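/- Let $X$ be a locally compact second countable Hausdorff space, $\mu$ a Radon measure on $X$ charging every non-empty open set, and $(\mathcal E,\mathcal F)$ a symmetric regular local Dirichlet form on $L_2(X,\mu)$. Write $\mathcal E(f)=\mathcal E(f,f)$, $\mathcal E_1(f)=\mathcal E(f)+\|f\|_{L_2(\mu)}^2$, let $C_0(X)$ be the continuous functions with compact support, and let $\mathcal C=C_0(X)\cap\mathcal F$. For $g,h\in\mathcal C$ let $\Gamma(g,h)$ be the energy measure, i.e. the unique finite signed Borel measure with $2\int_X f\,d\Gamma(g,h)=\mathcal E(fg,h)+\mathcal E(fh,g)-\mathcal E(gh,f)$ for all $f\in\mathcal C$; $\Gamma(f)=\Gamma(f,f)$. Let $m$ be a finite Borel measure on $X$ charging every non-empty open set, such that $\Gamma(f)\ll m$ for all $f\in\mathcal C$ (energy dominance), and $m(B)=0$ for each $B\subset X$ of zero $1$-capacity, where $\operatorname{cap}(A)=\inf\{\mathcal E_1(u):u\in\mathcal F,\ u\ge 1\ \mu\text{-a.e. on }A\}$ for open $A$ and $\operatorname{cap}(B)=\inf\{\operatorname{cap}(A):A\supset B\text{ open}\}$ in general. Fibers: choose a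 sequence $(f_n)\subset\mathcal C$ that is $\mathcal E$-dense in $\mathcal C$ and Borel versions $x\mapsto\Gamma_x(f_i,f_j)$ of $d\Gamma(f_i,f_j)/dm$ such that for every $x\in X$ the infinite matrix $(\Gamma_x(f_i,f_j))_{i,j}$ is symmetric and nonnegative definite. Let $\mathcal H_x$ be the Hilbert space completion, modulo null vectors, of the finite formal linear combinations $\sum_n c_nf_n$ with scalar product $\Gamma_x$, and denote by $d_xa$ the class of $a=\sum_n c_nf_n$ in $\mathcal H_x$. A section $v=(v_x)_{x\in X}$, $v_x\in\mathcal H_x$, is measurable if all $x\mapsto\langle v_x,d_xf_n\rangle_{\mathcal H_x}$ are Borel measurable; $L_p(X,m,(\mathcal H_x)_x)$ is the space of ($m$-a.e. classes of) measurable sections with norm $(\int_X\|v_x\|_{\mathcal H_x}^p\,m(dx))^{1/p}<\infty$. For $f\in\mathcal C$ the field $\partial f$ is the limit in $L_2(X,m,(\mathcal H_x)_x)$ of $x\mapsto d_xa_k$, for $a_k\in\operatorname{lin}\{f_n\}$ with $\Gamma(f-a_k)(X)\to0$. Let $\{\varphi_i\}_{i\in I}\subset\mathcal C$, $I\ne\emptyset$,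 be continuous coordinates for $\mathcal E$ with respect to $m$: the densities $d\Gamma(\varphi_i,\varphi_j)/dm$ lie in $L_1(X,m)\cap L_\infty(X,m)$ for all $i,j$, and the set $\mathcal FC_b^1$ of cylinder functions $F(\varphi_{i_1},\dots,\varphi_{i_k})$ with $k\in\mathbb N$, $i_1,\dots,i_k\in I$, $F\in C_b^1(\mathbb R^k)$, $F(0)=0$, is $\mathcal E_1$-dense in $\mathcal C$. Then, for any such choice of fibers and every $1<p<\infty$, $\mathcal S=\operatorname{lin}\{g\,\partial f: f,g\in\mathcal FC_b^1\}$ is a dense subspace of $L_p(X,m,(\mathcal H_x)_x)$. Moreover $\mathcal C_p:=\mathcal FC_b^1$ is a linear space contained in $\mathcal C\cap L_p(X,m)$ and satisfies: (COREI) $\mathcal C_p$ is dense in $L_p(X,m)$; (COREII) the image of $\mathcal C_p\otimes\mathcal C_p$ under $f\otimes g\mapsto g\,\partial f$ is a dense subspace of $L_p(X,m,(\mathcal H_x)_x)$; (COREIII) for all $f\in\mathcal C_p$, $\Gamma(f)\ll m$ with density $d\Gamma(f)/dm\in L_{p/2}(X,m)$. -/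

import Mathlib

open MeasureTheory Set Filter Topology
open scoped ENNReal CompactlySupported

/-- The class in `L²(X, μ)` of a continuous function with compact support, as a linear map. -/
noncomputable def ccToL2 {X : Type*} [TopologicalSpace X] [SecondCountableTopology X]
    [MeasurableSpace X] [BorelSpace X] (μ : Measure X) [IsFiniteMeasureOnCompacts μ] :
    C_c(X, ℝ) →ₗ[ℝ] Lp ℝ 2 μ where
  toFun f := (f.continuous.memLp_of_hasCompactSupport (p := 2) (μ := μ) f.hasCompactSupport).toLp
  map_add' _ _ := rfl
  map_smul' _ _ := rfl

/-- A symmetric Dirichlet form `(𝓔, 𝓕)` on the real space `L²(X, μ)`: a densely defined,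
nonnegative definite, symmetric bilinear form which is closed (complete for `𝓔₁ = 𝓔 + ‖·‖²`)
and Markovian (the unit contraction operates). -/
structure SymmDirichletForm {X : Type*} [MeasurableSpace X] (μ : Measure X) where
  domain : Submodule ℝ (Lp ℝ 2 μ)
  form : LinearMap.BilinForm ℝ domain
  symm : ∀ u v, form u v = form v u
  nonneg : ∀ u, 0 ≤ form u u
  dense : Dense (domain : Set (Lp ℝ 2 μ))
  closed : ∀ u : ℕ → domain,
    (∀ ε : ℝ, 0 < ε → ∃ N : ℕ, ∀ n ≥ N, ∀ k ≥ N,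
      form (u n - u k) (u n - u k) + ‖u n - u k‖ ^ 2 < ε) →
    ∃ v : domain, Tendsto (fun n => form (u n - v) (u n - v) + ‖u n - v‖ ^ 2) atTop (𝓝 0)
  markov : ∀ (u : domain) (v : Lp ℝ 2 μ),
    (v =ᵐ[μ] fun x => min (max ((u : Lp ℝ 2 μ) x) 0) 1) →
    ∃ hv : v ∈ domain, form ⟨v, hv⟩ ⟨v, hv⟩ ≤ form u u

namespace SymmDirichletForm

section Basic

variable {X : Type*} [MeasurableSpace X] {μ : Measure X}

/-- `𝓔₁(u) = 𝓔(u, u) + ‖u‖²` for `u ∈ 𝓕`. -/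
noncomputable def energyOne (E : SymmDirichletForm μ) (u : E.domain) : ℝ :=
  E.form u u + ‖u‖ ^ 2

open Classical in
/-- `𝓔(u, v)` for `u, v ∈ 𝓕`, extended by the value `0` outside `𝓕 × 𝓕`. -/
noncomputable def formExt (E : SymmDirichletForm μ) (u v : Lp ℝ 2 μ) : ℝ :=
  if h : u ∈ E.domain ∧ v ∈ E.domain then E.form ⟨u, h.1⟩ ⟨v, h.2⟩ else 0

variable [TopologicalSpace X]

/-- Locality: `𝓔(u, v) = 0` whenever `u, v ∈ 𝓕` have disjoint compact supports. -/
def IsLocal (E : SymmDirichletForm μ) : Prop :=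
  ∀ (u v : E.domain) (K L : Set X), IsCompact K → IsCompact L → Disjoint K L →
    (∀ᵐ x ∂μ, x ∉ K → (u : Lp ℝ 2 μ) x = 0) → (∀ᵐ x ∂μ, x ∉ L → (v : Lp ℝ 2 μ) x = 0) →
    E.form u v = 0

/-- The `1`-capacity of an open set (with `inf ∅ = ∞`). -/
noncomputable def capacityOpen (E : SymmDirichletForm μ) (A : Set X) : ℝ≥0∞ :=
  ⨅ (u : E.domain) (_ : ∀ᵐ x ∂μ, x ∈ A → 1 ≤ (u : Lp ℝ 2 μ) x), ENNReal.ofReal (E.energyOne u)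

/-- The `1`-capacity of an arbitrary set. -/
noncomputable def capacity (E : SymmDirichletForm μ) (B : Set X) : ℝ≥0∞ :=
  ⨅ (A : Set X) (_ : IsOpen A) (_ : B ⊆ A), E.capacityOpen A

end Basic

section Core

variable {X : Type*} [TopologicalSpace X] [SecondCountableTopology X]
  [MeasurableSpace X] [BorelSpace X] {μ : Measure X} [IsFiniteMeasureOnCompacts μ]

/-- `𝓒 = C₀(X) ∩ 𝓕`, where `C₀(X)` is the space of continuous functions with compact support. -/
noncomputable def core (E : SymmDirichletForm μ) : Submodule ℝ C_c(X, ℝ) :=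
  E.domain.comap (ccToL2 μ)

/-- The class in `𝓕` of an element of `𝓒`. -/
noncomputable def coreToDomain (E : SymmDirichletForm μ) (f : E.core) : E.domain :=
  ⟨ccToL2 μ f, f.2⟩

/-- Regularity: `𝓒` is `𝓔₁`-dense in `𝓕` and uniformly dense in `C₀(X)`. -/
def IsRegular (E : SymmDirichletForm μ) : Prop :=
  (∀ (u : E.domain) (ε : ℝ), 0 < ε → ∃ f : E.core, E.energyOne (u - E.coreToDomain f) < ε) ∧
  ∀ (h : C_c(X, ℝ)) (ε : ℝ), 0 < ε → ∃ f ∈ E.core, ∀ x, |h x - f x| < ε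

/-- `𝓔(f, g)` for continuous functions with compact support. On `𝓒` this is the form itself;
products of elements of `𝓒` lie in `𝓒`, so the value `0` given outside `𝓒` plays no role. -/
noncomputable def formCc (E : SymmDirichletForm μ) (f g : C_c(X, ℝ)) : ℝ :=
  E.formExt (ccToL2 μ f) (ccToL2 μ g)

/-- The finite signed measure `ν` is the (mutual) energy measure of `g` and `h`:
`2 ∫ f dν = 𝓔(fg, h) + 𝓔(fh, g) - 𝓔(gh, f)` for all `f ∈ 𝓒`. -/
def IsEnergyMeasure (E : SymmDirichletForm μ) (g h : C_c(X, ℝ)) (ν : SignedMeasure X) : Prop :=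
  ∀ f ∈ E.core, 2 * (∫ᵛ x, f x ∂•ν)
    = E.formCc (f * g) h + E.formCc (f * h) g - E.formCc (g * h) f

open Classical in
/-- The energy measure `Γ(g, h)` of `g, h ∈ 𝓒`. For a regular form on a locally compact second
countable Hausdorff space, existence and uniqueness of the measure chosen here are classical. -/
noncomputable def energyMeasure (E : SymmDirichletForm μ) (g h : C_c(X, ℝ)) : SignedMeasure X :=
  if H : ∃ ν : SignedMeasure X, E.IsEnergyMeasure g h ν then H.choose else 0

/-- The density `dΓ(g, h)/dm`. -/
noncomputable def energyDensity (E : SymmDirichletForm μ) (m : Measure X) (g h : C_c(X, ℝ)) :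
    X → ℝ :=
  (E.energyMeasure g h).rnDeriv m

/-- `m` is energy dominant: `Γ(f) ≪ m` for every `f ∈ 𝓒`. -/
def IsEnergyDominant (E : SymmDirichletForm μ) (m : Measure X) : Prop :=
  ∀ f ∈ E.core, E.energyMeasure f f ≪ᵥ m.toENNRealVectorMeasure

end Core

end SymmDirichletForm

/-- `F ∈ C_b¹(ℝᵏ)` with `F(0) = 0`. -/
def IsCbOneZero {k : ℕ} (F : (Fin k → ℝ) → ℝ) : Prop :=
  ContDiff ℝ 1 F ∧ (∃ C : ℝ, ∀ y, |F y| ≤ C ∧ ‖fderiv ℝ F y‖ ≤ C) ∧ F 0 = 0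

/-- The set `𝓕C_b¹(X, {φ_i})` of cylinder functions `F(φ_{i_1}, …, φ_{i_k})` with
`F ∈ C_b¹(ℝᵏ)`, `F(0) = 0`. -/
def cylinderFunctions {X I : Type*} [TopologicalSpace X] (φ : I → C_c(X, ℝ)) :
    Set C_c(X, ℝ) :=
  {f | ∃ (k : ℕ) (i : Fin k → I) (F : (Fin k → ℝ) → ℝ),
    IsCbOneZero F ∧ ∀ x, f x = F fun j => φ (i j) x}

namespace SymmDirichletForm

section Coordinates

variable {X : Type*} [TopologicalSpace X] [SecondCountableTopology X]
  [MeasurableSpace X] [BorelSpace X] {μ : Measure X} [IsFiniteMeasureOnCompacts μ]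

/-- `{φ_i}` is a set of continuous coordinates for `𝓔` with respect to `m`. -/
structure IsContinuousCoordinates (E : SymmDirichletForm μ) (m : Measure X) {I : Type*}
    (φ : I → C_c(X, ℝ)) : Prop where
  nonempty : Nonempty I
  mem_core : ∀ i, φ i ∈ E.core
  density : ∀ i j, MemLp (E.energyDensity m (φ i) (φ j)) 1 m ∧
    MemLp (E.energyDensity m (φ i) (φ j)) ∞ m
  dense : ∀ (g : E.core) (ε : ℝ), 0 < ε →
    ∃ f : E.core, (f : C_c(X, ℝ)) ∈ cylinderFunctions φ ∧
      E.energyOne (E.coreToDomain g - E.coreToDomain f) < ε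

/-- The choices entering the construction of the fibers: a countable family `(f_n)` which is
`𝓔`-dense in `𝓒`, and Borel versions `x ↦ Γ_x(f_i, f_j)` of the densities `dΓ(f_i, f_j)/dm`
such that for every `x` the matrix `(Γ_x(f_i, f_j))` is symmetric and nonnegative definite. -/
structure FiberChoice (E : SymmDirichletForm μ) (m : Measure X) where
  fn : ℕ → C_c(X, ℝ)
  fn_mem : ∀ n, fn n ∈ E.core
  fn_dense : ∀ f ∈ E.core, ∀ ε : ℝ, 0 < ε → ∃ n, E.formCc (f - fn n) (f - fn n) < ε
  Γx : ℕ → ℕ → X → ℝ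
  measurable : ∀ i j, Measurable (Γx i j)
  version : ∀ i j, Γx i j =ᵐ[m] E.energyDensity m (fn i) (fn j)
  symm : ∀ i j x, Γx i j x = Γx j i x
  nonneg : ∀ x (c : ℕ →₀ ℝ), 0 ≤ c.sum fun i a => c.sum fun j b => a * b * Γx i j x

namespace FiberChoice

variable {E : SymmDirichletForm μ} {m : Measure X}

/-- The bilinear form `Γ_x(∑ a_i f_i, ∑ b_j f_j) = ∑ a_i b_j Γ_x(f_i, f_j)`. -/
noncomputable def gammaAt (D : E.FiberChoice m) (x : X) (a b : ℕ →₀ ℝ) : ℝ :=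
  a.sum fun i s => b.sum fun j t => s * t * D.Γx i j x

theorem gammaAt_comm (D : E.FiberChoice m) (x : X) (a b : ℕ →₀ ℝ) :
    D.gammaAt x a b = D.gammaAt x b a := by
  simp only [gammaAt, Finsupp.sum]
  rw [Finset.sum_comm]
  refine Finset.sum_congr rfl fun i _ => Finset.sum_congr rfl fun j _ => ?_
  rw [D.symm j i x]; ring

theorem gammaAt_add (D : E.FiberChoice m) (x : X) (a b c : ℕ →₀ ℝ) :
    D.gammaAt x (a + b) c = D.gammaAt x a c + D.gammaAt x b c := by
  unfold gammaAt
  rw [Finsupp.sum_add_index']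
  · intro i; simp
  · intro i s t
    rw [← Finsupp.sum_add]
    exact Finsupp.sum_congr fun j _ => by ring

theorem gammaAt_smul (D : E.FiberChoice m) (x : X) (r : ℝ) (a b : ℕ →₀ ℝ) :
    D.gammaAt x (r • a) b = r * D.gammaAt x a b := by
  unfold gammaAt
  rw [Finsupp.sum_smul_index' (by intro i; simp), Finsupp.mul_sum]
  refine Finsupp.sum_congr fun i _ => ?_
  rw [Finsupp.mul_sum]
  exact Finsupp.sum_congr fun j _ => by simp only [smul_eq_mul]; ring

/-- `Γ_x` is a (possibly degenerate) scalar product. -/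
@[reducible]
noncomputable def gammaCore (D : E.FiberChoice m) (x : X) :
    PreInnerProductSpace.Core ℝ (ℕ →₀ ℝ) where
  inner a b := D.gammaAt x a b
  conj_inner_symm a b := D.gammaAt_comm x b a
  re_inner_nonneg a := D.nonneg x a
  add_left a b c := D.gammaAt_add x a b c
  smul_left a b r := D.gammaAt_smul x r a b

/-- Finite (formal) linear combinations of the `f_n`, equipped with the nonnegative definite
form `Γ_x`. -/
def PreFiber (_D : E.FiberChoice m) (_x : X) : Type := ℕ →₀ ℝ

noncomputable instance instSeminormedPreFiber (D : E.FiberChoice m) (x : X) :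
    SeminormedAddCommGroup (D.PreFiber x) :=
  @InnerProductSpace.Core.toSeminormedAddCommGroup ℝ (ℕ →₀ ℝ) _ _ _ (D.gammaCore x)

noncomputable instance instInnerPreFiber (D : E.FiberChoice m) (x : X) :
    InnerProductSpace ℝ (D.PreFiber x) :=
  @InnerProductSpace.ofCore ℝ (ℕ →₀ ℝ) _ _ _ (D.gammaCore x)

/-- The fiber `𝓗_x`: the Hilbert space completion of `lin {f_n} / ker Γ_x` with respect to `Γ_x`.
(`Completion` is the Hausdorff completion, so that `ker Γ_x` is factored out.) -/
abbrev Fiber (D : E.FiberChoice m) (x : X) : Type := UniformSpace.Completion (D.PreFiber x)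

/-- The section `x ↦ [a ⊗ 1]_x` (that is `x ↦ d_x a`) for a linear combination
`a = ∑ c_n f_n`. -/
noncomputable def diff (D : E.FiberChoice m) (c : ℕ →₀ ℝ) (x : X) : D.Fiber x :=
  ((show D.PreFiber x from c : D.PreFiber x) : UniformSpace.Completion (D.PreFiber x))

/-- The element `∑ c_n f_n` of `𝓒`. -/
noncomputable def comb (D : E.FiberChoice m) (c : ℕ →₀ ℝ) : C_c(X, ℝ) :=
  c.sum fun n a => a • D.fn n

/-- Measurable sections: `x ↦ ⟨v_x, [f_n ⊗ 1]_x⟩` is measurable for every `n`. -/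
def IsMeasurableSection (D : E.FiberChoice m) (v : ∀ x, D.Fiber x) : Prop :=
  ∀ n, Measurable fun x => inner ℝ (v x) (D.diff (Finsupp.single n 1) x)

/-- The norm of `L_p(X, m, (𝓗_x))`. -/
noncomputable def secNorm (D : E.FiberChoice m) (p : ℝ≥0∞) (v : ∀ x, D.Fiber x) : ℝ≥0∞ :=
  eLpNorm (fun x => ‖v x‖) p m

/-- `v` represents an element of `L_p(X, m, (𝓗_x))`. -/
def MemLpSection (D : E.FiberChoice m) (p : ℝ≥0∞) (v : ∀ x, D.Fiber x) : Prop :=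
  D.IsMeasurableSection v ∧ D.secNorm p v < ∞

/-- The section `ω` represents `∂f = f ⊗ 1`: it is the limit in `L_2(X, m, (𝓗_x))` of sections
`x ↦ [a ⊗ 1]_x` with `a ∈ lin {f_n}` and `‖∂f - ∂a‖²_𝓗 = Γ(f - a)(X) → 0`. -/
def IsDifferential (D : E.FiberChoice m) (f : C_c(X, ℝ)) (ω : ∀ x, D.Fiber x) : Prop :=
  D.MemLpSection 2 ω ∧
  ∀ ε : ℝ, 0 < ε → ∃ c : ℕ →₀ ℝ,
    E.energyMeasure (f - D.comb c) (f - D.comb c) univ < ε ∧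
    D.secNorm 2 (fun x => ω x - D.diff c x) < ENNReal.ofReal ε

open Classical in
/-- The section representing `∂f`, for `f ∈ 𝓒` (it exists and is unique up to `m`-null sets). -/
noncomputable def partialSection (D : E.FiberChoice m) (f : C_c(X, ℝ)) : ∀ x, D.Fiber x :=
  if H : ∃ ω, D.IsDifferential f ω then H.choose else 0

/-- `lin {g ∂f : f, g ∈ 𝓐}`, the image of `𝓐 ⊗ 𝓐` under `f ⊗ g ↦ g ∂f`. -/
noncomputable def simpleFields (D : E.FiberChoice m) (𝓐 : Set C_c(X, ℝ)) :
    Submodule ℝ (∀ x, D.Fiber x) :=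
  Submodule.span ℝ {v | ∃ f ∈ 𝓐, ∃ g ∈ 𝓐, v = fun x => g x • D.partialSection f x}

/-- `S` is (represents) a dense subspace of `L_p(X, m, (𝓗_x))`. -/
def IsDenseSubspace (D : E.FiberChoice m) (p : ℝ≥0∞) (S : Submodule ℝ (∀ x, D.Fiber x)) : Prop :=
  (∀ s ∈ S, D.MemLpSection p s) ∧
  ∀ v, D.MemLpSection p v → ∀ ε : ℝ≥0∞, 0 < ε →
    ∃ s ∈ S, D.secNorm p (fun x => v x - s x) < ε

/-- The conditions (COREI), (COREII), (COREIII) for the exponent `p` and a linear space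
`𝓒_p ⊆ 𝓒 ∩ L_p(X, m)`. -/
structure IsLpCore (D : E.FiberChoice m) (p : ℝ≥0∞) (Cp : Submodule ℝ C_c(X, ℝ)) : Prop where
  le_core : Cp ≤ E.core
  memLp : ∀ f ∈ Cp, MemLp f p m
  coreI : ∀ h : X → ℝ, MemLp h p m → ∀ ε : ℝ≥0∞, 0 < ε →
    ∃ f ∈ Cp, eLpNorm (fun x => h x - f x) p m < ε
  coreII : D.IsDenseSubspace p (D.simpleFields (Cp : Set C_c(X, ℝ)))
  coreIII : ∀ f ∈ Cp, E.energyMeasure f f ≪ᵥ m.toENNRealVectorMeasure ∧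
    MemLp (E.energyDensity m f f) (p / 2) m

end FiberChoice

end Coordinates

end SymmDirichletForm

/-! The proof rests on a contraction principle. Let `v` and finitely many `u_i` be continuous with
compact support, u_i ∈ 𝓒, (v(x) - v(y))² ≤ K Σ (u_i(x) - u_i(y))² and v(x)² ≤ K Σ u_i(x)². Then v ∈
𝓒, 𝓔(v) ≤ K Σ 𝓔(u_i), and Γ(v) ≤ K Σ Γ(u_i) as measures. A cylinder function F(φ_{i_1}, …) satisfies
this relative to its coordinates because F is Lipschitz and F(0) = 0; so it lies in 𝓒 and has a
bounded energy density, without recourse to a chain rule.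

The principle is proved for 𝓔^β(u, v) = β⟨u - βG_β u, v⟩ with G_β the resolvent. Since P = βG_β is
symmetric and sub-Markov, 𝓔^β is formally an integral of squared differences plus a killing term
(`carre_le_sum`, `formApprox_le_sum`), and β → ∞ gives the statement for 𝓔. The same approximation,
with the Riesz–Markov theorem, constructs the energy measures and compares them
(`exists_energyMeasure_self`, `energyMeasure_le_sum`).

(COREI): C_c(X) is dense in L_p and 𝓒 is uniformly dense in C_c(X), so it suffices to approximate g
∈ 𝓒. Take cylinder functions converging rapidly to g in 𝓔₁. A Borel–Cantelli argument for the
capacity gives pointwise convergence off a set of zero capacity, hence m-a.e.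
(`ae_tendsto_of_energyOne_le`). A smooth truncation makes the sequence uniformly bounded, and
dominated convergence concludes.

(COREII): ‖∂f‖ is m-a.e. the square root of dΓ(f)/dm (`IsDifferential.norm_ae_eq`), so ∂f is bounded
for cylinder f, and by (COREI) every h ∂f with h ∈ L_p is a limit of fields g ∂f. Countably many ∂f
span a dense subspace of almost every fiber (`exists_cylinder_dense_span`), and a measurable
selection argument then reaches all of L_p (`isApproximable_of_dense_span`). (COREIII) is the
boundedness of the density. -/

namespace SymmDirichletForm

/-! ### The resolvent and the approximating forms -/

section Resolvent

variable {X : Type*} [MeasurableSpace X] {μ : Measure X} (E : SymmDirichletForm μ)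

/-- The domain with the scalar product `𝓔(u, v) + (n + 1)⟨u, v⟩`. -/
def Hil (_n : ℕ) : Type _ := E.domain

noncomputable instance (n : ℕ) : AddCommGroup (E.Hil n) := inferInstanceAs (AddCommGroup E.domain)

noncomputable instance (n : ℕ) : Module ℝ (E.Hil n) := inferInstanceAs (Module ℝ E.domain)

/-- The identification of `Hil` with the domain. -/
noncomputable def toDom (n : ℕ) : E.Hil n ≃ₗ[ℝ] E.domain := LinearEquiv.refl ℝ E.domain

/-- The scalar product of `Hil`. -/
@[reducible]
noncomputable def hilCore (n : ℕ) : InnerProductSpace.Core ℝ (E.Hil n) where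
  inner u v := E.form (E.toDom n u) (E.toDom n v) + (n + 1) * inner ℝ (E.toDom n u) (E.toDom n v)
  conj_inner_symm u v := by
    simp only [conj_trivial]
    rw [E.symm, real_inner_comm]
  re_inner_nonneg u := by
    simp only [RCLike.re_to_real]
    have := E.nonneg (E.toDom n u)
    have h2 := real_inner_self_nonneg (x := E.toDom n u)
    positivity
  add_left u v w := by
    simp only [map_add, LinearMap.add_apply, inner_add_left]; ring
  smul_left u v r := by
    have h := real_inner_smul_left (E.toDom n u) (E.toDom n v) r
    simp only [map_smul, LinearMap.smul_apply, smul_eq_mul, conj_trivial]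
    rw [h]; ring
  definite u h := by
    have h1 := E.nonneg (E.toDom n u)
    have h2 := real_inner_self_nonneg (x := E.toDom n u)
    have h4 : inner ℝ (E.toDom n u) (E.toDom n u) = 0 := by nlinarith
    simpa using inner_self_eq_zero.1 h4

noncomputable instance (n : ℕ) : NormedAddCommGroup (E.Hil n) :=
  @InnerProductSpace.Core.toNormedAddCommGroup ℝ _ _ _ _ (E.hilCore n)

noncomputable instance (n : ℕ) : InnerProductSpace ℝ (E.Hil n) :=
  InnerProductSpace.ofCore (E.hilCore n).toCore

theorem hil_inner (n : ℕ) (u v : E.Hil n) : inner ℝ u v =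
    E.form (E.toDom n u) (E.toDom n v) + (n + 1) * inner ℝ (E.toDom n u) (E.toDom n v) := rfl

theorem hil_norm_sq (n : ℕ) (u : E.Hil n) :
    ‖u‖ ^ 2 = E.form (E.toDom n u) (E.toDom n u) + (n + 1) * ‖E.toDom n u‖ ^ 2 := by
  rw [← real_inner_self_eq_norm_sq, hil_inner, ← real_inner_self_eq_norm_sq]

theorem hil_zero_norm_sq (u : E.Hil 0) : ‖u‖ ^ 2 = E.energyOne (E.toDom 0 u) := by
  rw [hil_norm_sq]; simp [energyOne]

/-- Closedness for 𝓔₁ suffices, as 𝓔 + (n + 1)‖·‖² lies between 𝓔₁ and (n + 1)𝓔₁. -/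
instance (n : ℕ) : CompleteSpace (E.Hil n) := by
  refine Metric.complete_of_cauchySeq_tendsto fun u hu => ?_
  obtain ⟨v, hv⟩ := E.closed (fun k => E.toDom n (u k)) (by
    intro ε hε
    obtain ⟨N, hN⟩ := Metric.cauchySeq_iff.1 hu (Real.sqrt ε) (Real.sqrt_pos.2 hε)
    refine ⟨N, fun a ha b hb => ?_⟩
    have h := hN a ha b hb
    rw [dist_eq_norm, Real.lt_sqrt (norm_nonneg _), hil_norm_sq] at h
    simp only [map_sub (E.toDom n)] at h
    have h2 : (0 : ℝ) ≤ n * ‖E.toDom n (u a) - E.toDom n (u b)‖ ^ 2 := by positivity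
    linarith)
  refine ⟨(E.toDom n).symm v, ?_⟩
  rw [tendsto_iff_norm_sub_tendsto_zero]
  have key : Tendsto (fun k => ‖u k - (E.toDom n).symm v‖ ^ 2) atTop (𝓝 0) := by
    have h4 := hv.const_mul ((n : ℝ) + 1)
    rw [mul_zero] at h4
    refine squeeze_zero (fun k => by positivity) (fun k => ?_) h4
    rw [hil_norm_sq]
    simp only [map_sub (E.toDom n), LinearEquiv.apply_symm_apply]
    have h5 := E.nonneg (E.toDom n (u k) - v)
    have h6 : (0 : ℝ) ≤ n := n.cast_nonneg
    nlinarith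
  simpa using key.sqrt

/-- The inclusion of `Hil` into `L²`. -/
noncomputable def hilIncl (n : ℕ) : E.Hil n →L[ℝ] Lp ℝ 2 μ :=
  LinearMap.mkContinuous (E.domain.subtype ∘ₗ (E.toDom n).toLinearMap) 1 fun u => by
    rw [one_mul]
    refine le_of_sq_le_sq ?_ (norm_nonneg _)
    rw [hil_norm_sq]
    have h1 := E.nonneg (E.toDom n u)
    have h2 : (0 : ℝ) ≤ n * ‖E.toDom n u‖ ^ 2 := by positivity
    have h3 : ‖(E.domain.subtype ∘ₗ (E.toDom n).toLinearMap) u‖ = ‖E.toDom n u‖ := rfl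
    rw [h3]
    linarith

theorem hilIncl_apply (n : ℕ) (u : E.Hil n) : E.hilIncl n u = (E.toDom n u : Lp ℝ 2 μ) := rfl

/-- `β G_β` for `β = n + 1`, where `G_β` is the resolvent. -/
noncomputable def approx (n : ℕ) : Lp ℝ 2 μ →ₗ[ℝ] E.domain :=
  ((n : ℝ) + 1) • (E.toDom n).toLinearMap ∘ₗ
    (ContinuousLinearMap.adjoint (E.hilIncl n)).toLinearMap

theorem approx_apply (n : ℕ) (u : Lp ℝ 2 μ) :
    E.approx n u = ((n : ℝ) + 1) • E.toDom n (ContinuousLinearMap.adjoint (E.hilIncl n) u) := rfl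

/-- Adjointness to the inclusion is the resolvent equation 𝓔(G_β u, z) + β⟨G_β u, z⟩ = ⟨u, z⟩;
multiply by β and rearrange. -/
theorem form_approx (n : ℕ) (u : Lp ℝ 2 μ) (z : E.domain) :
    E.form (E.approx n u) z = (n + 1) * inner ℝ (u - E.approx n u) (z : Lp ℝ 2 μ) := by
  have h := ContinuousLinearMap.adjoint_inner_left (E.hilIncl n) ((E.toDom n).symm z) u
  rw [hil_inner, hilIncl_apply, LinearEquiv.apply_symm_apply, Submodule.coe_inner] at h
  rw [approx_apply, inner_sub_left, Submodule.coe_smul, real_inner_smul_left, ← h]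
  simp only [map_smul, LinearMap.smul_apply, smul_eq_mul]
  ring

variable {E}

theorem form_add_sq (u v : E.domain) :
    E.form (u + v) (u + v) = E.form u u + 2 * E.form u v + E.form v v := by
  simp only [map_add, LinearMap.add_apply, E.symm v u]; ring

theorem form_sub_sq (u v : E.domain) :
    E.form (u - v) (u - v) = E.form u u - 2 * E.form u v + E.form v v := by
  simp only [map_sub, LinearMap.sub_apply, E.symm v u]; ring

theorem form_cauchySchwarz (u v : E.domain) : E.form u v ^ 2 ≤ E.form u u * E.form v v := by
  have h : ∀ t : ℝ, 0 ≤ E.form v v * (t * t) + 2 * E.form u v * t + E.form u u := fun t => by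
    have := E.nonneg (u + t • v)
    rw [form_add_sq] at this
    simp only [map_smul, LinearMap.smul_apply, smul_eq_mul] at this
    linarith
  have := discrim_le_zero h
  rw [discrim] at this
  linarith

variable (E)

/-- The approximating forms `β ⟨u - β G_β u, v⟩`, `β = n + 1`. -/
noncomputable def formApprox (n : ℕ) (u v : Lp ℝ 2 μ) : ℝ :=
  (n + 1) * inner ℝ (u - E.approx n u) v

theorem formApprox_eq_form (n : ℕ) (u : Lp ℝ 2 μ) (v : E.domain) :
    E.formApprox n u v = E.form (E.approx n u) v := (E.form_approx n u v).symm

theorem inner_approx_comm (n : ℕ) (u v : Lp ℝ 2 μ) :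
    inner ℝ (E.approx n u : Lp ℝ 2 μ) v = inner ℝ u (E.approx n v : Lp ℝ 2 μ) := by
  have h1 := E.form_approx n u (E.approx n v)
  have h2 := E.form_approx n v (E.approx n u)
  rw [E.symm] at h1
  rw [h1, inner_sub_left, inner_sub_left, real_inner_comm (E.approx n u : Lp ℝ 2 μ) v,
    real_inner_comm (E.approx n u : Lp ℝ 2 μ) (E.approx n v)] at h2
  have h3 : (0 : ℝ) < n + 1 := by positivity
  have := mul_left_cancel₀ h3.ne' h2
  linarith

/-- Completing the square: `approx n u` is the unique minimiser of z ↦ 𝓔(z) + β‖z - u‖², and 𝓔^β(u,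
u) is the minimum. Monotonicity in β, the bound by 𝓔 and the Markov property of `approx` all follow
by inserting a suitable competitor z. -/
theorem form_add_norm_eq (n : ℕ) (u : Lp ℝ 2 μ) (z : E.domain) :
    E.form z z + (n + 1) * ‖(z : Lp ℝ 2 μ) - u‖ ^ 2 = E.formApprox n u u
      + E.form (z - E.approx n u) (z - E.approx n u)
      + (n + 1) * ‖(z : Lp ℝ 2 μ) - E.approx n u‖ ^ 2 := by
  have h1 := E.form_approx n u z
  have h2 := E.form_approx n u (E.approx n u)
  rw [form_sub_sq, formApprox, E.symm z (E.approx n u), h2, h1]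
  simp only [← real_inner_self_eq_norm_sq, inner_sub_left, inner_sub_right,
    real_inner_comm (E.approx n u : Lp ℝ 2 μ) u, real_inner_comm (E.approx n u : Lp ℝ 2 μ) z,
    real_inner_comm (z : Lp ℝ 2 μ) u]
  ring

theorem formApprox_self (n : ℕ) (u : Lp ℝ 2 μ) :
    E.formApprox n u u = E.form (E.approx n u) (E.approx n u)
      + (n + 1) * ‖(E.approx n u : Lp ℝ 2 μ) - u‖ ^ 2 := by
  rw [E.form_add_norm_eq n u (E.approx n u)]; simp

theorem formApprox_self_le (n : ℕ) (u : E.domain) : E.formApprox n u u ≤ E.form u u := by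
  have h := E.form_add_norm_eq n u u
  have h1 := E.nonneg (u - E.approx n u)
  have h2 : 0 ≤ ((n : ℝ) + 1) * ‖(u : Lp ℝ 2 μ) - E.approx n u‖ ^ 2 := by positivity
  simp only [sub_self, norm_zero] at h
  linarith

/-- The competitor is z = `approx k u` at level n; replacing n by k in front of ‖z - u‖² bounds its
value by `formApprox k u u`. This gives monotonicity and the Cauchy estimate at once. -/
theorem form_sub_add_norm_le {n k : ℕ} (hnk : n ≤ k) (u : Lp ℝ 2 μ) :
    E.form (E.approx k u - E.approx n u) (E.approx k u - E.approx n u)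
      + ‖E.approx k u - E.approx n u‖ ^ 2 ≤ E.formApprox k u u - E.formApprox n u u := by
  have h := E.form_add_norm_eq n u (E.approx k u)
  have h1 := E.formApprox_self k u
  have h2 : (n : ℝ) ≤ k := by exact_mod_cast hnk
  have h3 : (n : ℝ) * ‖(E.approx k u : Lp ℝ 2 μ) - u‖ ^ 2
    ≤ k * ‖(E.approx k u : Lp ℝ 2 μ) - u‖ ^ 2 := by gcongr
  have h4 : (0 : ℝ) ≤ n * ‖(E.approx k u : Lp ℝ 2 μ) - E.approx n u‖ ^ 2 := by positivity
  have h5 : ‖E.approx k u - E.approx n u‖ = ‖(E.approx k u : Lp ℝ 2 μ) - E.approx n u‖ := rfl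
  rw [h5]
  linarith

theorem formApprox_mono (u : Lp ℝ 2 μ) : Monotone fun n => E.formApprox n u u := by
  intro n k hnk
  have := E.form_sub_add_norm_le hnk u
  have h1 := E.nonneg (E.approx k u - E.approx n u)
  have h2 : 0 ≤ ‖E.approx k u - E.approx n u‖ ^ 2 := by positivity
  simp only
  linarith

/-- A bounded monotone sequence is Cauchy, so `approx n u` is 𝓔₁-Cauchy and closedness supplies a
limit in the domain. The limit is u because (n + 1)‖`approx n u` - u‖² ≤ C. -/
theorem tendsto_approx_of_bounded {u : Lp ℝ 2 μ} {C : ℝ} (hC : ∀ n, E.formApprox n u u ≤ C) :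
    ∃ h : u ∈ E.domain, Tendsto (fun n => E.form (E.approx n u - ⟨u, h⟩)
      (E.approx n u - ⟨u, h⟩)) atTop (𝓝 0) := by
  obtain ⟨a, ha⟩ := tendsto_atTop_of_monotone (E.formApprox_mono u) |>.resolve_left (by
    intro h
    obtain ⟨n, hn⟩ := (h.eventually (eventually_gt_atTop C)).exists
    exact (hC n).not_gt hn)
  have hcau := ha.cauchySeq
  obtain ⟨v, hv⟩ := E.closed (fun n => E.approx n u) (by
    intro ε hε
    obtain ⟨N, hN⟩ := Metric.cauchySeq_iff.1 hcau ε hε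
    refine ⟨N, fun k hk l hl => ?_⟩
    have h := hN k hk l hl
    rw [Real.dist_eq] at h
    rcases le_total l k with hlk | hlk
    · exact (E.form_sub_add_norm_le hlk u).trans_lt ((le_abs_self _).trans_lt h)
    · have h1 := (E.form_sub_add_norm_le hlk u).trans_lt
        ((le_abs_self _).trans_lt (by rwa [abs_sub_comm] at h))
      rw [form_sub_sq] at h1 ⊢
      rw [norm_sub_rev, E.symm (E.approx k u) (E.approx l u)]
      linarith)
  have hv2 : Tendsto (fun n => ((E.approx n u : E.domain) : Lp ℝ 2 μ)) atTop (𝓝 v) := by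
    rw [tendsto_iff_norm_sub_tendsto_zero]
    have : Tendsto (fun n => ‖E.approx n u - v‖ ^ 2) atTop (𝓝 0) :=
      squeeze_zero (fun n => by positivity)
        (fun n => le_add_of_nonneg_left (E.nonneg _)) hv
    simpa using this.sqrt
  have hu2 : Tendsto (fun n => ((E.approx n u : E.domain) : Lp ℝ 2 μ)) atTop (𝓝 u) := by
    rw [tendsto_iff_norm_sub_tendsto_zero]
    have h0 : Tendsto (fun n : ℕ => C * (1 / ((n : ℝ) + 1))) atTop (𝓝 0) := by
      simpa using tendsto_one_div_add_atTop_nhds_zero_nat.const_mul C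
    have : Tendsto (fun n => ‖(E.approx n u : Lp ℝ 2 μ) - u‖ ^ 2) atTop (𝓝 0) := by
      refine squeeze_zero (fun n => by positivity) (fun n => ?_) h0
      have h1 := hC n
      rw [formApprox_self] at h1
      have h2 := E.nonneg (E.approx n u)
      rw [mul_one_div, le_div_iff₀ (by positivity)]
      linarith
    simpa using this.sqrt
  have huv : (v : Lp ℝ 2 μ) = u := tendsto_nhds_unique hv2 hu2
  subst huv
  refine ⟨v.2, squeeze_zero (fun n => E.nonneg _) (fun n => ?_) hv⟩
  exact le_add_of_nonneg_right (by positivity)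

theorem tendsto_form_approx (u z : E.domain) :
    Tendsto (fun n => E.form (E.approx n u) z) atTop (𝓝 (E.form u z)) := by
  obtain ⟨h, h1⟩ := E.tendsto_approx_of_bounded (fun n => E.formApprox_self_le n u)
  rw [tendsto_iff_norm_sub_tendsto_zero]
  have h2 : Tendsto (fun n => Real.sqrt (E.form (E.approx n u - u) (E.approx n u - u)
    * E.form z z)) atTop (𝓝 0) := by simpa using (h1.mul_const (E.form z z)).sqrt
  refine squeeze_zero (fun n => norm_nonneg _) (fun n => ?_) h2
  refine Real.le_sqrt_of_sq_le ?_
  rw [Real.norm_eq_abs, sq_abs]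
  simpa using form_cauchySchwarz (E.approx n u - u) z

theorem tendsto_formApprox (u z : E.domain) :
    Tendsto (fun n => E.formApprox n u z) atTop (𝓝 (E.form u z)) := by
  simpa only [formApprox_eq_form] using E.tendsto_form_approx u z

theorem mem_domain_of_formApprox_le {u : Lp ℝ 2 μ} {C : ℝ} (hC : ∀ n, E.formApprox n u u ≤ C) :
    ∃ h : u ∈ E.domain, E.form ⟨u, h⟩ ⟨u, h⟩ ≤ C := by
  obtain ⟨h, -⟩ := E.tendsto_approx_of_bounded hC
  exact ⟨h, le_of_tendsto' (E.tendsto_formApprox ⟨u, h⟩ ⟨u, h⟩) hC⟩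

end Resolvent

end SymmDirichletForm

theorem Lp_coeFn_finsetSum {X ι : Type*} [MeasurableSpace X] {μ : Measure X} {p : ℝ≥0∞}
    (s : Finset ι) (f : ι → Lp ℝ p μ) :
    ((∑ i ∈ s, f i : Lp ℝ p μ) : X → ℝ) =ᵐ[μ] fun x => ∑ i ∈ s, f i x := by
  classical
  induction s using Finset.induction_on with
  | empty => simp only [Finset.sum_empty]; exact Lp.coeFn_zero ℝ p μ
  | insert a s ha ih =>
    rw [Finset.sum_insert ha]
    filter_upwards [Lp.coeFn_add (f a) (∑ i ∈ s, f i), ih] with x h1 h2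
    rw [h1, Pi.add_apply, h2, Finset.sum_insert ha]

namespace SymmDirichletForm

/-! ### Sub-Markov property of the resolvent -/

section Markov

variable {X : Type*} [MeasurableSpace X] {μ : Measure X} (E : SymmDirichletForm μ)

/-- Truncating the minimiser w to [0, 1] does not increase 𝓔, by the Markov property, nor the
distance to h, whose values lie in [0, 1]. By uniqueness of the minimiser, w equals its truncation.
-/
theorem approx_mem_unitInterval (n : ℕ) {h : Lp ℝ 2 μ} (h0 : ∀ᵐ x ∂μ, 0 ≤ h x)
    (h1 : ∀ᵐ x ∂μ, h x ≤ 1) :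
    ∀ᵐ x ∂μ, 0 ≤ (E.approx n h : Lp ℝ 2 μ) x ∧ (E.approx n h : Lp ℝ 2 μ) x ≤ 1 := by
  set w := E.approx n h with hw
  have hm : MemLp (fun x => min (max ((w : Lp ℝ 2 μ) x) 0) 1) 2 μ := by
    refine (Lp.memLp (w : Lp ℝ 2 μ)).of_le ?_ (Eventually.of_forall fun x => ?_)
    · exact ((Lp.aestronglyMeasurable _).sup aestronglyMeasurable_const).inf
        aestronglyMeasurable_const
    · rw [Real.norm_eq_abs, Real.norm_eq_abs, abs_of_nonneg (by positivity)]
      exact (min_le_left _ _).trans (max_le (le_abs_self _) (abs_nonneg _))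
  set v : Lp ℝ 2 μ := hm.toLp
  have hv : v =ᵐ[μ] fun x => min (max ((w : Lp ℝ 2 μ) x) 0) 1 := hm.coeFn_toLp
  obtain ⟨hvd, hle⟩ := E.markov w v hv
  have e1 := E.form_add_norm_eq n h ⟨v, hvd⟩
  have e2 := E.formApprox_self n h
  have e3 : ‖v - h‖ ≤ ‖(w : Lp ℝ 2 μ) - h‖ := by
    refine Lp.norm_le_norm_of_ae_le ?_
    filter_upwards [Lp.coeFn_sub v h, Lp.coeFn_sub (w : Lp ℝ 2 μ) h, hv, h0, h1]
      with x a1 a2 a3 a4 a5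
    rw [a1, a2, Pi.sub_apply, Pi.sub_apply, a3, Real.norm_eq_abs, Real.norm_eq_abs]
    refine abs_sub_le_iff.2 ⟨?_, ?_⟩
    · rcases le_total ((w : Lp ℝ 2 μ) x) 0 with hx | hx
      · rw [max_eq_right hx]
        have := neg_abs_le ((w : Lp ℝ 2 μ) x - h x)
        have := abs_nonneg ((w : Lp ℝ 2 μ) x - h x)
        have := min_le_left (0 : ℝ) 1
        linarith
      · rw [max_eq_left hx]
        have := le_abs_self ((w : Lp ℝ 2 μ) x - h x)
        have := min_le_left ((w : Lp ℝ 2 μ) x) 1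
        linarith
    · rcases le_total ((w : Lp ℝ 2 μ) x) 1 with hx | hx
      · have := neg_abs_le ((w : Lp ℝ 2 μ) x - h x)
        have : (w : Lp ℝ 2 μ) x ≤ min (max ((w : Lp ℝ 2 μ) x) 0) 1 :=
          le_min (le_max_left _ _) hx
        linarith
      · have := abs_nonneg ((w : Lp ℝ 2 μ) x - h x)
        have : 1 ≤ min (max ((w : Lp ℝ 2 μ) x) 0) 1 := le_min (hx.trans (le_max_left _ _)) le_rfl
        linarith
  have e4 : ((n : ℝ) + 1) * ‖v - h‖ ^ 2 ≤ (n + 1) * ‖(w : Lp ℝ 2 μ) - h‖ ^ 2 := by gcongr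
  have e5 := E.nonneg (⟨v, hvd⟩ - w)
  have e6 : ((n : ℝ) + 1) * ‖v - (w : Lp ℝ 2 μ)‖ ^ 2 ≤ 0 := by
    simp only [← hw] at e1 e2
    linarith
  have e7 : ‖v - (w : Lp ℝ 2 μ)‖ ^ 2 ≤ 0 := nonpos_of_mul_nonpos_right e6 (by positivity)
  have e8 : v = w := by
    have : ‖v - (w : Lp ℝ 2 μ)‖ = 0 := pow_eq_zero_iff (two_ne_zero) |>.1 (e7.antisymm (by positivity))
    exact sub_eq_zero.1 (norm_eq_zero.1 this)
  rw [e8] at hv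
  filter_upwards [hv] with x hx
  rw [hx]
  exact ⟨by positivity, min_le_right _ _⟩

theorem approx_mem_Icc (n : ℕ) {h : Lp ℝ 2 μ} {c : ℝ} (hc : 0 < c) (h0 : ∀ᵐ x ∂μ, 0 ≤ h x)
    (h1 : ∀ᵐ x ∂μ, h x ≤ c) :
    ∀ᵐ x ∂μ, 0 ≤ (E.approx n h : Lp ℝ 2 μ) x ∧ (E.approx n h : Lp ℝ 2 μ) x ≤ c := by
  have hs := Lp.coeFn_smul c⁻¹ h
  have key := E.approx_mem_unitInterval n (h := c⁻¹ • h)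
    (by filter_upwards [hs, h0] with x a b; rw [a]; simp only [Pi.smul_apply, smul_eq_mul]; positivity)
    (by
      filter_upwards [hs, h1] with x a b
      rw [a]; simp only [Pi.smul_apply, smul_eq_mul]
      rwa [inv_mul_le_iff₀ hc, mul_one])
  rw [map_smul, Submodule.coe_smul] at key
  filter_upwards [key, Lp.coeFn_smul c⁻¹ (E.approx n h : Lp ℝ 2 μ)] with x a b
  rw [b] at a
  simp only [Pi.smul_apply, smul_eq_mul] at a
  rw [inv_mul_le_iff₀ hc, mul_one] at a
  exact ⟨nonneg_of_mul_nonneg_right a.1 (by positivity), a.2⟩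

theorem approx_nonneg (n : ℕ) {h : Lp ℝ 2 μ} {M : ℝ} (hM : ∀ᵐ x ∂μ, h x ≤ M)
    (h0 : ∀ᵐ x ∂μ, 0 ≤ h x) : ∀ᵐ x ∂μ, 0 ≤ (E.approx n h : Lp ℝ 2 μ) x := by
  filter_upwards [E.approx_mem_Icc n (c := |M| + 1) (by positivity) h0
    (by filter_upwards [hM] with x hx; linarith [le_abs_self M])] with x hx using hx.1

/-- For c = 0 this is positivity applied to -h. For c > 0 one has h ≤ h⁺ ≤ c, and both h⁺ and h⁺ - h
are nonnegative. The bound `M` is there because positivity was obtained by rescaling to [0, 1]. -/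
theorem approx_le (n : ℕ) {h : Lp ℝ 2 μ} {M c : ℝ} (hM : ∀ᵐ x ∂μ, |h x| ≤ M) (hc : 0 ≤ c)
    (h1 : ∀ᵐ x ∂μ, h x ≤ c) : ∀ᵐ x ∂μ, (E.approx n h : Lp ℝ 2 μ) x ≤ c := by
  have hdec (a : Lp ℝ 2 μ) (g : Lp ℝ 2 μ) : ∀ᵐ x ∂μ, (E.approx n (a - g) : Lp ℝ 2 μ) x
      = (E.approx n a : Lp ℝ 2 μ) x - (E.approx n g : Lp ℝ 2 μ) x := by
    rw [map_sub, Submodule.coe_sub]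
    filter_upwards [Lp.coeFn_sub (E.approx n a : Lp ℝ 2 μ) (E.approx n g)] with x hx
    rw [hx, Pi.sub_apply]
  rcases hc.eq_or_lt with rfl | hc
  · have hn := Lp.coeFn_neg h
    have := E.approx_nonneg n (h := -h) (M := M)
      (by
        filter_upwards [hn, hM] with x a b
        rw [a, Pi.neg_apply]; exact (neg_le_abs _).trans b)
      (by filter_upwards [hn, h1] with x a b; rw [a, Pi.neg_apply]; linarith)
    have h2 := hdec 0 h
    rw [zero_sub, map_zero] at h2
    filter_upwards [this, h2, Lp.coeFn_zero ℝ 2 μ] with x a b c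
    rw [b, Submodule.coe_zero, c, Pi.zero_apply] at a
    linarith
  · have hp := Lp.coeFn_posPart h
    have hs := Lp.coeFn_sub (Lp.posPart h) h
    have k1 := E.approx_mem_Icc n (h := Lp.posPart h) hc
      (by filter_upwards [hp] with x a; rw [a]; exact le_max_right _ _)
      (by filter_upwards [hp, h1] with x a b; rw [a]; exact max_le b hc.le)
    have k2 := E.approx_nonneg n (h := Lp.posPart h - h) (M := 2 * M)
      (by
        filter_upwards [hp, hs, hM] with x a b c
        rw [b, Pi.sub_apply, a]
        have h3 : max (h x) 0 ≤ |h x| := max_le (le_abs_self _) (abs_nonneg _)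
        linarith [neg_abs_le (h x)])
      (by
        filter_upwards [hp, hs] with x a b
        rw [b, Pi.sub_apply, a]
        linarith [le_max_left (h x) 0])
    filter_upwards [k1, k2, hdec (Lp.posPart h) h] with x a b d
    rw [d] at b
    linarith [a.2]

/-- L¹-contraction is dual to P1 ≤ 1: for μ(s) < ∞, symmetry gives ∫_s P w = ⟨w, P 1_s⟩ ≤ ∫ w, and
σ-finiteness removes the restriction to s. -/
theorem approx_integral_le [SigmaFinite μ] (n : ℕ) {w : Lp ℝ 2 μ} {M : ℝ}
    (hM : ∀ᵐ x ∂μ, w x ≤ M) (h0 : ∀ᵐ x ∂μ, 0 ≤ w x) (hw : Integrable w μ) :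
    Integrable (E.approx n w : Lp ℝ 2 μ) μ ∧
      ∫ x, (E.approx n w : Lp ℝ 2 μ) x ∂μ ≤ ∫ x, w x ∂μ := by
  have hP := E.approx_nonneg n hM h0
  have key : ∫⁻ x, ENNReal.ofReal ((E.approx n w : Lp ℝ 2 μ) x) ∂μ
      ≤ ENNReal.ofReal (∫ x, w x ∂μ) := by
    refine lintegral_le_of_forall_fin_meas_le _ fun s hs hμs => ?_
    have : IsFiniteMeasure (μ.restrict s) := ⟨by simpa using hμs.lt_top⟩
    rw [← ofReal_integral_eq_lintegral_ofReal (((Lp.memLp _).restrict s).integrable (by norm_num))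
      (ae_restrict_of_ae hP)]
    refine ENNReal.ofReal_le_ofReal ?_
    rw [← L2.inner_indicatorConstLp_one (𝕜 := ℝ) hs hμs, ← inner_approx_comm, L2.inner_def]
    have h1 := E.approx_mem_unitInterval n (h := indicatorConstLp 2 hs hμs (1 : ℝ))
      (by
        filter_upwards [indicatorConstLp_coeFn (p := 2) (hs := hs) (hμs := hμs) (c := (1 : ℝ))]
          with x hx
        rw [hx]; exact indicator_nonneg (fun _ _ => zero_le_one) x)
      (by
        filter_upwards [indicatorConstLp_coeFn (p := 2) (hs := hs) (hμs := hμs) (c := (1 : ℝ))]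
          with x hx
        rw [hx]; exact indicator_le_self' (fun _ _ => zero_le_one) x)
    refine integral_mono_ae (L2.integrable_inner _ _) hw ?_
    filter_upwards [h1, h0] with x a b
    simp only [RCLike.inner_apply, conj_trivial]
    nlinarith [a.1, a.2]
  have hi : Integrable (E.approx n w : Lp ℝ 2 μ) μ := by
    refine ⟨Lp.aestronglyMeasurable _, ?_⟩
    rw [hasFiniteIntegral_iff_ofReal hP]
    exact key.trans_lt ENNReal.ofReal_lt_top
  refine ⟨hi, ?_⟩
  rw [← ofReal_integral_eq_lintegral_ofReal hi hP] at key
  exact (ENNReal.ofReal_le_ofReal_iff (integral_nonneg_of_ae h0)).1 key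

end Markov

end SymmDirichletForm

/-! ### Compactly supported continuous functions in L² -/

section CompactSupport

variable {X : Type*} [TopologicalSpace X] [SecondCountableTopology X]
    [MeasurableSpace X] [BorelSpace X] {μ : Measure X} [IsFiniteMeasureOnCompacts μ]

theorem coeFn_ccToL2 (f : C_c(X, ℝ)) : ccToL2 μ f =ᵐ[μ] f :=
  (f.continuous.memLp_of_hasCompactSupport (p := 2) (μ := μ) f.hasCompactSupport).coeFn_toLp

theorem exists_bound_cc {X : Type*} [TopologicalSpace X] (f : C_c(X, ℝ)) :
    ∃ M : ℝ, 0 < M ∧ ∀ x, |f x| ≤ M := by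
  obtain ⟨C, hC⟩ := f.continuous.bounded_above_of_compact_support f.hasCompactSupport
  exact ⟨|C| + 1, by positivity, fun x => (hC x).trans (by linarith [le_abs_self C])⟩

theorem integrable_cc_mul {X : Type*} [TopologicalSpace X]
    [MeasurableSpace X] [BorelSpace X] {μ : Measure X} [IsFiniteMeasureOnCompacts μ] (f : C_c(X, ℝ)) {g : X → ℝ} (hg : MemLp g 2 μ) :
    Integrable (fun x => f x * g x) μ :=
  (f.continuous.memLp_of_hasCompactSupport (p := 2) (μ := μ) f.hasCompactSupport).integrable_mul hg

theorem inner_ccToL2_left (f : C_c(X, ℝ)) (g : Lp ℝ 2 μ) :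
    inner ℝ (ccToL2 μ f) g = ∫ x, f x * g x ∂μ := by
  rw [L2.inner_def]
  refine integral_congr_ae ?_
  filter_upwards [coeFn_ccToL2 (μ := μ) f] with x hx
  simp [hx, mul_comm]

theorem inner_ccToL2_right (f : C_c(X, ℝ)) (g : Lp ℝ 2 μ) :
    inner ℝ g (ccToL2 μ f) = ∫ x, f x * g x ∂μ := by
  rw [real_inner_comm, inner_ccToL2_left]

theorem inner_ccToL2_ccToL2 (f g : C_c(X, ℝ)) :
    inner ℝ (ccToL2 μ f) (ccToL2 μ g) = ∫ x, f x * g x ∂μ := by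
  rw [inner_ccToL2_left]
  refine integral_congr_ae ?_
  filter_upwards [coeFn_ccToL2 (μ := μ) g] with x hx
  rw [hx]

end CompactSupport

namespace SymmDirichletForm

/-! ### Contraction estimates for the approximating forms -/

section Carre

variable {X : Type*} [TopologicalSpace X] [SecondCountableTopology X]
    [MeasurableSpace X] [BorelSpace X] {μ : Measure X} [IsFiniteMeasureOnCompacts μ]
    (E : SymmDirichletForm μ)

/-- `P u` with `P = β G_β`, `β = n + 1`, as a function. -/
noncomputable def approxFn (n : ℕ) (u : C_c(X, ℝ)) : X → ℝ := (E.approx n (ccToL2 μ u) : Lp ℝ 2 μ)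

theorem memLp_approxFn (n : ℕ) (u : C_c(X, ℝ)) : MemLp (E.approxFn n u) 2 μ := Lp.memLp _

theorem approxFn_le (n : ℕ) {u : C_c(X, ℝ)} {c : ℝ} (hc : 0 ≤ c) (h : ∀ x, u x ≤ c) :
    ∀ᵐ x ∂μ, E.approxFn n u x ≤ c := by
  obtain ⟨M, -, hM⟩ := exists_bound_cc u
  refine E.approx_le n (M := M) ?_ hc ?_
  · filter_upwards [coeFn_ccToL2 (μ := μ) u] with x hx
    rw [hx]; exact hM x
  · filter_upwards [coeFn_ccToL2 (μ := μ) u] with x hx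
    rw [hx]; exact h x

theorem approxFn_sub (n : ℕ) (u v : C_c(X, ℝ)) :
    E.approxFn n (u - v) =ᵐ[μ] E.approxFn n u - E.approxFn n v := by
  rw [approxFn, map_sub, map_sub, Submodule.coe_sub]
  exact Lp.coeFn_sub _ _

theorem approxFn_smul (n : ℕ) (c : ℝ) (u : C_c(X, ℝ)) :
    E.approxFn n (c • u) =ᵐ[μ] c • E.approxFn n u := by
  rw [approxFn, map_smul, map_smul, Submodule.coe_smul]
  exact Lp.coeFn_smul _ _

theorem approxFn_sum (n : ℕ) {ι : Type*} (s : Finset ι) (u : ι → C_c(X, ℝ)) :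
    E.approxFn n (∑ i ∈ s, u i) =ᵐ[μ] fun x => ∑ i ∈ s, E.approxFn n (u i) x := by
  rw [approxFn, map_sum, map_sum, Submodule.coe_sum]
  exact Lp_coeFn_finsetSum _ _

/-- The function `u² - 2 u P u + P(u²)`. -/
noncomputable def carre (n : ℕ) (u : C_c(X, ℝ)) (x : X) : ℝ :=
  u x ^ 2 - 2 * u x * E.approxFn n u x + E.approxFn n (u * u) x

/-- If P had a kernel p(x, dy), `carre n u x` would be ∫ (u(x) - u(y))² p(x, dy) + u(x)² (1 -
P1(x)), and `h1`, `h2` would compare the two terms separately. To avoid a kernel, u(x) is frozen at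
u(z), the sub-Markov bound is applied for each z in a countable dense set, and continuity in z
permits z = x. -/
theorem carre_le_sum (n : ℕ) {ι : Type*} [Fintype ι] {u : ι → C_c(X, ℝ)} {v : C_c(X, ℝ)} {K : ℝ}
    (h1 : ∀ x y, (v x - v y) ^ 2 ≤ K * ∑ i, (u i x - u i y) ^ 2)
    (h2 : ∀ x, v x ^ 2 ≤ K * ∑ i, u i x ^ 2) :
    ∀ᵐ x ∂μ, E.carre n v x ≤ K * ∑ i, E.carre n (u i) x := by
  obtain ⟨S, hS, hSd⟩ := TopologicalSpace.exists_countable_dense X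
  -- `h z x` is (v(x) - v(z))² - K Σ (u_i(x) - u_i(z))² plus the constant `c z`. Hence `h z ≤ c z`
  -- by `h1`, with `c z ≥ 0` by `h2`, as `approxFn_le` requires.
  let h : X → C_c(X, ℝ) := fun z =>
    (v * v - (2 * v z) • v) - K • ∑ i, (u i * u i - (2 * u i z) • u i)
  let G : X → X → ℝ := fun x z => (E.approxFn n (v * v) x - 2 * v z * E.approxFn n v x)
    - K * ∑ i, (E.approxFn n (u i * u i) x - 2 * u i z * E.approxFn n (u i) x)
  let c : X → ℝ := fun z => K * ∑ i, u i z ^ 2 - v z ^ 2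
  have hh : ∀ z, ∀ᵐ x ∂μ, E.approxFn n (h z) x = G x z := fun z => by
    have a1 := E.approxFn_sub n (v * v - (2 * v z) • v) (K • ∑ i, (u i * u i - (2 * u i z) • u i))
    have a2 := E.approxFn_sub n (v * v) ((2 * v z) • v)
    have a3 := E.approxFn_smul n (2 * v z) v
    have a4 := E.approxFn_smul n K (∑ i, (u i * u i - (2 * u i z) • u i))
    have a5 := E.approxFn_sum n Finset.univ fun i => (u i * u i - (2 * u i z) • u i)
    have a6 := eventually_countable_forall.2 fun i => E.approxFn_sub n (u i * u i) ((2 * u i z) • u i)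
    have a7 := eventually_countable_forall.2 fun i => E.approxFn_smul n (2 * u i z) (u i)
    filter_upwards [a1, a2, a3, a4, a5, a6, a7] with x b1 b2 b3 b4 b5 b6 b7
    simp only [h, G]
    simp only [b1, b2, b3, b4, b5, b6, b7, Pi.sub_apply, Pi.smul_apply, smul_eq_mul]
  have hle : ∀ z, ∀ᵐ x ∂μ, G x z ≤ c z := fun z => by
    have := E.approxFn_le n (u := h z) (c := c z) (sub_nonneg.2 (h2 z)) (fun x => by
      have := h1 x z
      have e : h z x = (v x - v z) ^ 2 - K * ∑ i, (u i x - u i z) ^ 2 + c z := by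
        simp only [h, c, CompactlySupportedContinuousMap.coe_sub, Pi.sub_apply,
          CompactlySupportedContinuousMap.mul_apply, CompactlySupportedContinuousMap.coe_smul,
          Pi.smul_apply, smul_eq_mul, CompactlySupportedContinuousMap.sum_apply, sub_sq,
          Finset.sum_add_distrib, Finset.sum_sub_distrib]
        have : ∀ i, u i x * u i x = u i x ^ 2 := fun i => by ring
        have h' : ∀ i, 2 * u i z * u i x = 2 * u i x * u i z := fun i => by ring
        simp only [this, h']
        ring
      linarith)
    filter_upwards [this, hh z] with x a b
    rwa [b] at a
  -- A single null set serves all z ∈ S. Off it, both sides are continuous in z, so the bound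
  -- extends to every z and in particular to z = x.
  have hall := (ae_ball_iff hS).2 fun z _ => hle z
  filter_upwards [hall] with x hx
  have hcl : IsClosed {z | G x z ≤ c z} := by
    refine isClosed_le ?_ ?_ <;> fun_prop
  have : x ∈ {z | G x z ≤ c z} := hcl.closure_subset_iff.2 (fun z hz => hx z hz) (hSd x)
  have hx' : G x x ≤ c x := this
  simp only [G, c] at hx'
  simp only [carre]
  have e : ∑ i, (u i x ^ 2 - 2 * u i x * E.approxFn n (u i) x + E.approxFn n (u i * u i) x)
    = ∑ i, u i x ^ 2 + ∑ i, (E.approxFn n (u i * u i) x - 2 * u i x * E.approxFn n (u i) x) := by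
    rw [← Finset.sum_add_distrib]
    exact Finset.sum_congr rfl fun i _ => by ring
  rw [e]
  linarith

theorem carre_nonneg (n : ℕ) (u : C_c(X, ℝ)) : ∀ᵐ x ∂μ, 0 ≤ E.carre n u x := by
  have h0 := E.carre_le_sum n (ι := Fin 1) (u := fun _ => u) (v := 0) (K := 1)
    (by intro x y; simp; positivity) (by intro x; simp; positivity)
  have h1 : E.approxFn n 0 =ᵐ[μ] 0 := by
    rw [approxFn, map_zero, map_zero, Submodule.coe_zero]; exact Lp.coeFn_zero _ _ _
  filter_upwards [h0, h1] with x a b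
  simpa [carre, b] using a

theorem integrable_approxFn_sq [SigmaFinite μ] (n : ℕ) {w : C_c(X, ℝ)} (hw : ∀ x, 0 ≤ w x) :
    Integrable (E.approxFn n w) μ ∧ ∫ x, E.approxFn n w x ∂μ ≤ ∫ x, w x ∂μ := by
  obtain ⟨M, -, hM⟩ := exists_bound_cc w
  have hc := coeFn_ccToL2 (μ := μ) w
  have := E.approx_integral_le n (w := ccToL2 μ w) (M := M)
    (by filter_upwards [hc] with x hx; rw [hx]; exact (le_abs_self _).trans (hM x))
    (by filter_upwards [hc] with x hx; rw [hx]; exact hw x)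
    (w.integrable.congr hc.symm)
  rwa [integral_congr_ae hc] at this

theorem integrable_mul_approxFn (n : ℕ) (u v : C_c(X, ℝ)) :
    Integrable (fun x => u x * E.approxFn n v x) μ := integrable_cc_mul u (E.memLp_approxFn n v)

theorem integrable_carre [SigmaFinite μ] (n : ℕ) (u : C_c(X, ℝ)) : Integrable (E.carre n u) μ := by
  have h1 := (E.integrable_approxFn_sq n (w := u * u) (fun x => mul_self_nonneg (u x))).1
  have h2 := (E.integrable_mul_approxFn n u u).const_mul 2
  have h3 : Integrable (u * u : C_c(X, ℝ)) μ := (u * u).integrable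
  refine ((h3.sub h2).add h1).congr (Eventually.of_forall fun x => ?_)
  simp [carre]; ring

theorem formApprox_ccToL2 (n : ℕ) (u v : C_c(X, ℝ)) :
    E.formApprox n (ccToL2 μ u) (ccToL2 μ v)
      = (n + 1) * (∫ x, u x * v x ∂μ - ∫ x, v x * E.approxFn n u x ∂μ) := by
  rw [formApprox, inner_sub_left, inner_ccToL2_ccToL2, inner_ccToL2_right]
  rfl

theorem integral_carre [SigmaFinite μ] (n : ℕ) (u : C_c(X, ℝ)) :
    ∫ x, E.carre n u x ∂μ = ∫ x, u x * u x ∂μ - 2 * ∫ x, u x * E.approxFn n u x ∂μ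
      + ∫ x, E.approxFn n (u * u) x ∂μ := by
  have h1 := (E.integrable_approxFn_sq n (w := u * u) (fun x => mul_self_nonneg (u x))).1
  have h2 := (E.integrable_mul_approxFn n u u).const_mul 2
  have h3 : Integrable (fun x => u x * u x) μ := (u * u).integrable
  rw [← integral_const_mul, ← integral_sub h3 h2,
    ← integral_add (show Integrable (fun x => u x * u x - 2 * (u x * E.approxFn n u x)) μ from
      h3.sub h2) h1]
  refine integral_congr_ae (Eventually.of_forall fun x => ?_)
  simp [carre]; ring

theorem integral_carre_le [SigmaFinite μ] (n : ℕ) (u : C_c(X, ℝ)) :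
    (n + 1) / 2 * ∫ x, E.carre n u x ∂μ ≤ E.formApprox n (ccToL2 μ u) (ccToL2 μ u) := by
  have h1 := (E.integrable_approxFn_sq n (w := u * u) (fun x => mul_self_nonneg (u x))).2
  rw [integral_carre, formApprox_ccToL2]
  simp only [CompactlySupportedContinuousMap.mul_apply] at h1
  have : (0 : ℝ) ≤ (n + 1) / 2 := by positivity
  nlinarith

/-- 𝓔^β(u, u) = (β/2) (∫ `carre n u` + ∫ (u² - P(u²))). The first part is compared by
`carre_le_sum`, the second by the L¹-contraction applied to K Σ u_i² - v² ≥ 0. -/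
theorem formApprox_le_sum [SigmaFinite μ] (n : ℕ) {ι : Type*} [Fintype ι] {u : ι → C_c(X, ℝ)} {v : C_c(X, ℝ)}
    {K : ℝ} (h1 : ∀ x y, (v x - v y) ^ 2 ≤ K * ∑ i, (u i x - u i y) ^ 2)
    (h2 : ∀ x, v x ^ 2 ≤ K * ∑ i, u i x ^ 2) :
    E.formApprox n (ccToL2 μ v) (ccToL2 μ v)
      ≤ K * ∑ i, E.formApprox n (ccToL2 μ (u i)) (ccToL2 μ (u i)) := by
  have hsq (w : C_c(X, ℝ)) : Integrable (E.approxFn n (w * w)) μ :=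
    (E.integrable_approxFn_sq n (w := w * w) (fun x => mul_self_nonneg (w x))).1
  have c1 : ∫ x, E.carre n v x ∂μ ≤ K * ∑ i, ∫ x, E.carre n (u i) x ∂μ := by
    rw [← integral_finsetSum _ fun i _ => E.integrable_carre n (u i), ← integral_const_mul]
    exact integral_mono_ae (E.integrable_carre n v)
      ((integrable_finsetSum _ fun i _ => E.integrable_carre n (u i)).const_mul K)
      (E.carre_le_sum n h1 h2)
  have c2 := (E.integrable_approxFn_sq n (w := K • ∑ i, u i * u i - v * v) (fun x => by
    have := h2 x
    simp only [CompactlySupportedContinuousMap.coe_sub, Pi.sub_apply,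
      CompactlySupportedContinuousMap.mul_apply, CompactlySupportedContinuousMap.coe_smul,
      Pi.smul_apply, smul_eq_mul, CompactlySupportedContinuousMap.sum_apply, ← sq]
    linarith)).2
  have e1 : ∫ x, E.approxFn n (K • ∑ i, u i * u i - v * v) x ∂μ
      = K * ∑ i, ∫ x, E.approxFn n (u i * u i) x ∂μ - ∫ x, E.approxFn n (v * v) x ∂μ := by
    rw [← integral_finsetSum _ fun i _ => hsq (u i), ← integral_const_mul,
      ← integral_sub ((integrable_finsetSum _ fun i _ => hsq (u i)).const_mul K) (hsq v)]
    refine integral_congr_ae ?_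
    filter_upwards [E.approxFn_sub n (K • ∑ i, u i * u i) (v * v),
      E.approxFn_smul n K (∑ i, u i * u i), E.approxFn_sum n Finset.univ fun i => u i * u i]
      with x b1 b2 b3
    rw [b1, Pi.sub_apply, b2, Pi.smul_apply, b3, smul_eq_mul]
  have e2 : ∫ x, (K • ∑ i, u i * u i - v * v : C_c(X, ℝ)) x ∂μ
      = K * ∑ i, ∫ x, u i x * u i x ∂μ - ∫ x, v x * v x ∂μ := by
    have hi (w : C_c(X, ℝ)) : Integrable (fun x => w x * w x) μ := (w * w).integrable
    rw [← integral_finsetSum _ fun i _ => hi (u i), ← integral_const_mul,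
      ← integral_sub ((integrable_finsetSum _ fun i _ => hi (u i)).const_mul K) (hi v)]
    refine integral_congr_ae (Eventually.of_forall fun x => ?_)
    simp
  rw [e1, e2] at c2
  simp only [integral_carre, Finset.sum_add_distrib, Finset.sum_sub_distrib,
    ← Finset.mul_sum] at c1
  simp only [formApprox_ccToL2, ← Finset.mul_sum, Finset.sum_sub_distrib]
  have : (0 : ℝ) < n + 1 := by positivity
  rw [mul_left_comm]
  refine mul_le_mul_of_nonneg_left ?_ this.le
  linarith

/-- The approximate energy functional. -/
noncomputable def energyApprox (n : ℕ) (u f : C_c(X, ℝ)) : ℝ :=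
  (n + 1) / 2 * ∫ x, f x * E.carre n u x ∂μ

theorem integrable_mul_carre [SigmaFinite μ] (n : ℕ) (u f : C_c(X, ℝ)) :
    Integrable (fun x => f x * E.carre n u x) μ := by
  obtain ⟨M, -, hM⟩ := exists_bound_cc f
  exact (E.integrable_carre n u).bdd_mul f.continuous.aestronglyMeasurable
    (Eventually.of_forall hM)

/-- This is the defining formula of Γ(u) with 𝓔^β in place of 𝓔; symmetry of P turns ∫ u P(fu) into
∫ f u Pu. -/
theorem energyApprox_eq [SigmaFinite μ] (n : ℕ) (u f : C_c(X, ℝ)) :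
    E.energyApprox n u f = E.formApprox n (ccToL2 μ (f * u)) (ccToL2 μ u)
      - 1 / 2 * E.formApprox n (ccToL2 μ (u * u)) (ccToL2 μ f) := by
  have e0 : ∫ x, u x * E.approxFn n (f * u) x ∂μ = ∫ x, f x * (u x * E.approxFn n u x) ∂μ := by
    have := E.inner_approx_comm n (ccToL2 μ (f * u)) (ccToL2 μ u)
    rw [inner_ccToL2_right, inner_ccToL2_left] at this
    rw [approxFn, this]
    simp [approxFn, mul_assoc]
  have i1 : Integrable (fun x => f x * (u x * u x)) μ := (f * (u * u)).integrable
  have i2 : Integrable (fun x => f x * (u x * E.approxFn n u x)) μ := by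
    simpa [mul_assoc] using E.integrable_mul_approxFn n (f * u) u
  have i3 := E.integrable_mul_approxFn n f (u * u)
  have e1 : ∫ x, f x * E.carre n u x ∂μ = ∫ x, f x * (u x * u x) ∂μ
      - 2 * ∫ x, f x * (u x * E.approxFn n u x) ∂μ + ∫ x, f x * E.approxFn n (u * u) x ∂μ := by
    rw [← integral_const_mul, ← integral_sub i1 (i2.const_mul 2),
      ← integral_add (show Integrable (fun x => f x * (u x * u x)
        - 2 * (f x * (u x * E.approxFn n u x))) μ from i1.sub (i2.const_mul 2)) i3]
    refine integral_congr_ae (Eventually.of_forall fun x => ?_)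
    simp only [carre]; ring
  rw [energyApprox, e1, formApprox_ccToL2, formApprox_ccToL2, e0]
  have e2 : ∫ x, (f * u : C_c(X, ℝ)) x * u x ∂μ = ∫ x, f x * (u x * u x) ∂μ := by
    simp [mul_assoc]
  have e3 : ∫ x, (u * u : C_c(X, ℝ)) x * f x ∂μ = ∫ x, f x * (u x * u x) ∂μ := by
    simp [mul_comm]
  rw [e2, e3]
  ring

theorem energyApprox_add [SigmaFinite μ] (n : ℕ) (u f g : C_c(X, ℝ)) :
    E.energyApprox n u (f + g) = E.energyApprox n u f + E.energyApprox n u g := by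
  simp only [energyApprox, ← mul_add]
  rw [← integral_add (E.integrable_mul_carre n u f) (E.integrable_mul_carre n u g)]
  simp [add_mul]

theorem energyApprox_smul (n : ℕ) (u f : C_c(X, ℝ)) (c : ℝ) :
    E.energyApprox n u (c • f) = c * E.energyApprox n u f := by
  simp only [energyApprox]
  rw [mul_left_comm, ← integral_const_mul c]
  simp [mul_assoc]

theorem energyApprox_nonneg (n : ℕ) (u : C_c(X, ℝ)) {f : C_c(X, ℝ)} (hf : ∀ x, 0 ≤ f x) :
    0 ≤ E.energyApprox n u f := by
  refine mul_nonneg (by positivity) (integral_nonneg_of_ae ?_)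
  filter_upwards [E.carre_nonneg n u] with x hx using mul_nonneg (hf x) hx

theorem abs_energyApprox_le [SigmaFinite μ] (n : ℕ) (u : C_c(X, ℝ)) {f : C_c(X, ℝ)} {M : ℝ}
    (hf : ∀ x, |f x| ≤ M) :
    |E.energyApprox n u f| ≤ M * E.formApprox n (ccToL2 μ u) (ccToL2 μ u) := by
  -- Nonnegativity of M is read off at a point, so the empty space is treated apart.
  rcases isEmpty_or_nonempty X with hX | ⟨⟨x₀⟩⟩
  · have : u = 0 := by ext x; exact isEmptyElim x
    simp [energyApprox, formApprox, this, integral_of_isEmpty]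
  have hM : 0 ≤ M := (abs_nonneg _).trans (hf x₀)
  refine le_trans ?_ (mul_le_mul_of_nonneg_left (E.integral_carre_le n u) hM)
  rw [energyApprox, abs_mul, abs_of_nonneg (by positivity : (0 : ℝ) ≤ (n + 1) / 2), mul_left_comm]
  refine mul_le_mul_of_nonneg_left ?_ (by positivity)
  rw [← integral_const_mul, ← Real.norm_eq_abs]
  refine norm_integral_le_of_norm_le ((E.integrable_carre n u).const_mul M) ?_
  filter_upwards [E.carre_nonneg n u] with x hx
  rw [norm_mul, Real.norm_eq_abs, Real.norm_eq_abs, abs_of_nonneg hx]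
  exact mul_le_mul_of_nonneg_right (hf x) hx

theorem energyApprox_le_sum [SigmaFinite μ] (n : ℕ) {ι : Type*} [Fintype ι] {u : ι → C_c(X, ℝ)} {v : C_c(X, ℝ)}
    {K : ℝ} (h1 : ∀ x y, (v x - v y) ^ 2 ≤ K * ∑ i, (u i x - u i y) ^ 2)
    (h2 : ∀ x, v x ^ 2 ≤ K * ∑ i, u i x ^ 2) {f : C_c(X, ℝ)} (hf : ∀ x, 0 ≤ f x) :
    E.energyApprox n v f ≤ K * ∑ i, E.energyApprox n (u i) f := by
  simp only [energyApprox, ← Finset.mul_sum]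
  rw [mul_left_comm]
  refine mul_le_mul_of_nonneg_left ?_ (by positivity)
  have hi := fun i => E.integrable_mul_carre n (u i) f
  rw [← integral_finsetSum _ fun i _ => hi i, ← integral_const_mul]
  refine integral_mono_ae (E.integrable_mul_carre n v f)
      ((integrable_finsetSum _ fun i _ => hi i).const_mul K) ?_
  filter_upwards [E.carre_le_sum n h1 h2] with x hx
  have := mul_le_mul_of_nonneg_left hx (hf x)
  simp only [← Finset.mul_sum]
  linarith

end Carre

end SymmDirichletForm

/-! ### Integrals against signed measures and Riesz representation -/

section SignedIntegral

variable {X : Type*} [MeasurableSpace X]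

theorem vectorIntegral_toSignedMeasure {ν : Measure X} [IsFiniteMeasure ν] (f : X → ℝ) :
    ∫ᵛ x, f x ∂•ν.toSignedMeasure = ∫ x, f x ∂ν := by
  rw [← VectorMeasure.integral_toSignedMeasure]
  congr 1
  ext
  simp

instance isFiniteMeasure_variation_signedMeasure (ν : SignedMeasure X) :
    IsFiniteMeasure ν.variation := by
  rw [← SignedMeasure.totalVariation_eq_variation]; infer_instance

variable [TopologicalSpace X] [BorelSpace X]

theorem vectorIntegrable_cc (ν : SignedMeasure X) (f : C_c(X, ℝ)) :
    VectorMeasure.Integrable ν f := f.integrable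

theorem vectorIntegral_sub_toSignedMeasure (ν ρ : Measure X) [IsFiniteMeasure ν]
    [IsFiniteMeasure ρ] (f : C_c(X, ℝ)) :
    ∫ᵛ x, f x ∂•(ν.toSignedMeasure - ρ.toSignedMeasure) = ∫ x, f x ∂ν - ∫ x, f x ∂ρ := by
  rw [VectorMeasure.integral_sub_vectorMeasure (vectorIntegrable_cc _ f) (vectorIntegrable_cc _ f),
    vectorIntegral_toSignedMeasure, vectorIntegral_toSignedMeasure]

theorem measure_regular [T2Space X] [LocallyCompactSpace X] [SecondCountableTopology X]
    (ν : Measure X) [IsFiniteMeasure ν] : ν.Regular := by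
  let _ := TopologicalSpace.pseudoMetrizableSpacePseudoMetric X
  infer_instance

/-- Riesz–Markov. The mass is controlled by inner regularity on the open set X: each compact set is
dominated by a cutoff with values in [0, 1], to which `hC` applies. -/
theorem exists_measure_of_positive [T2Space X] [LocallyCompactSpace X]
    (L : C_c(X, ℝ) →ₗ[ℝ] ℝ) (hL : ∀ f : C_c(X, ℝ), (∀ x, 0 ≤ f x) → 0 ≤ L f) {C : ℝ}
    (hC : ∀ f : C_c(X, ℝ), (∀ x, |f x| ≤ 1) → L f ≤ C) :
    ∃ ν : Measure X, IsFiniteMeasure ν ∧ (∀ f : C_c(X, ℝ), ∫ x, f x ∂ν = L f) ∧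
      ν univ ≤ ENNReal.ofReal C := by
  let Λ : C_c(X, ℝ) →ₚ[ℝ] ℝ := PositiveLinearMap.mk₀ L fun f hf => hL f hf
  have huniv : RealRMK.rieszMeasure Λ univ ≤ ENNReal.ofReal C := by
    rw [isOpen_univ.measure_eq_iSup_isCompact]
    refine iSup₂_le fun K _ => iSup_le fun hK => ?_
    obtain ⟨f, hf1, hf2, -, hf3⟩ :=
      exists_continuousMap_one_of_isCompact_subset_isOpen hK isOpen_univ (subset_univ K)
    let g : C_c(X, ℝ) := ⟨f, hasCompactSupport_def.mpr hf2⟩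
    refine (RealRMK.rieszMeasure_le_of_eq_one Λ (f := g) (fun x => (hf3 x).1) hK
      (fun x hx => hf1 hx)).trans (ENNReal.ofReal_le_ofReal ?_)
    exact hC g fun x => abs_le.2 ⟨by linarith [(hf3 x).1, show g x = f x from rfl], (hf3 x).2⟩
  exact ⟨RealRMK.rieszMeasure Λ, ⟨huniv.trans_lt ENNReal.ofReal_lt_top⟩,
    fun f => RealRMK.integral_rieszMeasure Λ f, huniv⟩

end SignedIntegral

namespace SymmDirichletForm

/-! ### The contraction principle on the core and the energy functionals -/

section Core

variable {X : Type*} [TopologicalSpace X] [SecondCountableTopology X]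
    [MeasurableSpace X] [BorelSpace X] {μ : Measure X} [IsFiniteMeasureOnCompacts μ]
    {E : SymmDirichletForm μ}

theorem formCc_eq {f g : C_c(X, ℝ)} (hf : f ∈ E.core) (hg : g ∈ E.core) :
    E.formCc f g = E.form ⟨ccToL2 μ f, hf⟩ ⟨ccToL2 μ g, hg⟩ := by
  have : ccToL2 μ f ∈ E.domain ∧ ccToL2 μ g ∈ E.domain := ⟨hf, hg⟩
  rw [formCc, formExt, dif_pos this]

theorem formCc_comm (f g : C_c(X, ℝ)) : E.formCc f g = E.formCc g f := by
  unfold formCc formExt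
  by_cases h : ccToL2 μ f ∈ E.domain ∧ ccToL2 μ g ∈ E.domain
  · rw [dif_pos h, dif_pos h.symm, E.symm]
  · rw [dif_neg h, dif_neg (fun h' => h h'.symm)]

theorem formCc_self_nonneg (f : C_c(X, ℝ)) : 0 ≤ E.formCc f f := by
  unfold formCc formExt
  split_ifs with h
  · exact E.nonneg _
  · exact le_rfl

theorem formCc_add_left {f g h : C_c(X, ℝ)} (hf : f ∈ E.core) (hg : g ∈ E.core)
    (hh : h ∈ E.core) : E.formCc (f + g) h = E.formCc f h + E.formCc g h := by
  rw [formCc_eq (E.core.add_mem hf hg) hh, formCc_eq hf hh, formCc_eq hg hh,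
    ← LinearMap.add_apply, ← map_add]
  congr 2

theorem formCc_smul_left (c : ℝ) {f h : C_c(X, ℝ)} (hf : f ∈ E.core)
    (hh : h ∈ E.core) : E.formCc (c • f) h = c * E.formCc f h := by
  rw [formCc_eq (E.core.smul_mem c hf) hh, formCc_eq hf hh, ← smul_eq_mul,
    ← LinearMap.smul_apply, ← map_smul]
  congr 2

theorem formCc_sub_left {f g h : C_c(X, ℝ)} (hf : f ∈ E.core) (hg : g ∈ E.core)
    (hh : h ∈ E.core) : E.formCc (f - g) h = E.formCc f h - E.formCc g h := by
  rw [formCc_eq (E.core.sub_mem hf hg) hh, formCc_eq hf hh, formCc_eq hg hh,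
    ← LinearMap.sub_apply, ← map_sub]
  congr 2

theorem formCc_add_right {f g h : C_c(X, ℝ)} (hf : f ∈ E.core) (hg : g ∈ E.core)
    (hh : h ∈ E.core) : E.formCc h (f + g) = E.formCc h f + E.formCc h g := by
  rw [formCc_comm, formCc_add_left hf hg hh, formCc_comm f, formCc_comm g]

theorem formCc_sub_right {f g h : C_c(X, ℝ)} (hf : f ∈ E.core) (hg : g ∈ E.core)
    (hh : h ∈ E.core) : E.formCc h (f - g) = E.formCc h f - E.formCc h g := by
  rw [formCc_comm, formCc_sub_left hf hg hh, formCc_comm f, formCc_comm g]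

theorem formCc_smul_right (c : ℝ) {f h : C_c(X, ℝ)} (hf : f ∈ E.core)
    (hh : h ∈ E.core) : E.formCc h (c • f) = c * E.formCc h f := by
  rw [formCc_comm, formCc_smul_left c hf hh, formCc_comm f]

theorem tendsto_formApprox_formCc {f g : C_c(X, ℝ)} (hf : f ∈ E.core) (hg : g ∈ E.core) :
    Tendsto (fun n => E.formApprox n (ccToL2 μ f) (ccToL2 μ g)) atTop (𝓝 (E.formCc f g)) := by
  rw [formCc_eq hf hg]
  exact E.tendsto_formApprox ⟨_, hf⟩ ⟨_, hg⟩

theorem formApprox_le_formCc (n : ℕ) {f : C_c(X, ℝ)} (hf : f ∈ E.core) :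
    E.formApprox n (ccToL2 μ f) (ccToL2 μ f) ≤ E.formCc f f := by
  rw [formCc_eq hf hf]
  exact E.formApprox_self_le n ⟨_, hf⟩

variable [SigmaFinite μ]

/-- The bound for 𝓔^β is uniform in β; such a bound both places v in the domain and survives the
limit. -/
theorem exists_form_le_of_contraction {ι : Type*} [Fintype ι] {u : ι → C_c(X, ℝ)} {v : C_c(X, ℝ)}
    {K : ℝ} (hK : 0 ≤ K) (hu : ∀ i, u i ∈ E.core)
    (h1 : ∀ x y, (v x - v y) ^ 2 ≤ K * ∑ i, (u i x - u i y) ^ 2)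
    (h2 : ∀ x, v x ^ 2 ≤ K * ∑ i, u i x ^ 2) :
    v ∈ E.core ∧ E.formCc v v ≤ K * ∑ i, E.formCc (u i) (u i) := by
  obtain ⟨h, hle⟩ := E.mem_domain_of_formApprox_le (u := ccToL2 μ v)
    (C := K * ∑ i, E.formCc (u i) (u i)) fun n => (E.formApprox_le_sum n h1 h2).trans (by
      gcongr with i
      exact formApprox_le_formCc n (hu i))
  exact ⟨h, by rwa [formCc_eq h h]⟩

theorem mem_core_of_contraction {ι : Type*} [Fintype ι] {u : ι → C_c(X, ℝ)} {v : C_c(X, ℝ)} {K : ℝ}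
    (hK : 0 ≤ K) (hu : ∀ i, u i ∈ E.core)
    (h1 : ∀ x y, (v x - v y) ^ 2 ≤ K * ∑ i, (u i x - u i y) ^ 2)
    (h2 : ∀ x, v x ^ 2 ≤ K * ∑ i, u i x ^ 2) : v ∈ E.core :=
  (exists_form_le_of_contraction hK hu h1 h2).1

theorem abs_mem_core {f g : C_c(X, ℝ)} (hf : f ∈ E.core) (hg : ∀ x, g x = |f x|) :
    g ∈ E.core ∧ E.formCc g g ≤ E.formCc f f := by
  have := exists_form_le_of_contraction (ι := Fin 1) (u := fun _ => f) (v := g) zero_le_one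
    (fun _ => hf) (fun x y => by
      simp only [hg, Finset.univ_unique, Finset.sum_singleton, one_mul]
      exact sq_le_sq.2 (abs_abs_sub_abs_le _ _)) (fun x => by simp [hg])
  simpa using this

theorem mul_mem_core {f g : C_c(X, ℝ)} (hf : f ∈ E.core) (hg : g ∈ E.core) : f * g ∈ E.core := by
  obtain ⟨M, hM0, hM⟩ := exists_bound_cc f
  obtain ⟨N, hN0, hN⟩ := exists_bound_cc g
  have hM2 (x : X) : f x ^ 2 ≤ M ^ 2 := sq_le_sq' (by linarith [neg_abs_le (f x), hM x])
    ((le_abs_self _).trans (hM x))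
  have hN2 (x : X) : g x ^ 2 ≤ N ^ 2 := sq_le_sq' (by linarith [neg_abs_le (g x), hN x])
    ((le_abs_self _).trans (hN x))
  -- K comes from (a + b)² ≤ 2(a² + b²) applied to f(x)(g(x) - g(y)) + g(y)(f(x) - f(y)).
  refine mem_core_of_contraction (ι := Fin 2) (u := ![f, g]) (K := 2 * (M ^ 2 + N ^ 2))
    (by positivity) (fun i => by fin_cases i <;> assumption) (fun x y => ?_) (fun x => ?_)
  · simp only [CompactlySupportedContinuousMap.mul_apply, Fin.sum_univ_two, Matrix.cons_val_zero,
      Matrix.cons_val_one]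
    have e : f x * g x - f y * g y = f x * (g x - g y) + g y * (f x - f y) := by ring
    rw [e]
    have := mul_le_mul_of_nonneg_right (hM2 x) (sq_nonneg (g x - g y))
    have := mul_le_mul_of_nonneg_right (hN2 y) (sq_nonneg (f x - f y))
    have := add_sq_le (a := f x * (g x - g y)) (b := g y * (f x - f y))
    have : 0 ≤ M ^ 2 * (f x - f y) ^ 2 := by positivity
    have : 0 ≤ N ^ 2 * (g x - g y) ^ 2 := by positivity
    nlinarith
  · simp only [CompactlySupportedContinuousMap.mul_apply, Fin.sum_univ_two, Matrix.cons_val_zero,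
      Matrix.cons_val_one]
    have := mul_le_mul_of_nonneg_right (hM2 x) (sq_nonneg (g x))
    have : 0 ≤ M ^ 2 * f x ^ 2 := by positivity
    have : 0 ≤ M ^ 2 * g x ^ 2 := by positivity
    have : 0 ≤ N ^ 2 * f x ^ 2 := by positivity
    have : 0 ≤ N ^ 2 * g x ^ 2 := by positivity
    nlinarith

/-- The limit of the approximate energy functionals along an ultrafilter. -/
noncomputable def energyLim (E : SymmDirichletForm μ) (u f : C_c(X, ℝ)) : ℝ :=
  limUnder (hyperfilter ℕ : Filter ℕ) fun n => E.energyApprox n u f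

/-- Convergence of 𝓔^β is known only on the domain, while the Riesz theorem needs a functional on
all of C_c(X). The approximants are bounded by sup|f| · 𝓔(u), so they converge along an ultrafilter,
and such limits are linear in f. For f ∈ 𝓒 the limit is the ordinary one (`energyLim_eq`). -/
theorem tendsto_energyLim {u : C_c(X, ℝ)} (hu : u ∈ E.core) (f : C_c(X, ℝ)) :
    Tendsto (fun n => E.energyApprox n u f) (hyperfilter ℕ) (𝓝 (E.energyLim u f)) := by
  refine tendsto_nhds_limUnder ?_
  obtain ⟨M, hM0, hM⟩ := exists_bound_cc f
  have hb (n : ℕ) : E.energyApprox n u f ∈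
      Icc (-(M * E.formCc u u)) (M * E.formCc u u) := by
    refine abs_le.1 ((E.abs_energyApprox_le n u hM).trans ?_)
    exact mul_le_mul_of_nonneg_left (formApprox_le_formCc n hu) hM0.le
  have hc : IsCompact (Icc (-(M * E.formCc u u)) (M * E.formCc u u)) := isCompact_Icc
  obtain ⟨x, -, hx⟩ := hc.ultrafilter_le_nhds
    ((hyperfilter ℕ).map fun n => E.energyApprox n u f)
    (by
      rw [Ultrafilter.coe_map]
      exact le_principal_iff.2 (mem_map.2 (Eventually.of_forall hb)))
  exact ⟨x, hx⟩

theorem energyLim_eq {u f : C_c(X, ℝ)} (hu : u ∈ E.core) (hf : f ∈ E.core) :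
    E.energyLim u f = E.formCc (f * u) u - 1 / 2 * E.formCc (u * u) f := by
  refine tendsto_nhds_unique (tendsto_energyLim hu f) ?_
  simp only [energyApprox_eq]
  exact ((tendsto_formApprox_formCc (mul_mem_core hf hu) hu).sub
    ((tendsto_formApprox_formCc (mul_mem_core hu hu) hf).const_mul (1 / 2))).mono_left
    Nat.hyperfilter_le_atTop

theorem energyLim_nonneg {u : C_c(X, ℝ)} (hu : u ∈ E.core) {f : C_c(X, ℝ)} (hf : ∀ x, 0 ≤ f x) :
    0 ≤ E.energyLim u f :=
  ge_of_tendsto' (tendsto_energyLim hu f) fun n => E.energyApprox_nonneg n u hf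

theorem energyLim_le {u : C_c(X, ℝ)} (hu : u ∈ E.core) {f : C_c(X, ℝ)} (hf : ∀ x, |f x| ≤ 1) :
    E.energyLim u f ≤ E.formCc u u := by
  refine le_of_tendsto' (tendsto_energyLim hu f) fun n => ?_
  refine (le_abs_self _).trans ((E.abs_energyApprox_le n u hf).trans ?_)
  rw [one_mul]
  exact formApprox_le_formCc n hu

theorem energyLim_le_sum {ι : Type*} [Fintype ι] {u : ι → C_c(X, ℝ)} {v : C_c(X, ℝ)} {K : ℝ}
    (hu : ∀ i, u i ∈ E.core) (hv : v ∈ E.core)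
    (h1 : ∀ x y, (v x - v y) ^ 2 ≤ K * ∑ i, (u i x - u i y) ^ 2)
    (h2 : ∀ x, v x ^ 2 ≤ K * ∑ i, u i x ^ 2) {f : C_c(X, ℝ)} (hf : ∀ x, 0 ≤ f x) :
    E.energyLim v f ≤ K * ∑ i, E.energyLim (u i) f :=
  le_of_tendsto_of_tendsto' (tendsto_energyLim hv f)
    ((tendsto_finsetSum _ fun i _ => tendsto_energyLim (hu i) f).const_mul K)
    fun n => E.energyApprox_le_sum n h1 h2 hf

/-- `energyLim` as a linear functional. -/
noncomputable def energyLinear {u : C_c(X, ℝ)} (hu : u ∈ E.core) : C_c(X, ℝ) →ₗ[ℝ] ℝ where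
  toFun f := E.energyLim u f
  map_add' f g := by
    refine tendsto_nhds_unique (tendsto_energyLim hu (f + g)) ?_
    simp only [energyApprox_add]
    exact (tendsto_energyLim hu f).add (tendsto_energyLim hu g)
  map_smul' c f := by
    refine tendsto_nhds_unique (tendsto_energyLim hu (c • f)) ?_
    simp only [energyApprox_smul]
    exact (tendsto_energyLim hu f).const_mul c

end Core

/-! ### Existence, uniqueness, bilinearity and comparison of energy measures -/

section EnergyMeasure

variable {X : Type*} [TopologicalSpace X] [T2Space X] [LocallyCompactSpace X]
    [SecondCountableTopology X]
    [MeasurableSpace X] [BorelSpace X] {μ : Measure X} [IsFiniteMeasureOnCompacts μ]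
    {E : SymmDirichletForm μ}

theorem exists_energyMeasure_self {u : C_c(X, ℝ)} (hu : u ∈ E.core) :
    ∃ ν : Measure X, IsFiniteMeasure ν ∧ (∀ f : C_c(X, ℝ), ∫ x, f x ∂ν = E.energyLim u f) ∧
      ν univ ≤ ENNReal.ofReal (E.formCc u u) :=
  exists_measure_of_positive (energyLinear hu) (fun _ hf => energyLim_nonneg hu hf)
    (fun _ hf => energyLim_le hu hf)

/-- The Jordan parts of ν - ρ have equal integrals on 𝓒, hence on C_c(X) by uniform density and
finite mass, hence they coincide as regular measures. -/
theorem signedMeasure_ext_of_core (hreg : E.IsRegular) {ν ρ : SignedMeasure X}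
    (h : ∀ f ∈ E.core, ∫ᵛ x, f x ∂•ν = ∫ᵛ x, f x ∂•ρ) : ν = ρ := by
  let j := (ν - ρ).toJordanDecomposition
  have hj : j.posPart.toSignedMeasure - j.negPart.toSignedMeasure = ν - ρ :=
    SignedMeasure.toSignedMeasure_toJordanDecomposition _
  have h0 : ∀ f ∈ E.core, ∫ x, f x ∂j.posPart = ∫ x, f x ∂j.negPart := fun f hf => by
    have := vectorIntegral_sub_toSignedMeasure j.posPart j.negPart f
    rw [hj, VectorMeasure.integral_sub_vectorMeasure (vectorIntegrable_cc _ f)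
      (vectorIntegrable_cc _ f), h f hf, sub_self] at this
    linarith
  have hcc (f : C_c(X, ℝ)) : ∫ x, f x ∂j.posPart = ∫ x, f x ∂j.negPart := by
    rw [← sub_eq_zero, ← abs_nonpos_iff]
    refine le_of_forall_pos_le_add fun ε hε => ?_
    set C := j.posPart.real univ + j.negPart.real univ + 1
    have hC : 0 < C := by positivity
    obtain ⟨g, hg, hfg⟩ := hreg.2 f (ε / C) (by positivity)
    have hb (ν : Measure X) [IsFiniteMeasure ν] :
        |∫ x, f x ∂ν - ∫ x, g x ∂ν| ≤ ε / C * ν.real univ := by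
      rw [← integral_sub f.integrable g.integrable, ← Real.norm_eq_abs]
      exact norm_integral_le_of_norm_le_const (Eventually.of_forall fun x => (hfg x).le)
    have b1 := abs_le.1 (hb j.posPart)
    have b2 := abs_le.1 (hb j.negPart)
    have b3 := h0 g hg
    have b4 : ε / C * C = ε := div_mul_cancel₀ _ hC.ne'
    have b5 : 0 < ε / C := by positivity
    have b6 : ε / C * C = ε / C * j.posPart.real univ + ε / C * j.negPart.real univ + ε / C := by
      simp only [C]; ring
    exact abs_le.2 ⟨by linarith, by linarith⟩
  have := measure_regular j.posPart
  have := measure_regular j.negPart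
  have heq : j.posPart = j.negPart := Measure.ext_of_integral_eq_on_compactlySupported hcc
  refine sub_eq_zero.1 ?_
  rw [← hj, sub_eq_zero]
  congr 1

theorem exists_isEnergyMeasure {g h : C_c(X, ℝ)} (hg : g ∈ E.core) (hh : h ∈ E.core) :
    ∃ ν : SignedMeasure X, E.IsEnergyMeasure g h ν := by
  have ha := E.core.add_mem hg hh
  have hs := E.core.sub_mem hg hh
  obtain ⟨ν, _, hν, -⟩ := exists_energyMeasure_self ha
  obtain ⟨ρ, _, hρ, -⟩ := exists_energyMeasure_self hs
  -- Polarisation: Γ(g, h) = (Γ(g + h) - Γ(g - h)) / 4.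
  refine ⟨(1 / 4 : ℝ) • (ν.toSignedMeasure - ρ.toSignedMeasure), fun f hf => ?_⟩
  rw [VectorMeasure.integral_smul_vectorMeasure, vectorIntegral_sub_toSignedMeasure, hν, hρ,
    energyLim_eq ha hf, energyLim_eq hs hf]
  have m1 := mul_mem_core hf hg
  have m2 := mul_mem_core hf hh
  have m3 := mul_mem_core hg hg
  have m4 := mul_mem_core hg hh
  have m5 := mul_mem_core hh hg
  have m6 := mul_mem_core hh hh
  have e1 : f * (g + h) = f * g + f * h := by ext x; simp [mul_add]
  have e2 : f * (g - h) = f * g - f * h := by ext x; simp [mul_sub]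
  have e3 : (g + h) * (g + h) = g * g + g * h + (g * h + h * h) := by ext x; simp; ring
  have e4 : (g - h) * (g - h) = g * g - g * h - (g * h - h * h) := by ext x; simp; ring
  rw [e1, e2, e3, e4, formCc_add_left m1 m2 ha, formCc_sub_left m1 m2 hs,
    formCc_add_left (E.core.add_mem m3 m4) (E.core.add_mem m4 m6) hf,
    formCc_add_left m3 m4 hf, formCc_add_left m4 m6 hf,
    formCc_sub_left (E.core.sub_mem m3 m4) (E.core.sub_mem m4 m6) hf,
    formCc_sub_left m3 m4 hf, formCc_sub_left m4 m6 hf,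
    formCc_add_right hg hh m1, formCc_add_right hg hh m2,
    formCc_sub_right hg hh m1, formCc_sub_right hg hh m2]
  simp only [smul_eq_mul]
  ring

theorem isEnergyMeasure_energyMeasure {g h : C_c(X, ℝ)} (hg : g ∈ E.core) (hh : h ∈ E.core) :
    E.IsEnergyMeasure g h (E.energyMeasure g h) := by
  have H := exists_isEnergyMeasure hg hh
  rw [energyMeasure, dif_pos H]
  exact H.choose_spec

theorem IsEnergyMeasure.unique (hreg : E.IsRegular) {g h : C_c(X, ℝ)} {ν ρ : SignedMeasure X}
    (h1 : E.IsEnergyMeasure g h ν) (h2 : E.IsEnergyMeasure g h ρ) : ν = ρ := by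
  refine signedMeasure_ext_of_core hreg fun f hf => ?_
  have := (h1 f hf).trans (h2 f hf).symm
  linarith

theorem IsEnergyMeasure.eq_energyMeasure (hreg : E.IsRegular) {g h : C_c(X, ℝ)} (hg : g ∈ E.core)
    (hh : h ∈ E.core) {ν : SignedMeasure X} (hν : E.IsEnergyMeasure g h ν) :
    E.energyMeasure g h = ν :=
  (isEnergyMeasure_energyMeasure hg hh).unique hreg hν

theorem energyMeasure_comm (hreg : E.IsRegular) {g h : C_c(X, ℝ)} (hg : g ∈ E.core)
    (hh : h ∈ E.core) : E.energyMeasure g h = E.energyMeasure h g := by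
  refine IsEnergyMeasure.eq_energyMeasure hreg hg hh fun f hf => ?_
  rw [isEnergyMeasure_energyMeasure hh hg f hf]
  have : g * h = h * g := by ext x; simp [mul_comm]
  rw [this]; ring

theorem energyMeasure_add_left (hreg : E.IsRegular) {g g' h : C_c(X, ℝ)} (hg : g ∈ E.core)
    (hg' : g' ∈ E.core) (hh : h ∈ E.core) :
    E.energyMeasure (g + g') h = E.energyMeasure g h + E.energyMeasure g' h := by
  refine IsEnergyMeasure.eq_energyMeasure hreg (E.core.add_mem hg hg') hh fun f hf => ?_
  rw [VectorMeasure.integral_add_vectorMeasure (vectorIntegrable_cc _ f) (vectorIntegrable_cc _ f),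
    mul_add, isEnergyMeasure_energyMeasure hg hh f hf, isEnergyMeasure_energyMeasure hg' hh f hf]
  have e1 : f * (g + g') = f * g + f * g' := by ext x; simp [mul_add]
  have e2 : (g + g') * h = g * h + g' * h := by ext x; simp [add_mul]
  rw [e1, e2, formCc_add_left (mul_mem_core hf hg) (mul_mem_core hf hg') hh,
    formCc_add_left (mul_mem_core hg hh) (mul_mem_core hg' hh) hf,
    formCc_add_right hg hg' (mul_mem_core hf hh)]
  ring

theorem energyMeasure_smul_left (hreg : E.IsRegular) (c : ℝ) {g h : C_c(X, ℝ)} (hg : g ∈ E.core)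
    (hh : h ∈ E.core) : E.energyMeasure (c • g) h = c • E.energyMeasure g h := by
  refine IsEnergyMeasure.eq_energyMeasure hreg (E.core.smul_mem c hg) hh fun f hf => ?_
  rw [VectorMeasure.integral_smul_vectorMeasure, smul_eq_mul, mul_left_comm,
    isEnergyMeasure_energyMeasure hg hh f hf]
  have e1 : f * (c • g) = c • (f * g) := by ext x; simp; ring
  have e2 : (c • g) * h = c • (g * h) := by ext x; simp; ring
  rw [e1, e2, formCc_smul_left c (mul_mem_core hf hg) hh,
    formCc_smul_left c (mul_mem_core hg hh) hf,
    formCc_smul_right c hg (mul_mem_core hf hh)]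
  ring

theorem vectorIntegral_energyMeasure_self {u f : C_c(X, ℝ)} (hu : u ∈ E.core) (hf : f ∈ E.core) :
    ∫ᵛ x, f x ∂•(E.energyMeasure u u) = E.energyLim u f := by
  have h := isEnergyMeasure_energyMeasure hu hu f hf
  rw [energyLim_eq hu hf]
  linarith

theorem energyMeasure_self_eq (hreg : E.IsRegular) {u : C_c(X, ℝ)} (hu : u ∈ E.core) :
    ∃ ν : Measure X, ∃ _ : IsFiniteMeasure ν, E.energyMeasure u u = ν.toSignedMeasure ∧
      ν univ ≤ ENNReal.ofReal (E.formCc u u) := by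
  obtain ⟨ν, hfin, hν, hle⟩ := exists_energyMeasure_self hu
  refine ⟨ν, hfin, signedMeasure_ext_of_core hreg fun f hf => ?_, hle⟩
  rw [vectorIntegral_energyMeasure_self hu hf, vectorIntegral_toSignedMeasure, hν]

theorem energyMeasure_self_nonneg (hreg : E.IsRegular) {u : C_c(X, ℝ)} (hu : u ∈ E.core)
    {s : Set X} (hs : MeasurableSet s) : 0 ≤ E.energyMeasure u u s := by
  obtain ⟨ν, _, hν, -⟩ := energyMeasure_self_eq hreg hu
  rw [hν]
  exact Measure.zero_le_toSignedMeasure ν s hs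

theorem energyMeasure_univ_le (hreg : E.IsRegular) {u : C_c(X, ℝ)} (hu : u ∈ E.core) :
    E.energyMeasure u u univ ≤ E.formCc u u := by
  obtain ⟨ν, _, hν, hle⟩ := energyMeasure_self_eq hreg hu
  rw [hν, Measure.toSignedMeasure_apply_measurable MeasurableSet.univ]
  exact ENNReal.toReal_le_of_le_ofReal (formCc_self_nonneg u) hle

/-- The difference of the functionals is positive and bounded, hence given by a positive measure; by
uniqueness that measure is K Σ Γ(u_i) - Γ(v). -/
theorem energyMeasure_le_sum (hreg : E.IsRegular) {ι : Type*} [Fintype ι] {u : ι → C_c(X, ℝ)}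
    {v : C_c(X, ℝ)} {K : ℝ} (hK : 0 ≤ K)
    (hu : ∀ i, u i ∈ E.core) (hv : v ∈ E.core)
    (h1 : ∀ x y, (v x - v y) ^ 2 ≤ K * ∑ i, (u i x - u i y) ^ 2)
    (h2 : ∀ x, v x ^ 2 ≤ K * ∑ i, u i x ^ 2) {s : Set X} (hs : MeasurableSet s) :
    E.energyMeasure v v s ≤ K * ∑ i, E.energyMeasure (u i) (u i) s := by
  obtain ⟨ν, _, hν, -⟩ := exists_measure_of_positive
    (K • ∑ i, energyLinear (hu i) - energyLinear hv)
    (C := K * ∑ i, E.formCc (u i) (u i) + E.formCc v v)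
    (fun f hf => by
      have := energyLim_le_sum hu hv h1 h2 hf
      simp only [LinearMap.sub_apply, LinearMap.smul_apply, LinearMap.sum_apply, smul_eq_mul]
      exact sub_nonneg.2 this)
    (fun f hf => by
      simp only [LinearMap.sub_apply, LinearMap.smul_apply, LinearMap.sum_apply, smul_eq_mul]
      have a1 : ∑ i, energyLinear (hu i) f ≤ ∑ i, E.formCc (u i) (u i) :=
        Finset.sum_le_sum fun i _ => energyLim_le (hu i) hf
      have a2 := energyLim_le hv (f := -f) (by simpa using hf)
      have a3 : E.energyLim v (-f) = - energyLinear hv f := map_neg (energyLinear hv) f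
      have := mul_le_mul_of_nonneg_left a1 hK
      linarith)
  have key : K • ∑ i, E.energyMeasure (u i) (u i) - E.energyMeasure v v = ν.toSignedMeasure := by
    refine signedMeasure_ext_of_core hreg fun f hf => ?_
    rw [VectorMeasure.integral_sub_vectorMeasure (vectorIntegrable_cc _ f)
      (vectorIntegrable_cc _ f), VectorMeasure.integral_smul_vectorMeasure,
      VectorMeasure.integral_finsetSum_vectorMeasure fun i _ => vectorIntegrable_cc _ f,
      vectorIntegral_toSignedMeasure, hν, vectorIntegral_energyMeasure_self hv hf]
    simp only [fun i => vectorIntegral_energyMeasure_self (hu i) hf]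
    simp [energyLinear]
  have h0 := Measure.zero_le_toSignedMeasure ν s hs
  rw [← key] at h0
  simpa using h0

end EnergyMeasure

end SymmDirichletForm

/-! ### Energy densities: Cauchy–Schwarz and triangle inequalities -/

theorem sq_le_mul_of_quadratic_nonneg {a b c : ℝ} (h : ∀ q : ℚ, 0 ≤ a + 2 * q * b + q ^ 2 * c) :
    b ^ 2 ≤ a * c := by
  have h' : ∀ t : ℝ, 0 ≤ c * (t * t) + 2 * b * t + a := by
    have hcl : IsClosed {t : ℝ | 0 ≤ c * (t * t) + 2 * b * t + a} :=
      isClosed_le continuous_const (by fun_prop)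
    intro t
    refine hcl.closure_subset_iff.2 ?_ (Rat.denseRange_cast (𝕜 := ℝ) t)
    rintro _ ⟨q, rfl⟩
    have := h q
    simp only [mem_ofPred_eq]
    linarith
  have := discrim_le_zero h'
  rw [discrim] at this
  linarith

theorem sqrt_add_le_of_sq_le {a b c : ℝ} (ha : 0 ≤ a) (hc : 0 ≤ c) (h : b ^ 2 ≤ a * c) :
    √(a + 2 * b + c) ≤ √a + √c := by
  rw [Real.sqrt_le_left (by positivity), add_sq, Real.sq_sqrt ha, Real.sq_sqrt hc]
  have : b ≤ √a * √c := by
    rw [← Real.sqrt_mul ha]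
    exact Real.le_sqrt_of_sq_le h
  linarith

theorem abs_sqrt_sub_sqrt_le {a b c : ℝ} (ha : 0 ≤ a) (hc : 0 ≤ c) (h : b ^ 2 ≤ a * c) :
    |√a - √c| ≤ √(a - 2 * b + c) := by
  refine Real.le_sqrt_of_sq_le ?_
  rw [sq_abs, sub_sq, Real.sq_sqrt ha, Real.sq_sqrt hc]
  have : b ≤ √a * √c := by
    rw [← Real.sqrt_mul ha]
    exact Real.le_sqrt_of_sq_le h
  linarith

namespace SymmDirichletForm

section Density

variable {X : Type*} [TopologicalSpace X] [T2Space X] [LocallyCompactSpace X]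
    [SecondCountableTopology X]
    [MeasurableSpace X] [BorelSpace X] {μ : Measure X} [IsFiniteMeasureOnCompacts μ]
    {E : SymmDirichletForm μ}

theorem energyMeasure_add_self (hreg : E.IsRegular) {f g : C_c(X, ℝ)} (hf : f ∈ E.core)
    (hg : g ∈ E.core) : E.energyMeasure (f + g) (f + g)
      = E.energyMeasure f f + (2 : ℝ) • E.energyMeasure f g + E.energyMeasure g g := by
  have h := E.core.add_mem hf hg
  rw [energyMeasure_add_left hreg hf hg h, energyMeasure_comm hreg hf h,
    energyMeasure_comm hreg hg h, energyMeasure_add_left hreg hf hg hf,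
    energyMeasure_add_left hreg hf hg hg, energyMeasure_comm hreg hg hf, two_smul]
  abel

/-- The square root of the total energy `Γ(f)(X)`. -/
noncomputable def sqrtEnergy (E : SymmDirichletForm μ) (f : C_c(X, ℝ)) : ℝ :=
  √(E.energyMeasure f f univ)

theorem sqrtEnergy_le (hreg : E.IsRegular) {f : C_c(X, ℝ)} (hf : f ∈ E.core) :
    E.sqrtEnergy f ≤ √(E.formCc f f) := Real.sqrt_le_sqrt (energyMeasure_univ_le hreg hf)

theorem sqrtEnergy_add_le (hreg : E.IsRegular) {f g : C_c(X, ℝ)} (hf : f ∈ E.core)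
    (hg : g ∈ E.core) : E.sqrtEnergy (f + g) ≤ E.sqrtEnergy f + E.sqrtEnergy g := by
  have e : E.energyMeasure (f + g) (f + g) univ = E.energyMeasure f f univ
      + 2 * E.energyMeasure f g univ + E.energyMeasure g g univ := by
    rw [energyMeasure_add_self hreg hf hg]; simp
  rw [sqrtEnergy, e]
  refine sqrt_add_le_of_sq_le (energyMeasure_self_nonneg hreg hf .univ)
    (energyMeasure_self_nonneg hreg hg .univ) (sq_le_mul_of_quadratic_nonneg fun q => ?_)
  have h1 := energyMeasure_self_nonneg hreg (E.core.add_mem hf (E.core.smul_mem (q : ℝ) hg)) .univ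
  rw [energyMeasure_add_self hreg hf (E.core.smul_mem (q : ℝ) hg),
    energyMeasure_comm hreg hf (E.core.smul_mem (q : ℝ) hg),
    energyMeasure_smul_left hreg _ hg hf, energyMeasure_smul_left hreg _ hg
      (E.core.smul_mem (q : ℝ) hg), energyMeasure_comm hreg hg (E.core.smul_mem (q : ℝ) hg),
    energyMeasure_smul_left hreg _ hg hg, energyMeasure_comm hreg hg hf] at h1
  simp only [add_apply, smul_apply, smul_eq_mul] at h1
  linarith

theorem sqrtEnergy_neg (hreg : E.IsRegular) {f : C_c(X, ℝ)} (hf : f ∈ E.core) :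
    E.sqrtEnergy (-f) = E.sqrtEnergy f := by
  have h := E.core.smul_mem (-1 : ℝ) hf
  have : -f = (-1 : ℝ) • f := by ext x; simp
  rw [sqrtEnergy, this, energyMeasure_smul_left hreg _ hf h, energyMeasure_comm hreg hf h,
    energyMeasure_smul_left hreg _ hf hf]
  simp [sqrtEnergy]

theorem sqrtEnergy_sub_le (hreg : E.IsRegular) {f g h : C_c(X, ℝ)} (hf : f ∈ E.core)
    (hg : g ∈ E.core) (hh : h ∈ E.core) :
    E.sqrtEnergy (f - g) ≤ E.sqrtEnergy (h - f) + E.sqrtEnergy (h - g) := by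
  have : f - g = -(h - f) + (h - g) := by abel
  rw [this, ← sqrtEnergy_neg hreg (E.core.sub_mem hh hf)]
  exact sqrtEnergy_add_le hreg (E.core.neg_mem (E.core.sub_mem hh hf)) (E.core.sub_mem hh hg)

omit [T2Space X] [LocallyCompactSpace X] in
theorem sqrtEnergy_nonneg (E : SymmDirichletForm μ) (f : C_c(X, ℝ)) : 0 ≤ E.sqrtEnergy f :=
  Real.sqrt_nonneg _

variable {m : Measure X} [IsFiniteMeasure m]

omit [IsFiniteMeasure m] in
theorem energyMeasure_absolutelyContinuous (hreg : E.IsRegular) (hdom : E.IsEnergyDominant m)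
    {f g : C_c(X, ℝ)} (hf : f ∈ E.core) (hg : g ∈ E.core) :
    E.energyMeasure f g ≪ᵥ m.toENNRealVectorMeasure := by
  intro s hs
  have h := congrArg (fun ν : SignedMeasure X => ν s) (energyMeasure_add_self hreg hf hg)
  simp only [add_apply, smul_apply, smul_eq_mul,
    hdom _ (E.core.add_mem hf hg) hs, hdom _ hf hs, hdom _ hg hs] at h
  linarith

theorem withDensity_energyDensity (hreg : E.IsRegular) (hdom : E.IsEnergyDominant m)
    {f g : C_c(X, ℝ)} (hf : f ∈ E.core) (hg : g ∈ E.core) :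
    m.withDensityᵥ (E.energyDensity m f g) = E.energyMeasure f g :=
  SignedMeasure.withDensityᵥ_rnDeriv_eq _ _
    (energyMeasure_absolutelyContinuous hreg hdom hf hg)

omit [T2Space X] [LocallyCompactSpace X] [IsFiniteMeasure m] in
theorem integrable_energyDensity (f g : C_c(X, ℝ)) : Integrable (E.energyDensity m f g) m :=
  SignedMeasure.integrable_rnDeriv _ _

omit [T2Space X] [LocallyCompactSpace X] [IsFiniteMeasure m] in
theorem measurable_energyDensity (f g : C_c(X, ℝ)) : Measurable (E.energyDensity m f g) :=
  SignedMeasure.measurable_rnDeriv _ _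

theorem setIntegral_energyDensity (hreg : E.IsRegular) (hdom : E.IsEnergyDominant m)
    {f g : C_c(X, ℝ)} (hf : f ∈ E.core) (hg : g ∈ E.core) {s : Set X} (hs : MeasurableSet s) :
    ∫ x in s, E.energyDensity m f g x ∂m = E.energyMeasure f g s := by
  rw [← withDensity_energyDensity hreg hdom hf hg,
    withDensityᵥ_apply (integrable_energyDensity f g) hs]

omit [IsFiniteMeasure m] in
theorem energyDensity_comm (hreg : E.IsRegular) {f g : C_c(X, ℝ)} (hf : f ∈ E.core)
    (hg : g ∈ E.core) : E.energyDensity m f g = E.energyDensity m g f := by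
  rw [energyDensity, energyMeasure_comm hreg hf hg, energyDensity]

theorem energyDensity_add_left (hreg : E.IsRegular) (hdom : E.IsEnergyDominant m)
    {f g h : C_c(X, ℝ)} (hf : f ∈ E.core) (hg : g ∈ E.core) (hh : h ∈ E.core) :
    E.energyDensity m (f + g) h =ᵐ[m] E.energyDensity m f h + E.energyDensity m g h := by
  refine Integrable.ae_eq_of_withDensityᵥ_eq (integrable_energyDensity _ _)
    ((integrable_energyDensity _ _).add (integrable_energyDensity _ _)) ?_
  rw [withDensityᵥ_add (integrable_energyDensity _ _) (integrable_energyDensity _ _),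
    withDensity_energyDensity hreg hdom (E.core.add_mem hf hg) hh,
    withDensity_energyDensity hreg hdom hf hh, withDensity_energyDensity hreg hdom hg hh,
    energyMeasure_add_left hreg hf hg hh]

theorem energyDensity_smul_left (hreg : E.IsRegular) (hdom : E.IsEnergyDominant m) (c : ℝ)
    {f h : C_c(X, ℝ)} (hf : f ∈ E.core) (hh : h ∈ E.core) :
    E.energyDensity m (c • f) h =ᵐ[m] c • E.energyDensity m f h := by
  refine Integrable.ae_eq_of_withDensityᵥ_eq (integrable_energyDensity _ _)
    ((integrable_energyDensity _ _).smul c) ?_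
  rw [withDensityᵥ_smul, withDensity_energyDensity hreg hdom (E.core.smul_mem c hf) hh,
    withDensity_energyDensity hreg hdom hf hh, energyMeasure_smul_left hreg c hf hh]

theorem energyDensity_sum_left (hreg : E.IsRegular) (hdom : E.IsEnergyDominant m) {ι : Type*}
    (s : Finset ι) (c : ι → ℝ) {f : ι → C_c(X, ℝ)} {h : C_c(X, ℝ)} (hf : ∀ i, f i ∈ E.core)
    (hh : h ∈ E.core) :
    E.energyDensity m (∑ i ∈ s, c i • f i) h =ᵐ[m]
      fun x => ∑ i ∈ s, c i * E.energyDensity m (f i) h x := by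
  classical
  induction s using Finset.induction_on with
  | empty =>
    have := energyDensity_smul_left hreg hdom 0 E.core.zero_mem hh
    rw [zero_smul] at this
    filter_upwards [this] with x hx
    simpa using hx
  | insert a s ha ih =>
    have h1 : ∑ i ∈ s, c i • f i ∈ E.core :=
      E.core.sum_mem fun i _ => E.core.smul_mem _ (hf i)
    filter_upwards [ih, energyDensity_add_left hreg hdom (E.core.smul_mem (c a) (hf a)) h1 hh,
      energyDensity_smul_left hreg hdom (c a) (hf a) hh] with x h2 h3 h4
    rw [Finset.sum_insert ha, Finset.sum_insert ha, h3, Pi.add_apply, h2, h4, Pi.smul_apply,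
      smul_eq_mul]

theorem energyDensity_self_nonneg (hreg : E.IsRegular) (hdom : E.IsEnergyDominant m)
    {f : C_c(X, ℝ)} (hf : f ∈ E.core) : ∀ᵐ x ∂m, 0 ≤ E.energyDensity m f f x :=
  ae_nonneg_of_forall_setIntegral_nonneg (integrable_energyDensity f f) fun s hs _ => by
    rw [setIntegral_energyDensity hreg hdom hf hf hs]
    exact energyMeasure_self_nonneg hreg hf hs

theorem energyDensity_le_sum (hreg : E.IsRegular) (hdom : E.IsEnergyDominant m)
    {ι : Type*} [Fintype ι] {u : ι → C_c(X, ℝ)}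
    {v : C_c(X, ℝ)} {K : ℝ} (hK : 0 ≤ K) (hu : ∀ i, u i ∈ E.core) (hv : v ∈ E.core)
    (h1 : ∀ x y, (v x - v y) ^ 2 ≤ K * ∑ i, (u i x - u i y) ^ 2)
    (h2 : ∀ x, v x ^ 2 ≤ K * ∑ i, u i x ^ 2) :
    ∀ᵐ x ∂m, E.energyDensity m v v x ≤ K * ∑ i, E.energyDensity m (u i) (u i) x := by
  have hi (i : ι) := integrable_energyDensity (E := E) (m := m) (u i) (u i)
  refine ae_le_of_forall_setIntegral_le (integrable_energyDensity v v)
    ((integrable_finsetSum _ fun i _ => hi i).const_mul K) fun s hs _ => ?_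
  rw [setIntegral_energyDensity hreg hdom hv hv hs, integral_const_mul,
    integral_finsetSum _ fun i _ => (hi i).integrableOn]
  simp only [fun i => setIntegral_energyDensity hreg hdom (hu i) (hu i) hs]
  exact energyMeasure_le_sum hreg hK hu hv h1 h2 hs

theorem energyDensity_add_smul_self (hreg : E.IsRegular) (hdom : E.IsEnergyDominant m) (q : ℝ)
    {f g : C_c(X, ℝ)} (hf : f ∈ E.core) (hg : g ∈ E.core) :
    ∀ᵐ x ∂m, E.energyDensity m (f + q • g) (f + q • g) x = E.energyDensity m f f x
      + 2 * q * E.energyDensity m f g x + q ^ 2 * E.energyDensity m g g x := by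
  have hqg := E.core.smul_mem q hg
  have h := E.core.add_mem hf hqg
  filter_upwards [energyDensity_add_left hreg hdom hf hqg h,
    energyDensity_smul_left hreg hdom q hg h, energyDensity_add_left hreg hdom hf hqg hf,
    energyDensity_add_left hreg hdom hf hqg hg, energyDensity_smul_left hreg hdom q hg hf,
    energyDensity_smul_left hreg hdom q hg hg] with x h1 h2 h3 h4 h5 h6
  rw [h1, Pi.add_apply, h2, Pi.smul_apply, energyDensity_comm hreg hf h,
    energyDensity_comm hreg hg h, h3, h4, Pi.add_apply, Pi.add_apply, h5, h6,
    energyDensity_comm hreg hg hf]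
  simp only [Pi.smul_apply, smul_eq_mul]
  ring

theorem energyDensity_cauchySchwarz (hreg : E.IsRegular) (hdom : E.IsEnergyDominant m)
    {f g : C_c(X, ℝ)} (hf : f ∈ E.core) (hg : g ∈ E.core) :
    ∀ᵐ x ∂m, E.energyDensity m f g x ^ 2 ≤ E.energyDensity m f f x * E.energyDensity m g g x := by
  -- Each q has its own exceptional null set, so only rational q are used; continuity in q restores
  -- the full discriminant argument.
  have h1 := eventually_countable_forall.2 fun q : ℚ =>
    energyDensity_add_smul_self hreg hdom (q : ℝ) hf hg
  have h2 := eventually_countable_forall.2 fun q : ℚ =>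
    energyDensity_self_nonneg hreg hdom (E.core.add_mem hf (E.core.smul_mem (q : ℝ) hg))
  filter_upwards [h1, h2] with x h1 h2
  exact sq_le_mul_of_quadratic_nonneg fun q => by rw [← h1 q]; exact h2 q

theorem abs_sqrt_energyDensity_sub_le (hreg : E.IsRegular) (hdom : E.IsEnergyDominant m)
    {f g : C_c(X, ℝ)} (hf : f ∈ E.core) (hg : g ∈ E.core) :
    ∀ᵐ x ∂m, |√(E.energyDensity m f f x) - √(E.energyDensity m g g x)|
      ≤ √(E.energyDensity m (f - g) (f - g) x) := by
  filter_upwards [energyDensity_self_nonneg hreg hdom hf, energyDensity_self_nonneg hreg hdom hg,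
    energyDensity_cauchySchwarz hreg hdom hf hg,
    energyDensity_add_smul_self hreg hdom (-1) hf hg] with x h1 h2 h3 h4
  have e : f + (-1 : ℝ) • g = f - g := by ext x; simp [sub_eq_add_neg]
  rw [e] at h4
  rw [h4]
  convert abs_sqrt_sub_sqrt_le h1 h2 h3 using 2
  ring

theorem eLpNorm_sqrt_energyDensity (hreg : E.IsRegular) (hdom : E.IsEnergyDominant m)
    {f : C_c(X, ℝ)} (hf : f ∈ E.core) :
    eLpNorm (fun x => √(E.energyDensity m f f x)) 2 m = ENNReal.ofReal (E.sqrtEnergy f) := by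
  have h0 := energyDensity_self_nonneg hreg hdom hf
  have h1 : ∫⁻ x, ‖√(E.energyDensity m f f x)‖ₑ ^ (2 : ℝ) ∂m
      = ENNReal.ofReal (E.energyMeasure f f univ) := by
    rw [← setIntegral_energyDensity hreg hdom hf hf .univ, setIntegral_univ,
      ofReal_integral_eq_lintegral_ofReal (integrable_energyDensity f f) h0]
    refine lintegral_congr_ae ?_
    filter_upwards [h0] with x hx
    rw [Real.enorm_eq_ofReal (Real.sqrt_nonneg _),
      ENNReal.ofReal_rpow_of_nonneg (Real.sqrt_nonneg _) (by norm_num), Real.rpow_two,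
      Real.sq_sqrt hx]
  rw [eLpNorm_eq_lintegral_rpow_enorm_toReal (by norm_num) (by norm_num)]
  simp only [ENNReal.toReal_ofNat]
  rw [h1, ENNReal.ofReal_rpow_of_nonneg (energyMeasure_self_nonneg hreg hf .univ) (by norm_num),
    ← Real.sqrt_eq_rpow, sqrtEnergy]

namespace FiberChoice

variable (D : E.FiberChoice m)

omit [T2Space X] [LocallyCompactSpace X] [IsFiniteMeasure m] in
theorem comb_mem_core (c : ℕ →₀ ℝ) : D.comb c ∈ E.core :=
  E.core.sum_mem fun n _ => E.core.smul_mem _ (D.fn_mem n)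

omit [T2Space X] [LocallyCompactSpace X] [IsFiniteMeasure m] in
theorem comb_single (n : ℕ) : D.comb (Finsupp.single n 1) = D.fn n := by simp [comb]

omit [T2Space X] [LocallyCompactSpace X] [IsFiniteMeasure m] in
theorem comb_sub (a b : ℕ →₀ ℝ) : D.comb (a - b) = D.comb a - D.comb b := by
  unfold comb
  exact Finsupp.sum_sub_index fun n r s => by ext x; simp [sub_mul]

theorem gammaAt_ae_eq (hreg : E.IsRegular) (hdom : E.IsEnergyDominant m) (a b : ℕ →₀ ℝ) :
    (fun x => D.gammaAt x a b) =ᵐ[m] E.energyDensity m (D.comb a) (D.comb b) := by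
  have h1 := energyDensity_sum_left hreg hdom a.support a D.fn_mem (D.comb_mem_core b)
  have h2 := eventually_countable_forall.2 fun i : ℕ =>
    energyDensity_sum_left hreg hdom b.support b D.fn_mem (D.fn_mem i)
  have h3 := eventually_countable_forall.2 fun i : ℕ =>
    eventually_countable_forall.2 fun j : ℕ => D.version i j
  filter_upwards [h1, h2, h3] with x h1 h2 h3
  have e1 : D.comb a = ∑ i ∈ a.support, a i • D.fn i := rfl
  have e2 : D.comb b = ∑ i ∈ b.support, b i • D.fn i := rfl
  rw [← e1] at h1
  rw [h1]
  simp only [gammaAt, Finsupp.sum]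
  refine Finset.sum_congr rfl fun i _ => ?_
  rw [energyDensity_comm hreg (D.fn_mem i) (D.comb_mem_core b), e2, h2 i, Finset.mul_sum]
  refine Finset.sum_congr rfl fun j _ => ?_
  rw [h3, energyDensity_comm hreg (D.fn_mem i) (D.fn_mem j)]
  ring

end FiberChoice

end Density

end SymmDirichletForm

/-! ### Measurable sections of the field of fibers -/

theorem denseRange_rat_combination {ι H : Type*} [NormedAddCommGroup H] [NormedSpace ℝ H]
    (e : ι → H) (he : Dense (Submodule.span ℝ (range e) : Set H)) :
    DenseRange fun q : ι →₀ ℚ => q.sum fun i a => (a : ℝ) • e i := by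
  classical
  let F : (ι →₀ ℚ) →+ H :=
    { toFun := fun q => q.sum fun i a => (a : ℝ) • e i
      map_zero' := by simp
      map_add' := fun p q => Finsupp.sum_add_index' (by simp) (by simp [add_smul]) }
  have key : ∀ y ∈ Submodule.span ℝ (range e), y ∈ F.range.topologicalClosure := by
    intro y hy
    obtain ⟨c, rfl⟩ := Finsupp.mem_span_range_iff_exists_finsupp.1 hy
    refine AddSubgroup.sum_mem _ fun i _ => ?_
    have hcl : IsClosed {t : ℝ | t • e i ∈ F.range.topologicalClosure} :=
      F.range.isClosed_topologicalClosure.preimage (by fun_prop : Continuous fun t : ℝ => t • e i)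
    refine hcl.closure_subset_iff.2 ?_ (Rat.denseRange_cast (𝕜 := ℝ) (c i))
    rintro _ ⟨q, rfl⟩
    refine F.range.le_topologicalClosure ⟨Finsupp.single i q, ?_⟩
    exact Finsupp.sum_single_index (h := fun i (a : ℚ) => (a : ℝ) • e i) (by simp)
  intro y
  have h : closure (Submodule.span ℝ (range e) : Set H) ⊆ F.range.topologicalClosure :=
    F.range.isClosed_topologicalClosure.closure_subset_iff.2 key
  exact h (he y)

/-- Since 2⟨v, w⟩ - ‖w‖² = ‖v‖² - ‖v - w‖², the number ‖v‖² is a supremum of expressions in scalar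
products with a dense family. With a countable family, the norm of a measurable section is therefore
measurable although the fiber varies with x. -/
theorem lt_norm_sq_iff_exists {κ H : Type*} [NormedAddCommGroup H] [InnerProductSpace ℝ H]
    {d : κ → H} (hd : DenseRange d) (v : H) (r : ℝ) :
    r < ‖v‖ ^ 2 ↔ ∃ q, r < 2 * inner ℝ v (d q) - inner ℝ (d q) (d q) := by
  have e (w : H) : 2 * inner ℝ v w - inner ℝ w w = ‖v‖ ^ 2 - ‖v - w‖ ^ 2 := by
    rw [norm_sub_sq_real, real_inner_self_eq_norm_sq]; ring
  simp only [e]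
  constructor
  · intro h
    have ho : IsOpen {w : H | r < ‖v‖ ^ 2 - ‖v - w‖ ^ 2} :=
      isOpen_lt continuous_const (by fun_prop)
    obtain ⟨q, hq⟩ := hd.exists_mem_open ho ⟨v, by simpa using h⟩
    exact ⟨q, hq⟩
  · rintro ⟨q, hq⟩
    exact hq.trans_le (sub_le_self _ (by positivity))

namespace SymmDirichletForm

namespace FiberChoice

section Section

variable {X : Type*} [TopologicalSpace X] [SecondCountableTopology X]
    [MeasurableSpace X] [BorelSpace X] {μ : Measure X} [IsFiniteMeasureOnCompacts μ]
    {E : SymmDirichletForm μ} {m : Measure X} (D : E.FiberChoice m)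

/-- `d_x` as a linear map. -/
noncomputable def diffLinear (x : X) : (ℕ →₀ ℝ) →ₗ[ℝ] D.Fiber x where
  toFun c := D.diff c x
  map_add' a b := UniformSpace.Completion.coe_add (α := D.PreFiber x) a b
  map_smul' r a := UniformSpace.Completion.coe_smul (M := ℝ) (X := D.PreFiber x) r a

theorem diff_sub (a b : ℕ →₀ ℝ) (x : X) : D.diff (a - b) x = D.diff a x - D.diff b x :=
  map_sub (D.diffLinear x) a b

theorem inner_diff (a b : ℕ →₀ ℝ) (x : X) :
    inner ℝ (D.diff a x) (D.diff b x) = D.gammaAt x a b :=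
  UniformSpace.Completion.inner_coe (𝕜 := ℝ) (E := D.PreFiber x) a b

theorem norm_sq_diff (a : ℕ →₀ ℝ) (x : X) : ‖D.diff a x‖ ^ 2 = D.gammaAt x a a := by
  rw [← real_inner_self_eq_norm_sq, inner_diff]

theorem diff_eq_sum (a : ℕ →₀ ℝ) (x : X) :
    D.diff a x = a.sum fun n s => s • D.diff (Finsupp.single n 1) x := by
  have h : a = a.sum fun n s => s • Finsupp.single n 1 := by simp
  conv_lhs => rw [h]
  exact map_finsuppSum (D.diffLinear x) a _ |>.trans
    (Finsupp.sum_congr fun n _ => map_smul (D.diffLinear x) _ _)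

theorem dense_span_diff (x : X) :
    Dense (Submodule.span ℝ (range fun n => D.diff (Finsupp.single n 1) x) : Set (D.Fiber x)) := by
  have h : DenseRange ((↑) : D.PreFiber x → D.Fiber x) :=
    UniformSpace.Completion.denseRange_coe
  have hmem (a : ℕ →₀ ℝ) : D.diff a x
      ∈ Submodule.span ℝ (range fun n => D.diff (Finsupp.single n 1) x) := by
    rw [diff_eq_sum]
    exact Submodule.sum_mem _ fun n _ => Submodule.smul_mem _ _ (Submodule.subset_span ⟨n, rfl⟩)
  refine h.mono ?_
  rintro _ ⟨a, rfl⟩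
  exact hmem a

theorem measurable_gammaAt (a b : ℕ →₀ ℝ) : Measurable fun x => D.gammaAt x a b := by
  have := D.measurable
  unfold gammaAt Finsupp.sum
  fun_prop

variable {D}

theorem isMeasurableSection_diff (a : ℕ →₀ ℝ) : D.IsMeasurableSection (D.diff a) := fun n => by
  simp only [inner_diff]
  exact D.measurable_gammaAt _ _

namespace IsMeasurableSection

theorem add {v w : ∀ x, D.Fiber x} (hv : D.IsMeasurableSection v) (hw : D.IsMeasurableSection w) :
    D.IsMeasurableSection fun x => v x + w x := fun n => by
  simp only [inner_add_left]
  exact (hv n).add (hw n)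

theorem sub {v w : ∀ x, D.Fiber x} (hv : D.IsMeasurableSection v) (hw : D.IsMeasurableSection w) :
    D.IsMeasurableSection fun x => v x - w x := fun n => by
  simp only [inner_sub_left]
  exact (hv n).sub (hw n)

theorem smul {v : ∀ x, D.Fiber x} {g : X → ℝ} (hg : Measurable g)
    (hv : D.IsMeasurableSection v) :
    D.IsMeasurableSection fun x => g x • v x := fun n => by
  simp only [real_inner_smul_left]
  exact hg.mul (hv n)

theorem zero : D.IsMeasurableSection fun _ => 0 := fun n => by
  simp only [inner_zero_left]
  exact measurable_const

theorem norm_sq {v : ∀ x, D.Fiber x} (hv : D.IsMeasurableSection v) :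
    Measurable fun x => ‖v x‖ ^ 2 := by
  have hd (x : X) := denseRange_rat_combination _ (D.dense_span_diff x)
  refine measurable_of_Ioi fun r => ?_
  have e : (fun x => ‖v x‖ ^ 2) ⁻¹' Ioi r = ⋃ q : ℕ →₀ ℚ, {x | r <
      2 * inner ℝ (v x) (q.sum fun i a => (a : ℝ) • D.diff (Finsupp.single i 1) x)
      - inner ℝ (q.sum fun i a => (a : ℝ) • D.diff (Finsupp.single i 1) x)
        (q.sum fun i a => (a : ℝ) • D.diff (Finsupp.single i 1) x)} := by
    ext x
    simp only [mem_preimage, mem_Ioi, mem_iUnion]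
    exact lt_norm_sq_iff_exists (hd x) (v x) r
  rw [e]
  refine MeasurableSet.iUnion fun q => ?_
  refine measurableSet_lt measurable_const ?_
  have hv' := hv
  have hG := fun i => D.measurable_gammaAt (Finsupp.single i 1)
  simp only [Finsupp.sum, inner_sum, sum_inner, real_inner_smul_left, real_inner_smul_right,
    inner_diff]
  unfold IsMeasurableSection at hv'
  fun_prop

theorem norm {v : ∀ x, D.Fiber x} (hv : D.IsMeasurableSection v) :
    Measurable fun x => ‖v x‖ := by
  have := hv.norm_sq.sqrt
  simpa using this

theorem of_tendsto {v : ℕ → ∀ x, D.Fiber x} {w : ∀ x, D.Fiber x}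
    (hv : ∀ k, D.IsMeasurableSection (v k))
    (h : ∀ x, Tendsto (fun k => v k x) atTop (𝓝 (w x))) : D.IsMeasurableSection w := fun n =>
  measurable_of_tendsto_metrizable (fun k => hv k n) (tendsto_pi_nhds.2 fun x =>
    (h x).inner tendsto_const_nhds)

end IsMeasurableSection

theorem secNorm_add_le {p : ℝ≥0∞} (hp : 1 ≤ p) {v w : ∀ x, D.Fiber x}
    (hv : D.IsMeasurableSection v) (hw : D.IsMeasurableSection w) :
    D.secNorm p (fun x => v x + w x) ≤ D.secNorm p v + D.secNorm p w := by
  have h := eLpNorm_add_le (f := fun x => ‖v x‖) (g := fun x => ‖w x‖)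
    (hv.norm.aestronglyMeasurable (μ := m)) hw.norm.aestronglyMeasurable hp
  unfold secNorm
  refine le_trans (eLpNorm_mono fun x => ?_) h
  simp only [Pi.add_apply, norm_norm]
  exact (norm_add_le _ _).trans (Real.le_norm_self _)

theorem secNorm_sub_le {p : ℝ≥0∞} (hp : 1 ≤ p) {u v w : ∀ x, D.Fiber x}
    (hu : D.IsMeasurableSection u) (hv : D.IsMeasurableSection v) (hw : D.IsMeasurableSection w) :
    D.secNorm p (fun x => u x - w x)
      ≤ D.secNorm p (fun x => u x - v x) + D.secNorm p (fun x => v x - w x) := by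
  simpa using secNorm_add_le hp (hu.sub hv) (hv.sub hw)

namespace MemLpSection

variable {p : ℝ≥0∞}

theorem add (hp : 1 ≤ p) {v w : ∀ x, D.Fiber x} (hv : D.MemLpSection p v)
    (hw : D.MemLpSection p w) : D.MemLpSection p fun x => v x + w x :=
  ⟨hv.1.add hw.1, (secNorm_add_le hp hv.1 hw.1).trans_lt (ENNReal.add_lt_top.2 ⟨hv.2, hw.2⟩)⟩

theorem zero : D.MemLpSection p fun _ => 0 :=
  ⟨IsMeasurableSection.zero, by simp [secNorm]⟩

theorem const_smul (c : ℝ) {v : ∀ x, D.Fiber x} (hv : D.MemLpSection p v) :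
    D.MemLpSection p fun x => c • v x := by
  refine ⟨hv.1.smul measurable_const, ?_⟩
  have h : eLpNorm (fun x => c • ‖v x‖) p m < ∞ := by
    refine (eLpNorm_const_smul_le (c := c) (f := fun x => ‖v x‖)).trans_lt ?_
    exact ENNReal.mul_lt_top (by simp) hv.2
  refine lt_of_le_of_lt (eLpNorm_mono fun x => ?_) h
  simp [norm_smul]

theorem memLp_norm {v : ∀ x, D.Fiber x} (hv : D.MemLpSection p v) :
    MemLp (fun x => ‖v x‖) p m := ⟨hv.1.norm.aestronglyMeasurable, hv.2⟩

end MemLpSection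

end Section

/-! ### Existence and pointwise norm of the differential -/

section Differential

variable {X : Type*} [TopologicalSpace X] [T2Space X] [LocallyCompactSpace X]
    [SecondCountableTopology X]
    [MeasurableSpace X] [BorelSpace X] {μ : Measure X} [IsFiniteMeasureOnCompacts μ]
    {E : SymmDirichletForm μ} {m : Measure X} [IsFiniteMeasure m] {D : E.FiberChoice m}

theorem norm_diff_ae_eq (hreg : E.IsRegular) (hdom : E.IsEnergyDominant m) (c : ℕ →₀ ℝ) :
    ∀ᵐ x ∂m, ‖D.diff c x‖ = √(E.energyDensity m (D.comb c) (D.comb c) x) := by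
  filter_upwards [D.gammaAt_ae_eq hreg hdom c c] with x hx
  rw [← hx, ← norm_sq_diff, Real.sqrt_sq (norm_nonneg _)]

theorem secNorm_diff (hreg : E.IsRegular) (hdom : E.IsEnergyDominant m) (c : ℕ →₀ ℝ) :
    D.secNorm 2 (D.diff c) = ENNReal.ofReal (E.sqrtEnergy (D.comb c)) := by
  rw [← eLpNorm_sqrt_energyDensity hreg hdom (D.comb_mem_core c)]
  exact eLpNorm_congr_ae (norm_diff_ae_eq hreg hdom c)

theorem secNorm_diff_sub_diff (hreg : E.IsRegular) (hdom : E.IsEnergyDominant m) (a b : ℕ →₀ ℝ) :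
    D.secNorm 2 (fun x => D.diff a x - D.diff b x)
      = ENNReal.ofReal (E.sqrtEnergy (D.comb a - D.comb b)) := by
  rw [← comb_sub, ← secNorm_diff hreg hdom]
  simp only [← diff_sub]

-- The Riesz–Fischer argument, carried out for sections: combinations converging at a geometric rate
-- in L² are almost everywhere pointwise Cauchy in the complete fibers. Their pointwise limit is the
-- differential, and Fatou's lemma gives the L² estimate.
open Classical in
theorem exists_isDifferential (hreg : E.IsRegular) (hdom : E.IsEnergyDominant m) {f : C_c(X, ℝ)}
    (hf : f ∈ E.core) : ∃ ω, D.IsDifferential f ω := by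
  have hch : ∀ k : ℕ, ∃ n, E.sqrtEnergy (f - D.fn n) ≤ (1 / 2 : ℝ) ^ k := fun k => by
    obtain ⟨n, hn⟩ := D.fn_dense f hf (((1 / 2 : ℝ) ^ k) ^ 2) (by positivity)
    refine ⟨n, (sqrtEnergy_le hreg (E.core.sub_mem hf (D.fn_mem n))).trans ?_⟩
    rw [Real.sqrt_le_left (by positivity)]
    exact hn.le
  choose N hN using hch
  let c : ℕ → ℕ →₀ ℝ := fun k => Finsupp.single (N k) 1
  have hc (k : ℕ) : D.comb (c k) = D.fn (N k) := D.comb_single (N k)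
  have hdist (k l : ℕ) : D.secNorm 2 (fun x => D.diff (c k) x - D.diff (c l) x)
      ≤ ENNReal.ofReal ((1 / 2) ^ k + (1 / 2) ^ l) := by
    rw [secNorm_diff_sub_diff hreg hdom, hc, hc]
    exact ENNReal.ofReal_le_ofReal ((sqrtEnergy_sub_le hreg (D.fn_mem _) (D.fn_mem _) hf).trans
      (add_le_add (hN k) (hN l)))
  have hmd (k l : ℕ) : D.IsMeasurableSection fun x => D.diff (c k) x - D.diff (c l) x :=
    (isMeasurableSection_diff _).sub (isMeasurableSection_diff _)
  let G : Set X := {x | ∑' k, ‖D.diff (c k) x - D.diff (c (k + 1)) x‖ₑ ≠ ∞}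
  have hmeas (k : ℕ) : Measurable fun x => ‖D.diff (c k) x - D.diff (c (k + 1)) x‖ₑ := by
    have := (hmd k (k + 1)).norm.enorm
    simpa only [enorm_norm] using this
  have hG : MeasurableSet G :=
    (Measurable.tsum hmeas) (measurableSet_singleton ∞).compl
  have hGae : ∀ᵐ x ∂m, x ∈ G := by
    -- As m is finite, the geometric L² bounds give summable L¹ bounds.
    have hlt : ∫⁻ x, ∑' k, ‖D.diff (c k) x - D.diff (c (k + 1)) x‖ₑ ∂m ≠ ∞ := by
      rw [lintegral_tsum fun k => (hmeas k).aemeasurable]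
      have hb (k : ℕ) : ∫⁻ x, ‖D.diff (c k) x - D.diff (c (k + 1)) x‖ₑ ∂m
          ≤ ENNReal.ofReal (2 * (1 / 2) ^ k) * m univ ^ (1 / 2 : ℝ) := by
        have h1 := eLpNorm_le_eLpNorm_mul_rpow_measure_univ (μ := m) (p := 1) (q := 2)
          (by norm_num) (hmd k (k + 1)).norm.aestronglyMeasurable
        rw [eLpNorm_one_eq_lintegral_enorm] at h1
        simp only [enorm_norm] at h1
        rw [show 1 / (1 : ℝ≥0∞).toReal - 1 / (2 : ℝ≥0∞).toReal = 1 / 2 by norm_num] at h1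
        refine h1.trans ?_
        refine mul_le_mul' ((hdist k (k + 1)).trans (ENNReal.ofReal_le_ofReal ?_)) le_rfl
        have : (0 : ℝ) ≤ (1 / 2) ^ k := by positivity
        rw [pow_succ]
        linarith
      refine ne_top_of_le_ne_top ?_ (ENNReal.tsum_le_tsum hb)
      rw [ENNReal.tsum_mul_right]
      refine ENNReal.mul_ne_top ?_ (ENNReal.rpow_ne_top_of_nonneg (by norm_num) (by simp))
      rw [← ENNReal.ofReal_tsum_of_nonneg (fun k => by positivity)
        (summable_geometric_two.mul_left 2)]
      exact ENNReal.ofReal_ne_top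
    exact ae_lt_top (Measurable.tsum hmeas) hlt |>.mono fun x hx => hx.ne
  have hconv : ∀ x ∈ G, ∃ l, Tendsto (fun k => D.diff (c k) x) atTop (𝓝 l) := fun x hx => by
    refine cauchySeq_tendsto_of_complete (cauchySeq_of_summable_dist ?_)
    have : Summable fun k => ‖D.diff (c k) x - D.diff (c (k + 1)) x‖₊ :=
      ENNReal.tsum_coe_ne_top_iff_summable.1 hx
    have h2 := NNReal.summable_coe.2 this
    simpa only [dist_eq_norm, coe_nnnorm] using h2
  let ω : ∀ x, D.Fiber x := fun x => if h : x ∈ G then (hconv x h).choose else 0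
  have hω : ∀ x ∈ G, Tendsto (fun k => D.diff (c k) x) atTop (𝓝 (ω x)) := fun x hx => by
    simp only [ω, dif_pos hx]
    exact (hconv x hx).choose_spec
  have hωm : D.IsMeasurableSection ω := by
    -- The indicator of G makes the sequence converge at every point, with limit 0 off G.
    refine IsMeasurableSection.of_tendsto
      (v := fun k x => G.indicator (fun _ => (1 : ℝ)) x • D.diff (c k) x)
      (fun k => (isMeasurableSection_diff _).smul (measurable_const.indicator hG)) fun x => ?_
    by_cases hx : x ∈ G
    · simpa [hx] using hω x hx
    · simp [hx, ω]
  have hlim (k : ℕ) : D.secNorm 2 (fun x => ω x - D.diff (c k) x)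
      ≤ ENNReal.ofReal (2 * (1 / 2) ^ k) := by
    refine (Lp.eLpNorm_lim_le_liminf_eLpNorm
      (f := fun l x => ‖D.diff (c l) x - D.diff (c k) x‖)
      (fun l => (hmd l k).norm.aestronglyMeasurable) (fun x => ‖ω x - D.diff (c k) x‖)
      (hGae.mono fun x hx => ((hω x hx).sub tendsto_const_nhds).norm)).trans ?_
    refine liminf_le_of_frequently_le' (Eventually.frequently ?_)
    filter_upwards [eventually_ge_atTop k] with l hl
    refine (hdist l k).trans (ENNReal.ofReal_le_ofReal ?_)
    have := pow_le_pow_of_le_one (by norm_num : (0 : ℝ) ≤ 1 / 2) (by norm_num) hl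
    linarith
  refine ⟨ω, ⟨hωm, ?_⟩, fun ε hε => ?_⟩
  · have h1 := secNorm_add_le (p := 2) (by norm_num) (hωm.sub (isMeasurableSection_diff (c 0)))
      (isMeasurableSection_diff (D := D) (c 0))
    simp only [sub_add_cancel] at h1
    refine h1.trans_lt (ENNReal.add_lt_top.2 ⟨(hlim 0).trans_lt ENNReal.ofReal_lt_top, ?_⟩)
    rw [secNorm_diff hreg hdom]
    exact ENNReal.ofReal_lt_top
  · obtain ⟨k, hk⟩ := exists_pow_lt_of_lt_one (show 0 < min ε 1 / 2 by positivity)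
      (by norm_num : (1 / 2 : ℝ) < 1)
    have hk1 : (2 : ℝ) * (1 / 2) ^ k < ε := by linarith [min_le_left ε 1]
    refine ⟨c k, ?_, (hlim k).trans_lt ((ENNReal.ofReal_lt_ofReal_iff hε).2 hk1)⟩
    have h1 := hN k
    rw [← hc k, sqrtEnergy, Real.sqrt_le_left (by positivity)] at h1
    have h2 : (0 : ℝ) < (1 / 2) ^ k := by positivity
    have h3 : (1 / 2 : ℝ) ^ k ≤ 1 := pow_le_one₀ (by norm_num) (by norm_num)
    nlinarith

theorem isDifferential_partialSection (hreg : E.IsRegular) (hdom : E.IsEnergyDominant m)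
    {f : C_c(X, ℝ)} (hf : f ∈ E.core) : D.IsDifferential f (D.partialSection f) := by
  have H := exists_isDifferential (D := D) hreg hdom hf
  rw [partialSection, dif_pos H]
  exact H.choose_spec

namespace IsDifferential

variable {f : C_c(X, ℝ)} {ω : ∀ x, D.Fiber x}

omit [T2Space X] [LocallyCompactSpace X] [IsFiniteMeasure m] in
theorem exists_approx (hω : D.IsDifferential f ω) {ε : ℝ} (hε : 0 < ε) :
    ∃ c : ℕ →₀ ℝ, E.sqrtEnergy (f - D.comb c) ≤ ε ∧
      D.secNorm 2 (fun x => ω x - D.diff c x) ≤ ENNReal.ofReal ε := by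
  -- ε² serves Γ(f - a)(X), of which `sqrtEnergy` is the square root; ε serves the norm of the
  -- section.
  obtain ⟨c, h1, h2⟩ := hω.2 (min ε (ε ^ 2)) (by positivity)
  refine ⟨c, ?_, h2.le.trans (ENNReal.ofReal_le_ofReal (min_le_left _ _))⟩
  rw [sqrtEnergy, Real.sqrt_le_left hε.le]
  exact h1.le.trans (min_le_right _ _)

/-- `IsDifferential` provides some good combination for each accuracy. The triangle inequality
through it, with the isometry on combinations, covers an arbitrary `c`. -/
theorem secNorm_sub_diff_le (hreg : E.IsRegular) (hdom : E.IsEnergyDominant m) (hf : f ∈ E.core)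
    (hω : D.IsDifferential f ω) (c : ℕ →₀ ℝ) :
    D.secNorm 2 (fun x => ω x - D.diff c x) ≤ ENNReal.ofReal (E.sqrtEnergy (f - D.comb c)) := by
  refine ENNReal.le_of_forall_pos_le_add fun ε hε _ => ?_
  have hε' : (0 : ℝ) < ε / 2 := by positivity
  obtain ⟨a, h1, h2⟩ := hω.exists_approx hε'
  refine (secNorm_sub_le (by norm_num) hω.1.1 (isMeasurableSection_diff a)
    (isMeasurableSection_diff c)).trans ?_
  rw [secNorm_diff_sub_diff hreg hdom]
  have h3 := sqrtEnergy_sub_le hreg (D.comb_mem_core a) (D.comb_mem_core c) hf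
  refine (add_le_add h2 (ENNReal.ofReal_le_ofReal h3)).trans ?_
  rw [← ENNReal.ofReal_coe_nnreal, ← ENNReal.ofReal_add hε'.le (add_nonneg
    (sqrtEnergy_nonneg _ _) (sqrtEnergy_nonneg _ _)),
    ← ENNReal.ofReal_add (sqrtEnergy_nonneg E (f - D.comb c)) ε.coe_nonneg]
  refine ENNReal.ofReal_le_ofReal ?_
  linarith

/-- Equality holds for combinations of the f_n. Replacing f by an approximating combination changes
both sides by functions small in L², by the reverse triangle inequality in the fiber and for square
roots of densities. -/
theorem norm_ae_eq (hreg : E.IsRegular) (hdom : E.IsEnergyDominant m) (hf : f ∈ E.core)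
    (hω : D.IsDifferential f ω) : ∀ᵐ x ∂m, ‖ω x‖ = √(E.energyDensity m f f x) := by
  have hmeas : Measurable fun x => ‖ω x‖ - √(E.energyDensity m f f x) :=
    hω.1.1.norm.sub (measurable_energyDensity f f).sqrt
  have h0 : eLpNorm (fun x => ‖ω x‖ - √(E.energyDensity m f f x)) 2 m = 0 := by
    refine le_antisymm (ENNReal.le_of_forall_pos_le_add fun ε hε _ => ?_) bot_le
    have hε' : (0 : ℝ) < ε / 2 := by positivity
    obtain ⟨c, h1, h2⟩ := hω.exists_approx hε'
    have hc := D.comb_mem_core c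
    have hle : eLpNorm (fun x => ‖ω x‖ - √(E.energyDensity m f f x)) 2 m
        ≤ eLpNorm (fun x => ‖ω x - D.diff c x‖
          + √(E.energyDensity m (f - D.comb c) (f - D.comb c) x)) 2 m := by
      refine eLpNorm_mono_ae ?_
      filter_upwards [norm_diff_ae_eq (D := D) hreg hdom c,
        abs_sqrt_energyDensity_sub_le hreg hdom hf hc] with x e1 e2
      rw [← e1] at e2
      rw [Real.norm_eq_abs, Real.norm_eq_abs, abs_of_nonneg (a := _ + _) (by positivity)]
      have e3 := abs_norm_sub_norm_le (ω x) (D.diff c x)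
      have e4 := abs_sub_le ‖ω x‖ ‖D.diff c x‖ (√(E.energyDensity m f f x))
      rw [abs_sub_comm ‖D.diff c x‖] at e4
      linarith
    refine (hle.trans (eLpNorm_add_le
      (hω.1.1.sub (isMeasurableSection_diff c)).norm.aestronglyMeasurable
      (measurable_energyDensity _ _).sqrt.aestronglyMeasurable (by norm_num))).trans ?_
    rw [eLpNorm_sqrt_energyDensity hreg hdom (E.core.sub_mem hf hc), zero_add]
    refine (add_le_add h2 (ENNReal.ofReal_le_ofReal h1)).trans ?_
    rw [← ENNReal.ofReal_add hε'.le hε'.le, add_halves, ENNReal.ofReal_coe_nnreal]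
  rw [eLpNorm_eq_zero_iff hmeas.aestronglyMeasurable (by norm_num)] at h0
  filter_upwards [h0] with x hx
  exact sub_eq_zero.1 hx

end IsDifferential

end Differential

end FiberChoice

end SymmDirichletForm

/-! ### Cylinder functions: linearity, Lipschitz bounds, truncation -/

namespace IsCbOneZero

variable {k l : ℕ} {F G : (Fin k → ℝ) → ℝ}

theorem add (hF : IsCbOneZero F) (hG : IsCbOneZero G) : IsCbOneZero fun y => F y + G y := by
  obtain ⟨hF1, ⟨C, hC⟩, hF0⟩ := hF
  obtain ⟨hG1, ⟨C', hC'⟩, hG0⟩ := hG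
  refine ⟨hF1.add hG1, ⟨C + C', fun y => ⟨?_, ?_⟩⟩, by simp [hF0, hG0]⟩
  · exact (abs_add_le _ _).trans (add_le_add (hC y).1 (hC' y).1)
  · rw [fderiv_fun_add (hF1.differentiable one_ne_zero y) (hG1.differentiable one_ne_zero y)]
    exact (norm_add_le _ _).trans (add_le_add (hC y).2 (hC' y).2)

theorem const_mul (c : ℝ) (hF : IsCbOneZero F) : IsCbOneZero fun y => c * F y := by
  obtain ⟨hF1, ⟨C, hC⟩, hF0⟩ := hF
  refine ⟨contDiff_const.mul hF1, ⟨|c| * C, fun y => ⟨?_, ?_⟩⟩, by simp [hF0]⟩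
  · rw [abs_mul]
    exact mul_le_mul_of_nonneg_left (hC y).1 (abs_nonneg c)
  · rw [fderiv_const_mul (hF1.differentiable one_ne_zero y), norm_smul, Real.norm_eq_abs]
    exact mul_le_mul_of_nonneg_left (hC y).2 (abs_nonneg c)

theorem comp_clm (hF : IsCbOneZero F) (L : (Fin l → ℝ) →L[ℝ] (Fin k → ℝ)) :
    IsCbOneZero fun y => F (L y) := by
  obtain ⟨hF1, ⟨C, hC⟩, hF0⟩ := hF
  refine ⟨hF1.comp L.contDiff, ⟨max C (C * ‖L‖), fun y => ⟨(hC _).1.trans (le_max_left _ _), ?_⟩⟩,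
    by simp [hF0]⟩
  rw [fderiv_fun_comp y (hF1.differentiable one_ne_zero _) L.differentiableAt, L.fderiv]
  refine (ContinuousLinearMap.opNorm_comp_le _ _).trans (le_trans ?_ (le_max_right _ _))
  exact mul_le_mul_of_nonneg_right (hC _).2 (norm_nonneg _)

theorem comp_left (hF : IsCbOneZero F) {χ : ℝ → ℝ} (hχ : ContDiff ℝ 1 χ) {C : ℝ}
    (hC : ∀ t, |χ t| ≤ C ∧ ‖fderiv ℝ χ t‖ ≤ C) (h0 : χ 0 = 0) : IsCbOneZero fun y => χ (F y) := by
  obtain ⟨hF1, ⟨C', hC'⟩, hF0⟩ := hF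
  refine ⟨hχ.comp hF1, ⟨max C (C * C'), fun y => ⟨(hC _).1.trans (le_max_left _ _), ?_⟩⟩,
    by simp [hF0, h0]⟩
  rw [fderiv_fun_comp y (hχ.differentiable one_ne_zero _) (hF1.differentiable one_ne_zero y)]
  refine (ContinuousLinearMap.opNorm_comp_le _ _).trans (le_trans ?_ (le_max_right _ _))
  exact mul_le_mul (hC _).2 (hC' _).2 (norm_nonneg _) ((norm_nonneg _).trans (hC 0).2)

theorem exists_sq_sub_le (hF : IsCbOneZero F) : ∃ K : ℝ, 0 ≤ K ∧
    ∀ a b, (F a - F b) ^ 2 ≤ K * ∑ i, (a i - b i) ^ 2 := by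
  obtain ⟨hF1, ⟨C, hC⟩, hF0⟩ := hF
  have hC0 : 0 ≤ C := (abs_nonneg _).trans (hC 0).1
  refine ⟨C ^ 2, by positivity, fun a b => ?_⟩
  have h1 := Convex.norm_image_sub_le_of_norm_fderiv_le (𝕜 := ℝ) (s := univ)
    (fun x _ => hF1.differentiable one_ne_zero x) (fun x _ => (hC x).2) convex_univ
    (mem_univ b) (mem_univ a)
  have h2 : ‖a - b‖ ≤ √(∑ i, (a i - b i) ^ 2) := by
    rw [pi_norm_le_iff_of_nonneg (Real.sqrt_nonneg _)]
    intro i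
    rw [Pi.sub_apply, Real.norm_eq_abs, ← Real.sqrt_sq_eq_abs]
    exact Real.sqrt_le_sqrt (Finset.single_le_sum (f := fun i => (a i - b i) ^ 2)
      (fun j _ => sq_nonneg _) (Finset.mem_univ i))
  have h3 : |F a - F b| ≤ C * √(∑ i, (a i - b i) ^ 2) :=
    h1.trans (mul_le_mul_of_nonneg_left h2 hC0)
  rw [← sq_abs]
  refine (pow_le_pow_left₀ (abs_nonneg _) h3 2).trans_eq ?_
  rw [mul_pow, Real.sq_sqrt (Finset.sum_nonneg fun i _ => sq_nonneg _)]

end IsCbOneZero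

/-- Used to bound approximating cylinder functions uniformly while leaving the values of their limit
unchanged. -/
theorem exists_smooth_truncation (M : ℝ) : ∃ (χ : ℝ → ℝ) (C : ℝ), ContDiff ℝ 1 χ ∧
    (∀ t, |χ t| ≤ C ∧ ‖fderiv ℝ χ t‖ ≤ C) ∧ χ 0 = 0 ∧ ∀ t, |t| ≤ M → χ t = t := by
  let b : ContDiffBump (0 : ℝ) := ⟨|M| + 1, |M| + 2, by positivity, by linarith⟩
  have h1 : ContDiff ℝ 1 fun t : ℝ => t * b t := contDiff_id.mul b.contDiff
  have h2 : HasCompactSupport fun t : ℝ => t * b t := b.hasCompactSupport.mul_left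
  obtain ⟨C, hC⟩ := h1.continuous.bounded_above_of_compact_support h2
  obtain ⟨C', hC'⟩ := (h1.continuous_fderiv one_ne_zero).bounded_above_of_compact_support
    (h2.fderiv ℝ)
  refine ⟨_, max C C', h1, fun t => ⟨(hC t).trans (le_max_left _ _),
    (hC' t).trans (le_max_right _ _)⟩, by simp, fun t ht => ?_⟩
  rw [b.one_of_mem_closedBall, mul_one]
  rw [mem_closedBall_zero_iff, Real.norm_eq_abs]
  change |t| ≤ |M| + 1
  linarith [le_abs_self M]

theorem exists_mul_ofReal_le {a η : ℝ≥0∞} (ha : a ≠ ∞) (hη : 0 < η) :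
    ∃ δ : ℝ, 0 < δ ∧ a * ENNReal.ofReal δ ≤ η := by
  have ht : Tendsto (fun n : ℕ => a * ENNReal.ofReal (1 / ((n : ℝ) + 1))) atTop (𝓝 0) := by
    have h1 := ENNReal.tendsto_ofReal tendsto_one_div_add_atTop_nhds_zero_nat
    simpa using ENNReal.Tendsto.const_mul h1 (Or.inr ha)
  obtain ⟨n, hn⟩ := (ht.eventually_lt_const hη).exists
  exact ⟨1 / ((n : ℝ) + 1), by positivity, hn.le⟩

section Cylinder

variable {X I : Type*} [TopologicalSpace X]

/-- The cylinder functions form a linear space. -/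
def cylinderSubmodule (φ : I → C_c(X, ℝ)) : Submodule ℝ C_c(X, ℝ) where
  carrier := cylinderFunctions φ
  zero_mem' := by
    refine ⟨0, Fin.elim0, fun _ => 0, ⟨contDiff_const, ⟨0, fun y => ?_⟩, rfl⟩, fun x => rfl⟩
    simp
  add_mem' := by
    rintro f g ⟨k, i, F, hF, hf⟩ ⟨l, j, G, hG, hg⟩
    let L₁ : (Fin (k + l) → ℝ) →L[ℝ] (Fin k → ℝ) :=
      ContinuousLinearMap.pi fun a => ContinuousLinearMap.proj (Fin.castAdd l a)
    let L₂ : (Fin (k + l) → ℝ) →L[ℝ] (Fin l → ℝ) :=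
      ContinuousLinearMap.pi fun a => ContinuousLinearMap.proj (Fin.natAdd k a)
    refine ⟨k + l, Fin.append i j, _, (hF.comp_clm L₁).add (hG.comp_clm L₂), fun x => ?_⟩
    rw [CompactlySupportedContinuousMap.coe_add, Pi.add_apply, hf, hg]
    congr 2 <;> ext a <;> simp [L₁, L₂]
  smul_mem' := by
    rintro c f ⟨k, i, F, hF, hf⟩
    exact ⟨k, i, _, hF.const_mul c, fun x => by simp [hf]⟩

theorem exists_truncation_mem_cylinder {φ : I → C_c(X, ℝ)} {f : C_c(X, ℝ)}
    (hf : f ∈ cylinderFunctions φ) {χ : ℝ → ℝ} (hχ : ContDiff ℝ 1 χ) {C : ℝ}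
    (hC : ∀ t, |χ t| ≤ C ∧ ‖fderiv ℝ χ t‖ ≤ C) (h0 : χ 0 = 0) :
    ∃ g ∈ cylinderFunctions φ, ∀ x, g x = χ (f x) := by
  obtain ⟨k, i, F, hF, hf⟩ := hf
  refine ⟨⟨⟨fun x => χ (f x), hχ.continuous.comp f.continuous⟩,
    f.hasCompactSupport.comp_left h0⟩, ⟨k, i, _, hF.comp_left hχ hC h0, fun x => ?_⟩, fun x => rfl⟩
  rw [← hf]; rfl

/-- These are the hypotheses of the contraction principle: the first is the mean value inequality
for F, the second is the same inequality against the origin, where F vanishes. -/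
theorem exists_contraction_of_mem_cylinder {φ : I → C_c(X, ℝ)} {f : C_c(X, ℝ)}
    (hf : f ∈ cylinderFunctions φ) : ∃ (k : ℕ) (i : Fin k → I) (K : ℝ), 0 ≤ K ∧
      (∀ x y, (f x - f y) ^ 2 ≤ K * ∑ j, (φ (i j) x - φ (i j) y) ^ 2) ∧
      ∀ x, f x ^ 2 ≤ K * ∑ j, φ (i j) x ^ 2 := by
  obtain ⟨k, i, F, hF, hf⟩ := hf
  obtain ⟨K, hK, hle⟩ := hF.exists_sq_sub_le
  refine ⟨k, i, K, hK, fun x y => ?_, fun x => ?_⟩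
  · rw [hf, hf]; exact hle _ _
  · rw [hf]
    simpa [hF.2.2] using hle (fun j => φ (i j) x) 0

end Cylinder

namespace SymmDirichletForm

/-! ### Capacity and pointwise convergence -/

section Capacity

variable {X : Type*} [TopologicalSpace X] [SecondCountableTopology X]
    [MeasurableSpace X] [BorelSpace X] {μ : Measure X} [IsFiniteMeasureOnCompacts μ]
    {E : SymmDirichletForm μ}

theorem energyOne_coreToDomain (f : E.core) :
    E.energyOne (E.coreToDomain f) = E.formCc f f + ‖ccToL2 μ f‖ ^ 2 := by
  rw [formCc_eq f.2 f.2]; rfl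

/-- The competitor is Σ_n 2^(n+N) r_{n+N}. Its terms have 𝓔₁-norm at most 2^(n+N) · 4^-(n+N), so it
converges with norm at most 2 · 2^-N. Being a sum of nonnegative terms, it dominates each of them,
hence is at least 1 wherever some r_{n+N} exceeds 2^-(n+N). -/
theorem capacityOpen_le_of_hasSum (r : ℕ → C_c(X, ℝ)) (hr : ∀ n, r n ∈ E.core)
    (hr0 : ∀ n x, 0 ≤ r n x) (N : ℕ)
    (hle : ∀ n, E.energyOne (E.coreToDomain ⟨r n, hr n⟩) ≤ ((1 / 4) ^ n) ^ 2) :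
    E.capacityOpen (⋃ n, {x | (1 / 2 : ℝ) ^ (n + N) < r (n + N) x})
      ≤ ENNReal.ofReal ((2 * (1 / 2) ^ N) ^ 2) := by
  let h : ℕ → E.Hil 0 := fun n =>
    (2 : ℝ) ^ (n + N) • (E.toDom 0).symm (E.coreToDomain ⟨r (n + N), hr (n + N)⟩)
  have hn (n : ℕ) : ‖h n‖ ≤ (1 / 2) ^ N * (1 / 2) ^ n := by
    have h1 : ‖(E.toDom 0).symm (E.coreToDomain ⟨r (n + N), hr (n + N)⟩)‖ ≤ (1 / 4) ^ (n + N) := by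
      refine le_of_sq_le_sq ?_ (by positivity)
      rw [hil_zero_norm_sq, LinearEquiv.apply_symm_apply]
      exact hle _
    rw [norm_smul, Real.norm_of_nonneg (by positivity), ← pow_add, add_comm N]
    refine (mul_le_mul_of_nonneg_left h1 (by positivity)).trans_eq ?_
    rw [← mul_pow]; norm_num
  have hgeo : HasSum (fun n : ℕ => (1 / 2 : ℝ) ^ N * (1 / 2) ^ n) ((1 / 2) ^ N * 2) :=
    hasSum_geometric_two.mul_left _
  have hsum : Summable h := Summable.of_norm_bounded hgeo.summable hn
  have hu : ‖∑' n, h n‖ ≤ (1 / 2) ^ N * 2 := tsum_of_norm_bounded hgeo hn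
  have hL := (E.hilIncl 0).hasSum hsum.hasSum
  have hLn (n : ℕ) : E.hilIncl 0 (h n) = (2 : ℝ) ^ (n + N) • ccToL2 μ (r (n + N)) := by
    simp only [h, map_smul]
    rfl
  have hcoe (n : ℕ) : ∀ᵐ x ∂μ, (E.hilIncl 0 (h n)) x = 2 ^ (n + N) * r (n + N) x := by
    rw [hLn]
    filter_upwards [Lp.coeFn_smul ((2 : ℝ) ^ (n + N)) (ccToL2 μ (r (n + N))),
      coeFn_ccToL2 (μ := μ) (r (n + N))] with x h1 h2
    rw [h1, Pi.smul_apply, h2, smul_eq_mul]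
  have hpos (n : ℕ) : 0 ≤ E.hilIncl 0 (h n) := by
    rw [← Lp.coeFn_nonneg]
    filter_upwards [hcoe n] with x hx
    rw [hx, Pi.zero_apply]
    have := hr0 (n + N) x
    positivity
  have hle' (n : ℕ) : E.hilIncl 0 (h n) ≤ E.hilIncl 0 (∑' n, h n) :=
    le_hasSum hL n fun j _ => hpos j
  refine (iInf₂_le (E.toDom 0 (∑' n, h n)) ?_).trans ?_
  · have h1 := eventually_countable_forall.2 fun n => (Lp.coeFn_le _ _).2 (hle' n)
    have h2 := eventually_countable_forall.2 hcoe
    filter_upwards [h1, h2] with x h1 h2 hx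
    obtain ⟨n, hn⟩ := mem_iUnion.1 hx
    have h3 := h1 n
    rw [h2 n] at h3
    have h4 : (1 : ℝ) ≤ 2 ^ (n + N) * r (n + N) x := by
      have h5 := mul_le_mul_of_nonneg_left (le_of_lt hn) (by positivity : (0 : ℝ) ≤ 2 ^ (n + N))
      rw [← mul_pow] at h5
      norm_num at h5
      simpa using h5
    exact h4.trans h3
  · rw [← hil_zero_norm_sq]
    refine ENNReal.ofReal_le_ofReal (pow_le_pow_left₀ (norm_nonneg _) (hu.trans_eq ?_) 2)
    ring

/-- Borel–Cantelli for capacity: the open sets where |g - f_n| > 2^-n for some n ≥ N have capacity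
tending to 0, so their intersection is m-null; off it |g - f_n| ≤ 2^-n from some index on. Passing
to |g - f_n| gives nonnegative functions without increasing 𝓔₁. -/
theorem ae_tendsto_of_energyOne_le [SigmaFinite μ] {m : Measure X}
    (hcap : ∀ B : Set X, E.capacity B = 0 → m B = 0)
    {g : C_c(X, ℝ)} (hg : g ∈ E.core) {f : ℕ → C_c(X, ℝ)} (hf : ∀ n, f n ∈ E.core)
    (hle : ∀ n, E.energyOne (E.coreToDomain ⟨g, hg⟩ - E.coreToDomain ⟨f n, hf n⟩)
      ≤ ((1 / 4) ^ n) ^ 2) :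
    ∀ᵐ x ∂m, Tendsto (fun n => f n x) atTop (𝓝 (g x)) := by
  let r : ℕ → C_c(X, ℝ) := fun n => ⟨⟨fun x => |g x - f n x|, by fun_prop⟩,
    (g - f n).hasCompactSupport.comp_left (g := fun t : ℝ => |t|) abs_zero⟩
  have hrd (n : ℕ) (x : X) : r n x = |(g - f n) x| := rfl
  have hd (n : ℕ) : g - f n ∈ E.core := E.core.sub_mem hg (hf n)
  have hr (n : ℕ) := abs_mem_core (hd n) (hrd n)
  have hle' (n : ℕ) : E.energyOne (E.coreToDomain ⟨r n, (hr n).1⟩) ≤ ((1 / 4) ^ n) ^ 2 := by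
    refine le_trans ?_ (hle n)
    have e : E.coreToDomain ⟨g, hg⟩ - E.coreToDomain ⟨f n, hf n⟩
      = E.coreToDomain ⟨g - f n, hd n⟩ := rfl
    rw [e, energyOne_coreToDomain, energyOne_coreToDomain]
    refine add_le_add (hr n).2 (pow_le_pow_left₀ (norm_nonneg _) ?_ 2)
    refine Lp.norm_le_norm_of_ae_le ?_
    filter_upwards [coeFn_ccToL2 (μ := μ) (r n), coeFn_ccToL2 (μ := μ) (g - f n)] with x h1 h2
    rw [h1, h2, hrd, Real.norm_eq_abs, Real.norm_eq_abs, abs_abs]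
  let A : ℕ → Set X := fun N => ⋃ n, {x | (1 / 2 : ℝ) ^ (n + N) < r (n + N) x}
  have hA (N : ℕ) : IsOpen (A N) :=
    isOpen_iUnion fun n => isOpen_lt continuous_const (r (n + N)).continuous
  have hB : m (⋂ N, A N) = 0 := by
    refine hcap _ (le_antisymm ?_ bot_le)
    have ht : Tendsto (fun N : ℕ => ENNReal.ofReal ((2 * (1 / 2 : ℝ) ^ N) ^ 2)) atTop (𝓝 0) := by
      rw [← ENNReal.ofReal_zero]
      refine ENNReal.tendsto_ofReal ?_
      have := ((tendsto_pow_atTop_nhds_zero_of_lt_one (by norm_num : (0 : ℝ) ≤ 1 / 2)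
        (by norm_num)).const_mul 2).pow 2
      simpa using this
    refine ge_of_tendsto' ht fun N => ?_
    refine (iInf_le_of_le (A N) (iInf₂_le_of_le (hA N) (iInter_subset _ N) le_rfl)).trans ?_
    exact capacityOpen_le_of_hasSum r (fun n => (hr n).1) (fun n x => abs_nonneg _) N hle'
  have : ∀ᵐ x ∂m, x ∉ ⋂ N, A N := measure_eq_zero_iff_ae_notMem.1 hB
  filter_upwards [this] with x hx
  simp only [A, mem_iInter, mem_iUnion, mem_ofPred_eq, not_forall, not_exists, not_lt] at hx
  obtain ⟨N, hN⟩ := hx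
  rw [tendsto_iff_norm_sub_tendsto_zero]
  refine squeeze_zero' (Eventually.of_forall fun n => norm_nonneg _) ?_
    (tendsto_pow_atTop_nhds_zero_of_lt_one (by norm_num : (0 : ℝ) ≤ 1 / 2) (by norm_num))
  filter_upwards [eventually_ge_atTop N] with n hn
  have := hN (n - N)
  rw [Nat.sub_add_cancel hn, hrd] at this
  rw [norm_sub_rev]
  exact this

end Capacity

/-! ### Bounded densities and density of cylinder functions in L_p -/

section CoreI

variable {X : Type*} [TopologicalSpace X] [T2Space X] [LocallyCompactSpace X]
    [SecondCountableTopology X]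
    [MeasurableSpace X] [BorelSpace X] {μ : Measure X} [IsFiniteMeasureOnCompacts μ]
    {E : SymmDirichletForm μ} {m : Measure X} [IsFiniteMeasure m] {I : Type*} {φ : I → C_c(X, ℝ)}

omit [T2Space X] [IsFiniteMeasure m] in
theorem cylinderFunctions_subset_core (hφ : E.IsContinuousCoordinates m φ) {f : C_c(X, ℝ)}
    (hf : f ∈ cylinderFunctions φ) : f ∈ E.core := by
  obtain ⟨k, i, K, hK, h1, h2⟩ := exists_contraction_of_mem_cylinder hf
  exact mem_core_of_contraction (u := fun j => φ (i j)) hK (fun j => hφ.mem_core (i j)) h1 h2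

/-- The comparison Γ(f) ≤ K Σ Γ(φ_i) transfers the L_∞ bounds from the coordinates to f. -/
theorem exists_energyDensity_le (hreg : E.IsRegular) (hdom : E.IsEnergyDominant m)
    (hφ : E.IsContinuousCoordinates m φ) {f : C_c(X, ℝ)} (hf : f ∈ cylinderFunctions φ) :
    ∃ C : ℝ, 0 ≤ C ∧ ∀ᵐ x ∂m, E.energyDensity m f f x ≤ C := by
  obtain ⟨k, i, K, hK, h1, h2⟩ := exists_contraction_of_mem_cylinder hf
  have hb (j : Fin k) : ∀ᵐ x ∂m, E.energyDensity m (φ (i j)) (φ (i j)) x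
      ≤ (eLpNorm (E.energyDensity m (φ (i j)) (φ (i j))) ∞ m).toReal := by
    have h := (hφ.density (i j) (i j)).2
    filter_upwards [ae_le_eLpNormEssSup (f := E.energyDensity m (φ (i j)) (φ (i j))) (μ := m)]
      with x hx
    refine (Real.le_norm_self _).trans ?_
    rw [← toReal_enorm]
    exact ENNReal.toReal_mono h.2.ne (by rwa [eLpNorm_exponent_top])
  refine ⟨K * ∑ j, (eLpNorm (E.energyDensity m (φ (i j)) (φ (i j))) ∞ m).toReal,
    by positivity, ?_⟩
  filter_upwards [energyDensity_le_sum hreg hdom (u := fun j => φ (i j)) hK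
    (fun j => hφ.mem_core (i j)) (cylinderFunctions_subset_core hφ hf) h1 h2,
    eventually_countable_forall.2 hb] with x a b
  exact a.trans (mul_le_mul_of_nonneg_left (Finset.sum_le_sum fun j _ => b j) hK)

omit [LocallyCompactSpace X] [T2Space X] [SecondCountableTopology X] in
theorem tendsto_eLpNorm_sub_of_bounded {p : ℝ≥0∞} (hp0 : p ≠ 0) (hp : p ≠ ∞) {f : ℕ → C_c(X, ℝ)}
    {g : C_c(X, ℝ)} {C : ℝ} (hC : ∀ n x, |f n x| ≤ C)
    (h : ∀ᵐ x ∂m, Tendsto (fun n => f n x) atTop (𝓝 (g x))) :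
    Tendsto (fun n => eLpNorm (fun x => g x - f n x) p m) atTop (𝓝 0) := by
  obtain ⟨M, hM0, hM⟩ := exists_bound_cc g
  have hpr : 0 < p.toReal := ENNReal.toReal_pos hp0 hp
  have key : Tendsto (fun n => ∫⁻ x, ‖g x - f n x‖ₑ ^ p.toReal ∂m) atTop (𝓝 (∫⁻ _, 0 ∂m)) := by
    refine tendsto_lintegral_of_dominated_convergence
      (fun _ => ENNReal.ofReal (M + C) ^ p.toReal) (fun n => by fun_prop)
      (fun n => Eventually.of_forall fun x => ?_) ?_ ?_
    · refine ENNReal.rpow_le_rpow ?_ hpr.le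
      rw [Real.enorm_eq_ofReal_abs]
      exact ENNReal.ofReal_le_ofReal ((abs_sub _ _).trans (add_le_add (hM x) (hC n x)))
    · rw [lintegral_const]
      exact ENNReal.mul_ne_top (ENNReal.rpow_ne_top_of_nonneg hpr.le ENNReal.ofReal_ne_top)
        (by simp)
    · filter_upwards [h] with x hx
      have h1 := ((tendsto_const_nhds (x := g x)).sub hx).enorm
      have h2 := (ENNReal.continuous_rpow_const (y := p.toReal)).tendsto _ |>.comp h1
      simpa [hpr, Function.comp_def] using h2
  simp only [eLpNorm_eq_lintegral_rpow_enorm_toReal hp0 hp]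
  have h3 := (ENNReal.continuous_rpow_const (y := 1 / p.toReal)).tendsto _ |>.comp key
  simpa [hpr, Function.comp_def] using h3

omit [T2Space X] in
theorem exists_cylinder_eLpNorm_sub_lt (hcap : ∀ B : Set X, E.capacity B = 0 → m B = 0)
    (hφ : E.IsContinuousCoordinates m φ) {p : ℝ≥0∞} (hp0 : p ≠ 0) (hp : p ≠ ∞) {g : C_c(X, ℝ)}
    (hg : g ∈ E.core) {ε : ℝ≥0∞} (hε : 0 < ε) :
    ∃ f ∈ cylinderFunctions φ, eLpNorm (fun x => g x - f x) p m < ε := by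
  have hch (n : ℕ) := hφ.dense ⟨g, hg⟩ (((1 / 4 : ℝ) ^ n) ^ 2) (by positivity)
  choose f hfc hfe using hch
  obtain ⟨M, hM0, hM⟩ := exists_bound_cc g
  -- χ is the identity on the range of g, so χ ∘ f_n still tends to χ ∘ g = g, now with a uniform
  -- bound allowing dominated convergence.
  obtain ⟨χ, C, hχ, hC, h0, hid⟩ := exists_smooth_truncation M
  have hch' (n : ℕ) := exists_truncation_mem_cylinder (hfc n) hχ hC h0
  choose f' hf' hf'e using hch'
  have ht := ae_tendsto_of_energyOne_le hcap hg (fun n => (f n).2) (fun n => (hfe n).le)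
  have ht' : ∀ᵐ x ∂m, Tendsto (fun n => f' n x) atTop (𝓝 (g x)) := by
    filter_upwards [ht] with x hx
    have := (hχ.continuous.tendsto (g x)).comp hx
    rw [hid _ (hM x)] at this
    simpa only [hf'e, Function.comp_def] using this
  have := tendsto_eLpNorm_sub_of_bounded hp0 hp (fun n x => by rw [hf'e]; exact (hC _).1) ht'
  obtain ⟨n, hn⟩ := (this.eventually_lt_const hε).exists
  exact ⟨f' n, hf' n, hn⟩

/-- Three approximations, each within η: h by a function in C_c(X), that one by an element of 𝓒
uniformly (enough because m is finite), and the latter by a cylinder function. -/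
theorem cylinderFunctions_dense_Lp (hreg : E.IsRegular)
    (hcap : ∀ B : Set X, E.capacity B = 0 → m B = 0)
    (hφ : E.IsContinuousCoordinates m φ) {p : ℝ≥0∞} (hp1 : 1 ≤ p) (hp : p ≠ ∞) {h : X → ℝ}
    (hh : MemLp h p m) {ε : ℝ≥0∞} (hε : 0 < ε) :
    ∃ f ∈ cylinderFunctions φ, eLpNorm (fun x => h x - f x) p m < ε := by
  have hp0 : p ≠ 0 := (zero_lt_one.trans_le hp1).ne'
  have := measure_regular m
  obtain ⟨η, hη, hη3⟩ : ∃ η : ℝ≥0∞, 0 < η ∧ η + η + η ≤ ε :=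
    ⟨ε / 3, ENNReal.div_pos hε.ne' (by norm_num), (ENNReal.add_thirds ε).le⟩
  obtain ⟨g₀, hg₀s, hg₀, hg₀c, -⟩ := hh.exists_hasCompactSupport_eLpNorm_sub_le hp hη.ne'
  let g : C_c(X, ℝ) := ⟨⟨g₀, hg₀c⟩, hg₀s⟩
  obtain ⟨δ, hδ0, hδ⟩ := exists_mul_ofReal_le
    (ENNReal.rpow_ne_top_of_nonneg (by positivity) (by simp) : m univ ^ p.toReal⁻¹ ≠ ∞) hη
  obtain ⟨g', hg', hgg'⟩ := hreg.2 g δ hδ0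
  obtain ⟨f, hf, hf'⟩ := exists_cylinder_eLpNorm_sub_lt hcap hφ hp0 hp hg' hη
  refine ⟨f, hf, ?_⟩
  have a1 : eLpNorm (fun x => g x - g' x) p m ≤ η :=
    (eLpNorm_le_of_ae_bound (Eventually.of_forall fun x => (hgg' x).le)).trans hδ
  have m1 : AEStronglyMeasurable (h - g₀) m :=
    hh.1.sub hg₀c.aestronglyMeasurable
  have m2 : AEStronglyMeasurable (fun x => g x - g' x) m :=
    (g.continuous.sub g'.continuous).aestronglyMeasurable
  have m3 : AEStronglyMeasurable (fun x => g' x - f x) m :=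
    (g'.continuous.sub f.continuous).aestronglyMeasurable
  have e : (fun x => h x - f x) = (h - g₀) + ((fun x => g x - g' x) + fun x => g' x - f x) := by
    ext x
    have : g x = g₀ x := rfl
    simp only [Pi.add_apply, Pi.sub_apply, this]
    ring
  rw [e]
  refine (eLpNorm_add_le m1 (m2.add m3) hp1).trans_lt ?_
  refine (add_le_add_right (eLpNorm_add_le m2 m3 hp1) _).trans_lt ?_
  refine lt_of_lt_of_le ?_ hη3
  rw [add_assoc]
  have hfin : eLpNorm (h - g₀) p m ≠ ∞ := by
    have : MemLp g₀ p m := hg₀c.memLp_of_hasCompactSupport hg₀s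
    exact (hh.sub this).2.ne
  have hfin2 : eLpNorm (fun x => g x - g' x) p m ≠ ∞ :=
    ((g - g').continuous.memLp_of_hasCompactSupport (g - g').hasCompactSupport).2.ne
  exact ENNReal.add_lt_add_of_le_of_lt hfin hg₀ (ENNReal.add_lt_add_of_le_of_lt hfin2 a1 hf')

end CoreI

end SymmDirichletForm

namespace SymmDirichletForm

namespace FiberChoice

/-! ### Approximation of measurable sections from a fiberwise dense family -/

section Approximation

variable {X : Type*} [TopologicalSpace X] [SecondCountableTopology X]
    [MeasurableSpace X] [BorelSpace X] {μ : Measure X} [IsFiniteMeasureOnCompacts μ]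
    {E : SymmDirichletForm μ} {m : Measure X} {D : E.FiberChoice m} {p : ℝ≥0∞}
    {S : Submodule ℝ (∀ x, D.Fiber x)}

/-- The measurable section `v` lies in the `L_p`-closure of `S`. -/
def IsApproximable (D : E.FiberChoice m) (p : ℝ≥0∞) (S : Submodule ℝ (∀ x, D.Fiber x))
    (v : ∀ x, D.Fiber x) : Prop :=
  D.IsMeasurableSection v ∧
    ∀ ε : ℝ≥0∞, 0 < ε → ∃ s ∈ S, D.secNorm p (fun x => v x - s x) < ε

namespace IsApproximable

theorem zero : D.IsApproximable p S fun _ => 0 :=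
  ⟨IsMeasurableSection.zero, fun ε hε => ⟨0, S.zero_mem, by simpa [secNorm] using hε⟩⟩

theorem add (hp : 1 ≤ p) (hS : ∀ s ∈ S, D.IsMeasurableSection s) {v w : ∀ x, D.Fiber x}
    (hv : D.IsApproximable p S v) (hw : D.IsApproximable p S w) :
    D.IsApproximable p S fun x => v x + w x := by
  refine ⟨hv.1.add hw.1, fun ε hε => ?_⟩
  obtain ⟨s, hs, hs'⟩ := hv.2 (ε / 2) (ENNReal.half_pos hε.ne')
  obtain ⟨t, ht, ht'⟩ := hw.2 (ε / 2) (ENNReal.half_pos hε.ne')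
  refine ⟨s + t, S.add_mem hs ht, ?_⟩
  have h := secNorm_add_le hp (hv.1.sub (hS s hs)) (hw.1.sub (hS t ht))
  have e : (fun x => v x - s x + (w x - t x)) = fun x => v x + w x - (s + t) x := by
    ext x; simp only [Pi.add_apply]; abel
  rw [e] at h
  exact h.trans_lt ((ENNReal.add_lt_add hs' ht').trans_eq (ENNReal.add_halves ε))

theorem finsetSum (hp : 1 ≤ p) (hS : ∀ s ∈ S, D.IsMeasurableSection s) {ι : Type*} (s : Finset ι)
    {v : ι → ∀ x, D.Fiber x} (hv : ∀ i ∈ s, D.IsApproximable p S (v i)) :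
    D.IsApproximable p S fun x => ∑ i ∈ s, v i x := by
  classical
  induction s using Finset.induction_on with
  | empty => simpa using zero
  | insert a s ha ih =>
    simp only [Finset.sum_insert ha]
    exact add hp hS (hv a (Finset.mem_insert_self a s))
      (ih fun i hi => hv i (Finset.mem_insert_of_mem hi))

end IsApproximable

/-- Rational combinations of the `e i` form a countable family, dense in almost every fiber.
Choosing at each x the first one within δ of v(x) is a measurable choice. Keeping finitely many of
the resulting pieces gives a finite sum of sections 1_A c e_i, and the rest is small by
integrability. -/
theorem isApproximable_of_dense_span [IsFiniteMeasure m] (hp1 : 1 ≤ p) (hp : p ≠ ∞)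
    (hS : ∀ s ∈ S, D.IsMeasurableSection s) {ι : Type*} [Countable ι] {e : ι → ∀ x, D.Fiber x}
    (he : ∀ i, D.IsMeasurableSection (e i))
    (hd : ∀ᵐ x ∂m, Dense (Submodule.span ℝ (range fun i => e i x) : Set (D.Fiber x)))
    (happ : ∀ i (A : Set X) (c : ℝ), MeasurableSet A →
      D.IsApproximable p S fun x => A.indicator (fun _ => c) x • e i x)
    {v : ∀ x, D.Fiber x} (hv : D.MemLpSection p v) : D.IsApproximable p S v := by
  classical
  refine ⟨hv.1, fun ε hε => ?_⟩
  obtain ⟨q, hq⟩ := exists_surjective_nat (ι →₀ ℚ)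
  let s : ℕ → ∀ x, D.Fiber x := fun k x => (q k).sum fun i a => (a : ℝ) • e i x
  have hsm (k : ℕ) : D.IsMeasurableSection (s k) := by
    simp only [s, Finsupp.sum]
    induction (q k).support using Finset.induction_on with
    | empty => simpa using IsMeasurableSection.zero
    | insert a t ha ih =>
      simp only [Finset.sum_insert ha]
      exact ((he a).smul measurable_const).add ih
  obtain ⟨η, hη, hηt, hη3⟩ : ∃ η : ℝ≥0∞, 0 < η ∧ η ≠ ∞ ∧ η + η + η ≤ ε := by
    refine ⟨min (ε / 3) 1, lt_min (ENNReal.div_pos hε.ne' (by norm_num)) one_pos,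
      (min_le_right _ _).trans_lt ENNReal.one_lt_top |>.ne, ?_⟩
    have h : min (ε / 3) 1 ≤ ε / 3 := min_le_left _ _
    exact (add_le_add (add_le_add h h) h).trans (ENNReal.add_thirds ε).le
  obtain ⟨δ, hδ0, hδ⟩ := exists_mul_ofReal_le
    (ENNReal.rpow_ne_top_of_nonneg (by positivity) (by simp) : m univ ^ p.toReal⁻¹ ≠ ∞) hη
  obtain ⟨η', hη'0, hη'⟩ := exists_mul_ofReal_le ENNReal.one_ne_top hη
  rw [one_mul] at hη'
  let B : ℕ → Set X := fun k => {x | ‖v x - s k x‖ < δ}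
  have hB (k : ℕ) : MeasurableSet (B k) :=
    measurableSet_lt (hv.1.sub (hsm k)).norm measurable_const
  have hBu : ∀ᵐ x ∂m, ∃ k, x ∈ B k := by
    filter_upwards [hd] with x hx
    obtain ⟨r, hr⟩ := (denseRange_rat_combination _ hx).exists_dist_lt (v x) hδ0
    obtain ⟨k, rfl⟩ := hq r
    exact ⟨k, by rwa [dist_eq_norm] at hr⟩
  -- On `A k`, the first combination within δ of v is `s k`; `R M` is the set where none of the
  -- first M combinations qualifies.
  let A : ℕ → Set X := disjointed B
  have hA (k : ℕ) : MeasurableSet (A k) := MeasurableSet.disjointed hB k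
  let R : ℕ → Set X := fun M => (⋃ k ∈ Finset.range M, A k)ᶜ
  have hR (M : ℕ) : MeasurableSet (R M) :=
    (Finset.measurableSet_biUnion _ fun k _ => hA k).compl
  have hRt : Tendsto (fun M => m (R M)) atTop (𝓝 0) := by
    have hanti : Antitone R := fun M M' hM => compl_subset_compl.2
      (biUnion_subset_biUnion_left (Finset.coe_subset.2 (Finset.range_mono hM)))
    have h1 := tendsto_measure_iInter_atTop (μ := m) (fun M => (hR M).nullMeasurableSet) hanti
      ⟨0, measure_ne_top _ _⟩
    have h2 : m (⋂ M, R M) = 0 := by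
      rw [measure_eq_zero_iff_ae_notMem]
      filter_upwards [hBu] with x hx hxR
      have : x ∈ ⋃ k, A k := by rw [iUnion_disjointed]; exact mem_iUnion.2 hx
      obtain ⟨k, hk⟩ := mem_iUnion.1 this
      refine mem_iInter.1 hxR (k + 1) ?_
      simp only [mem_iUnion]
      exact ⟨k, Finset.self_mem_range_succ k, hk⟩
    rwa [h2] at h1
  -- Absolute continuity of the integral of ‖v‖^p makes v negligible on `R M`, whose measure tends
  -- to 0.
  obtain ⟨θ, hθ, hle⟩ := hv.memLp_norm.eLpNorm_indicator_le hp1 hp hη'0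
  obtain ⟨M, hM⟩ := (hRt.eventually_le_const (ENNReal.ofReal_pos.2 hθ)).exists
  let w : ∀ x, D.Fiber x := fun x => ∑ k ∈ Finset.range M, ∑ i ∈ (q k).support,
    (A k).indicator (fun _ => (q k i : ℝ)) x • e i x
  have hw : D.IsApproximable p S w :=
    IsApproximable.finsetSum hp1 hS _ fun k _ => IsApproximable.finsetSum hp1 hS _ fun i _ =>
      happ i (A k) _ (hA k)
  have hws (x : X) : ‖v x - w x‖ ≤ δ + (R M).indicator (fun x => ‖v x‖) x := by
    by_cases hx : x ∈ R M
    · have h0 : w x = 0 := by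
        refine Finset.sum_eq_zero fun k hk => Finset.sum_eq_zero fun i _ => ?_
        have : x ∉ A k := fun h => hx (by simp only [mem_iUnion]; exact ⟨k, hk, h⟩)
        rw [indicator_of_notMem this, zero_smul]
      rw [h0, sub_zero, indicator_of_mem hx]
      linarith
    · simp only [R, mem_compl_iff, not_not, mem_iUnion] at hx
      obtain ⟨k, hk, hxk⟩ := hx
      have h0 : w x = s k x := by
        simp only [w, s, Finsupp.sum]
        rw [Finset.sum_eq_single k]
        · simp [hxk]
        · intro j _ hj
          have : x ∉ A j := fun h =>
            disjoint_left.1 (disjoint_disjointed B hj) h hxk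
          simp [this]
        · exact fun h => (h hk).elim
      have h1 : x ∈ B k := disjointed_subset B k hxk
      have h2 : 0 ≤ (R M).indicator (fun x => ‖v x‖) x :=
        indicator_nonneg (fun _ _ => norm_nonneg _) x
      rw [h0]
      have h3 : ‖v x - s k x‖ < δ := h1
      linarith
  obtain ⟨t, ht, ht'⟩ := hw.2 η hη
  refine ⟨t, ht, ?_⟩
  have h1 : D.secNorm p (fun x => v x - w x) ≤ η + η := by
    have h2 : eLpNorm (fun x => ‖v x - w x‖) p m
        ≤ eLpNorm ((fun _ => δ) + (R M).indicator fun x => ‖v x‖) p m := by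
      refine eLpNorm_mono fun x => ?_
      rw [norm_norm]
      exact (hws x).trans (Real.le_norm_self _)
    refine h2.trans ((eLpNorm_add_le aestronglyMeasurable_const
      (hv.1.norm.indicator (hR M)).aestronglyMeasurable hp1).trans ?_)
    refine add_le_add ?_ ((hle _ (hR M) hM).trans hη')
    exact (eLpNorm_le_of_ae_bound (Eventually.of_forall fun x =>
      (Real.norm_of_nonneg hδ0.le).le)).trans hδ
  refine (secNorm_sub_le hp1 hv.1 hw.1 (hS t ht)).trans_lt (lt_of_lt_of_le ?_ hη3)
  refine ENNReal.add_lt_add_of_le_of_lt ?_ h1 ht'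
  exact (h1.trans_lt (ENNReal.add_lt_top.2 ⟨hηt.lt_top, hηt.lt_top⟩)).ne

end Approximation

end FiberChoice

end SymmDirichletForm

namespace SymmDirichletForm

namespace FiberChoice

/-! ### Simple fields of cylinder functions -/

section SimpleFields

variable {X : Type*} [TopologicalSpace X] [T2Space X] [LocallyCompactSpace X]
    [SecondCountableTopology X]
    [MeasurableSpace X] [BorelSpace X] {μ : Measure X} [IsFiniteMeasureOnCompacts μ]
    {E : SymmDirichletForm μ} {m : Measure X} [IsFiniteMeasure m] {I : Type*} {φ : I → C_c(X, ℝ)}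
    {D : E.FiberChoice m} {p : ℝ≥0∞}

theorem exists_norm_partialSection_le (hreg : E.IsRegular) (hdom : E.IsEnergyDominant m)
    (hφ : E.IsContinuousCoordinates m φ) {f : C_c(X, ℝ)} (hf : f ∈ cylinderFunctions φ) :
    ∃ C : ℝ, 0 ≤ C ∧ ∀ᵐ x ∂m, ‖D.partialSection f x‖ ≤ C := by
  obtain ⟨C, hC, hle⟩ := exists_energyDensity_le hreg hdom hφ hf
  have hfc := cylinderFunctions_subset_core hφ hf
  refine ⟨√C, Real.sqrt_nonneg C, ?_⟩
  filter_upwards [hle, (isDifferential_partialSection (D := D) hreg hdom hfc).norm_ae_eq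
    hreg hdom hfc] with x h1 h2
  rw [h2]
  exact Real.sqrt_le_sqrt h1

theorem isMeasurableSection_partialSection (hreg : E.IsRegular) (hdom : E.IsEnergyDominant m)
    (hφ : E.IsContinuousCoordinates m φ) {f : C_c(X, ℝ)} (hf : f ∈ cylinderFunctions φ) :
    D.IsMeasurableSection (D.partialSection f) :=
  (isDifferential_partialSection hreg hdom (cylinderFunctions_subset_core hφ hf)).1.1

omit [T2Space X] [LocallyCompactSpace X] [IsFiniteMeasure m] in
theorem secNorm_smul_le {v : ∀ x, D.Fiber x} {C : ℝ} (hv : ∀ᵐ x ∂m, ‖v x‖ ≤ C) (h : X → ℝ) :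
    D.secNorm p (fun x => h x • v x) ≤ ENNReal.ofReal C * eLpNorm h p m := by
  refine eLpNorm_le_mul_eLpNorm_of_ae_le_mul ?_ p
  filter_upwards [hv] with x hx
  rw [norm_norm, norm_smul, mul_comm]
  exact mul_le_mul_of_nonneg_right hx (norm_nonneg _)

theorem memLpSection_of_mem_simpleFields (hreg : E.IsRegular) (hdom : E.IsEnergyDominant m)
    (hφ : E.IsContinuousCoordinates m φ) (hp : 1 ≤ p) {s : ∀ x, D.Fiber x}
    (hs : s ∈ D.simpleFields (cylinderFunctions φ)) : D.MemLpSection p s := by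
  induction hs using Submodule.span_induction with
  | mem s hs =>
    obtain ⟨f, hf, g, -, rfl⟩ := hs
    obtain ⟨C, -, hC⟩ := exists_norm_partialSection_le (D := D) hreg hdom hφ hf
    refine ⟨(isMeasurableSection_partialSection hreg hdom hφ hf).smul g.continuous.measurable,
      (secNorm_smul_le hC g).trans_lt (ENNReal.mul_lt_top ENNReal.ofReal_lt_top ?_)⟩
    exact (g.continuous.memLp_of_hasCompactSupport g.hasCompactSupport).2
  | zero => exact MemLpSection.zero
  | add s t _ _ hs ht => exact hs.add hp ht
  | smul c s _ hs => exact hs.const_smul c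

theorem isApproximable_smul_partialSection (hreg : E.IsRegular) (hdom : E.IsEnergyDominant m)
    (hcap : ∀ B : Set X, E.capacity B = 0 → m B = 0)
    (hφ : E.IsContinuousCoordinates m φ) (hp1 : 1 ≤ p) (hp : p ≠ ∞) {f : C_c(X, ℝ)}
    (hf : f ∈ cylinderFunctions φ) {h : X → ℝ} (hhm : Measurable h) (hh : MemLp h p m) :
    D.IsApproximable p (D.simpleFields (cylinderFunctions φ))
      fun x => h x • D.partialSection f x := by
  refine ⟨(isMeasurableSection_partialSection hreg hdom hφ hf).smul hhm, fun ε hε => ?_⟩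
  obtain ⟨C, -, hC⟩ := exists_norm_partialSection_le (D := D) hreg hdom hφ hf
  -- As ‖∂f‖ ≤ C almost everywhere, the error (h - g) ∂f has norm at most C ‖h - g‖_p, so scalar
  -- density suffices.
  obtain ⟨g, hg, hlt⟩ := cylinderFunctions_dense_Lp hreg hcap hφ hp1 hp hh
    (ENNReal.div_pos hε.ne' (by simp) : 0 < ε / (ENNReal.ofReal C + 1))
  refine ⟨_, Submodule.subset_span ⟨f, hf, g, hg, rfl⟩, ?_⟩
  simp only [← sub_smul]
  refine (secNorm_smul_le hC _).trans_lt (lt_of_le_of_lt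
    (mul_le_mul_left (le_self_add : _ ≤ ENNReal.ofReal C + 1) _) ?_)
  rw [mul_comm]
  exact ENNReal.mul_lt_of_lt_div hlt

/-- For each f_n take cylinder functions g_{n,k} within 2^-k in 𝓔₁-norm. Then ∂g_{n,k} → d f_n in
L², hence almost everywhere along a subsequence, so for almost every x the closed span contains all
d_x f_n, whose span is dense in the fiber. -/
theorem exists_cylinder_dense_span (hreg : E.IsRegular) (hdom : E.IsEnergyDominant m)
    (hφ : E.IsContinuousCoordinates m φ) :
    ∃ g : ℕ × ℕ → C_c(X, ℝ), (∀ i, g i ∈ cylinderFunctions φ) ∧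
      ∀ᵐ x ∂m, Dense (Submodule.span ℝ (range fun i => D.partialSection (g i) x) :
        Set (D.Fiber x)) := by
  have hch (i : ℕ × ℕ) := hφ.dense ⟨D.fn i.1, D.fn_mem i.1⟩ (((1 / 2 : ℝ) ^ i.2) ^ 2)
    (by positivity)
  choose g hg hlt using hch
  refine ⟨fun i => g i, hg, ?_⟩
  have hω (i : ℕ × ℕ) := isDifferential_partialSection (D := D) hreg hdom (g i).2
  have hsec (n k : ℕ) : eLpNorm (fun x => ‖D.partialSection (g (n, k)) x
      - D.diff (Finsupp.single n 1) x‖) 2 m ≤ ENNReal.ofReal ((1 / 2) ^ k) := by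
    refine ((hω (n, k)).secNorm_sub_diff_le hreg hdom (g (n, k)).2 _).trans
      (ENNReal.ofReal_le_ofReal ?_)
    rw [comb_single, ← neg_sub,
      sqrtEnergy_neg hreg (E.core.sub_mem (D.fn_mem n) (g (n, k)).2)]
    refine (sqrtEnergy_le hreg (E.core.sub_mem (D.fn_mem n) (g (n, k)).2)).trans ?_
    rw [Real.sqrt_le_left (by positivity)]
    refine le_trans ?_ (hlt (n, k)).le
    change _ ≤ E.energyOne (E.coreToDomain (⟨D.fn n, D.fn_mem n⟩ - g (n, k)))
    rw [energyOne_coreToDomain]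
    exact le_add_of_nonneg_right (sq_nonneg _)
  have hcl (n : ℕ) : ∀ᵐ x ∂m, D.diff (Finsupp.single n 1) x
      ∈ closure (range fun i => D.partialSection (g i) x) := by
    have hm (k : ℕ) : AEStronglyMeasurable (fun x => ‖D.partialSection (g (n, k)) x
        - D.diff (Finsupp.single n 1) x‖) m :=
      ((hω (n, k)).1.1.sub (isMeasurableSection_diff _)).norm.aestronglyMeasurable
    have ht : Tendsto (fun k => eLpNorm ((fun x => ‖D.partialSection (g (n, k)) x
        - D.diff (Finsupp.single n 1) x‖) - fun _ => (0 : ℝ)) 2 m) atTop (𝓝 0) := by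
      refine tendsto_of_tendsto_of_tendsto_of_le_of_le tendsto_const_nhds
        (h := fun k : ℕ => ENNReal.ofReal ((1 / 2) ^ k)) ?_ (fun _ => zero_le) fun k => ?_
      · simpa using ENNReal.tendsto_ofReal (tendsto_pow_atTop_nhds_zero_of_lt_one
          (by norm_num : (0 : ℝ) ≤ 1 / 2) (by norm_num))
      · have e : ((fun x => ‖D.partialSection (g (n, k)) x - D.diff (Finsupp.single n 1) x‖)
            - fun _ => (0 : ℝ)) = _ := sub_zero _
        rw [e]
        exact hsec n k
    obtain ⟨ns, -, hns⟩ := (tendstoInMeasure_of_tendsto_eLpNorm two_ne_zero hm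
      aestronglyMeasurable_const ht).exists_seq_tendsto_ae
    filter_upwards [hns] with x hx
    exact mem_closure_of_tendsto (tendsto_iff_norm_sub_tendsto_zero.2 hx)
      (Eventually.of_forall fun k => mem_range_self (n, ns k))
  filter_upwards [ae_all_iff.2 hcl] with x hx
  have hle : Submodule.span ℝ (range fun n => D.diff (Finsupp.single n 1) x)
      ≤ (Submodule.span ℝ (range fun i => D.partialSection (g i) x)).topologicalClosure := by
    refine Submodule.span_le.2 ?_
    rintro _ ⟨n, rfl⟩
    exact closure_mono Submodule.subset_span (hx n)
  exact dense_closure.1 ((D.dense_span_diff x).mono hle)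

theorem isDenseSubspace_simpleFields (hreg : E.IsRegular) (hdom : E.IsEnergyDominant m)
    (hcap : ∀ B : Set X, E.capacity B = 0 → m B = 0)
    (hφ : E.IsContinuousCoordinates m φ) (hp1 : 1 ≤ p) (hp : p ≠ ∞) :
    D.IsDenseSubspace p (D.simpleFields (cylinderFunctions φ)) := by
  have hS := fun s hs => memLpSection_of_mem_simpleFields (D := D) (s := s) hreg hdom hφ hp1 hs
  refine ⟨hS, fun v hv => ?_⟩
  obtain ⟨g, hg, hd⟩ := exists_cylinder_dense_span (D := D) hreg hdom hφ
  refine (isApproximable_of_dense_span hp1 hp (fun s hs => (hS s hs).1)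
    (fun i => isMeasurableSection_partialSection hreg hdom hφ (hg i)) hd
    (fun i A c hA => ?_) hv).2
  exact isApproximable_smul_partialSection hreg hdom hcap hφ hp1 hp (hg i)
    (measurable_const.indicator hA) ((memLp_const c).indicator hA)

theorem isLpCore_cylinderSubmodule (hreg : E.IsRegular) (hdom : E.IsEnergyDominant m)
    (hcap : ∀ B : Set X, E.capacity B = 0 → m B = 0)
    (hφ : E.IsContinuousCoordinates m φ) (hp1 : 1 ≤ p) (hp : p ≠ ∞) :
    D.IsLpCore p (cylinderSubmodule φ) where
  le_core _ hf := cylinderFunctions_subset_core hφ hf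
  memLp f _ := f.continuous.memLp_of_hasCompactSupport f.hasCompactSupport
  coreI _ hh _ hε := cylinderFunctions_dense_Lp hreg hcap hφ hp1 hp hh hε
  coreII := isDenseSubspace_simpleFields hreg hdom hcap hφ hp1 hp
  coreIII f hf := by
    have hfc := cylinderFunctions_subset_core hφ hf
    obtain ⟨C, hC, hle⟩ := exists_energyDensity_le hreg hdom hφ hf
    -- A bounded function on a finite measure space is in L_{p/2}, including when p/2 < 1.
    refine ⟨hdom f hfc, MemLp.of_bound (measurable_energyDensity f f).aestronglyMeasurable C ?_⟩
    filter_upwards [hle, energyDensity_self_nonneg hreg hdom hfc] with x h1 h2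
    rwa [Real.norm_of_nonneg h2]

end SimpleFields

end FiberChoice

end SymmDirichletForm

theorem mainTheorem7 {X : Type*} [TopologicalSpace X] [T2Space X] [LocallyCompactSpace X]
    [SecondCountableTopology X] [MeasurableSpace X] [BorelSpace X]
    (μ : Measure X) [IsFiniteMeasureOnCompacts μ] [μ.IsOpenPosMeasure]
    (E : SymmDirichletForm μ) (hreg : E.IsRegular) (hloc : E.IsLocal)
    (m : Measure X) [IsFiniteMeasure m] [m.IsOpenPosMeasure]
    (hdom : E.IsEnergyDominant m)
    (hcap : ∀ B : Set X, E.capacity B = 0 → m B = 0)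
    {I : Type*} (φ : I → C_c(X, ℝ)) (hφ : E.IsContinuousCoordinates m φ)
    (D : E.FiberChoice m) (p : ℝ≥0∞) (hp : 1 < p) (hp' : p < ∞) :
    D.IsDenseSubspace p (D.simpleFields (cylinderFunctions φ)) ∧
    ∃ Cp : Submodule ℝ C_c(X, ℝ),
      (Cp : Set C_c(X, ℝ)) = cylinderFunctions φ ∧ D.IsLpCore p Cp :=
  ⟨SymmDirichletForm.FiberChoice.isDenseSubspace_simpleFields hreg hdom hcap hφ hp.le hp'.ne,
    cylinderSubmodule φ, rfl,
    SymmDirichletForm.FiberChoice.isLpCore_cylinderSubmodule hreg hdom hcap hφ hp.le hp'.ne⟩
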